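/- **Notation.** Functions on $[0,2\pi]$ are extended $2\pi$-periodically. $H^k_{per}$ ($k=1,2$) are the periodic Sobolev spaces, $C^\infty_{per}$ the smooth periodic functions, $H^{-1}_{per}$ the dual of $H^1_{per}([0,2\pi])$, and $H^2_{imm}$ the set of $\gamma\in H^2_{per}([0,2\pi];\mathbb R^2)$ with $\partial_x\gamma\neq0$ everywhere. Along $\gamma\in H^2_{imm}$ put $\partial_s=|\partial_x\gamma|^{-1}\partial_x$, $ds=|\partial_x\gamma|\,dx$, $\tau=\partial_s\gamma$, $\nu=J\tau$ ($J$ the counterclockwise rotation by $\pi/2$), $\partial_s\tau=\kappa\nu$, $\operatorname{div}_\gamma\eta=\langle\partial_s\eta,\tau\rangle$, $\nabla_\gamma\eta=\partial_s\eta\otimes\tau$, $L(\gamma)=\int_0^{2\pi}|\partial_x\gamma|\,dx$, $A(\gamma)=-\frac12\int_0^{2\pi}\langle\gamma,J\partial_x\gamma\rangle\,dx$, and for $\delta,\lambda\in\mathbb R$ $$E(\gamma,\eta)=\tfrac12\int_\gamma(\kappa+\delta\operatorname{div}_\gamma\eta)^2\,ds+\tfrac\lambda2\int_\gamma|\nabla_\gamma\eta|^2\,ds,\qquad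 E_{LM}=E+L .$$ The constraints are (L) $L(\gamma)=L_0$, (A) $A(\gamma)=A_0$, (S) $S(\eta):=|\eta|^2-1=0$. A pair $(\gamma,\eta)\in H^2_{imm}\times H^1_{per}([0,2\pi];\mathbb R^2)$ is a critical point of $\Phi\in\{E_{LM},E\}$ subject to some of these constraints if it satisfies them and the first variation of $\Phi$ vanishes in every direction $(\varphi,\psi)\in H^2_{per}\times H^1_{per}$ in which the derivatives of all these constraints vanish. Lagrange multipliers are numbers $a$ for (A) and $\ell$ for (L) (when imposed) and $\psi^*\in H^{-1}_{per}$ for (S), such that for all $(\varphi,\psi)\in H^2_{per}\times H^1_{per}$ $$\Phi'(\gamma,\eta)[\varphi,\psi]+\ell\,L'(\gamma)[\varphi]+a\,A'(\gamma)[\varphi]+\langle\psi^*,2\langle\eta,\psi\rangle\rangle=0$$ (without the term $\ell L'$ if (L) is not imposed). The decomposition $\psi^*=\psi_0^*+\partial_s\psi_1^*$ means $\langle\psi^*,g\rangle=\int_\gamma(\psi_0^*g-\psi_1^*\partial_sg)\,ds$ for $g\in H^1_{per}$. **Theorem.** Fix $\delta,\lambda,L_0,A_0\in\mathbb R$ with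 $\lambda>0$, $L_0>0$. Let $\gamma\in H^2_{imm}$ be parametrized proportional to arc length and $\eta\in H^1_{per}([0,2\pi];\mathbb R^2)$, and let $(\gamma,\eta)$ be (i) a critical point of $E_{LM}$ subject to (A) and (S), or (ii) a critical point of $E$ subject to (L), (A) and (S), with $\kappa$ not constant and $A_0\in[-L_0^2/4\pi,L_0^2/4\pi]$. Then $\gamma,\eta\in C^\infty_{per}([0,2\pi];\mathbb R^2)$; Lagrange multipliers exist; and for all Lagrange multipliers, $\psi^*$ is smooth in the sense that it can be written as $\psi^*=\psi_0^*+\partial_s\psi_1^*$ with $\psi_0^*,\psi_1^*\in C^\infty_{per}([0,2\pi])$ satisfying, for all $k\in\mathbb N_0$, $$\|\gamma\|_{W^{k+2,\infty}}+\|\eta\|_{W^{k+1,\infty}}+\|\psi_0^*\|_{W^{k,\infty}}+\|\psi_1^*\|_{W^{k,\infty}}\le C_k .$$ Here, once $\delta,\lambda,A_0$ (and in case (ii) also $L_0$) are fixed, $C_k$ depends only on upper bounds for $\|\gamma\|_{H^2}$, $\|\eta\|_{H^1}$ and $\|\psi^*\|_{H^{-1}}$, except that in case (ii) with $|A_0|=L_0^2/(4\pi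 n)$ for some integer $n\ge1$ (the area of a circle of total length $L_0$ covered $n$ times) $C_k$ depends also on an upper bound for $|\ell|$. -/

import Mathlib

open MeasureTheory Set
open scoped ENNReal ContDiff RealInnerProductSpace

noncomputable section

/-- The Euclidean plane `ℝ²`. -/
abbrev Plane : Type := EuclideanSpace ℝ (Fin 2)

/-! ### Periodic function spaces

All functions on `[0, 2π]` are extended by periodicity to `ℝ`. -/

section Spaces

variable {E : Type*} [NormedAddCommGroup E] [NormedSpace ℝ E]

/-- `f ∈ H¹_per([0,2π]; E)`, with `f` its continuous representative extended periodically: `f` is the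
integral of its (almost everywhere defined, equivalently weak) derivative, which is in `L²`. -/
def IsH1per (f : ℝ → E) : Prop :=
  Function.Periodic f (2 * Real.pi) ∧
  MemLp (deriv f) 2 (volume.restrict (Ioc 0 (2 * Real.pi))) ∧
  ∀ x : ℝ, f x = f 0 + ∫ t in (0 : ℝ)..x, deriv f t

/-- `f ∈ H²_per([0,2π]; E)`: both `f` and its derivative are in `H¹_per`. -/
def IsH2per (f : ℝ → E) : Prop := IsH1per f ∧ IsH1per (deriv f)

/-- `f ∈ C^∞_per([0,2π]; E)`. -/
def IsSmoothPer (f : ℝ → E) : Prop :=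
  Function.Periodic f (2 * Real.pi) ∧ ContDiff ℝ ∞ f

/-- The norm of `H^k(0,2π)`, for functions in that space. -/
def hNorm (k : ℕ) (f : ℝ → E) : ℝ :=
  Real.sqrt (∑ j ∈ Finset.range (k + 1), ∫ x in (0 : ℝ)..(2 * Real.pi), ‖iteratedDeriv j f x‖ ^ 2)

/-- The norm of `W^{k,∞}(0,2π)`, for `k` times differentiable functions. -/
def wInftyNorm (k : ℕ) (f : ℝ → E) : ℝ≥0∞ :=
  ∑ j ∈ Finset.range (k + 1),
    eLpNorm (iteratedDeriv j f) ∞ (volume.restrict (Ioc 0 (2 * Real.pi)))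

end Spaces

/-- `Ψ ∈ H⁻¹_per([0,2π])`, the topological dual of `H¹_per([0,2π])`: a bounded linear functional on
`H¹_per`. Only the values of `Ψ` on `H¹_per` matter. -/
structure IsHMinusOne (Ψ : (ℝ → ℝ) → ℝ) : Prop where
  map_add : ∀ f g : ℝ → ℝ, IsH1per f → IsH1per g → Ψ (f + g) = Ψ f + Ψ g
  map_smul : ∀ (c : ℝ) (f : ℝ → ℝ), IsH1per f → Ψ (c • f) = c * Ψ f
  bounded : ∃ C : ℝ, ∀ f : ℝ → ℝ, IsH1per f → |Ψ f| ≤ C * hNorm 1 f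

/-- The dual norm of `H⁻¹_per`. -/
def hMinusOneNorm (Ψ : (ℝ → ℝ) → ℝ) : ℝ :=
  sInf {C : ℝ | 0 ≤ C ∧ ∀ f : ℝ → ℝ, IsH1per f → |Ψ f| ≤ C * hNorm 1 f}

/-! ### Geometry of plane curves -/

/-- The counterclockwise rotation by `π/2`. -/
def rotJ (v : Plane) : Plane := !₂[-(v 1), v 0]

/-- `γ ∈ H²_imm([0,2π]; ℝ²)`: closed regular curves of class `H²`. -/
def IsH2imm (γ : ℝ → Plane) : Prop := IsH2per γ ∧ ∀ x, deriv γ x ≠ 0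

/-- The arc length derivative `∂ₛ f = |∂ₓγ|⁻¹ ∂ₓf` along `γ`. -/
def arcDeriv {E : Type*} [NormedAddCommGroup E] [NormedSpace ℝ E]
    (γ : ℝ → Plane) (f : ℝ → E) (x : ℝ) : E :=
  ‖deriv γ x‖⁻¹ • deriv f x

/-- `∫_γ f ds = ∫₀^{2π} f |∂ₓγ| dx`. -/
def arcIntegral (γ : ℝ → Plane) (f : ℝ → ℝ) : ℝ :=
  ∫ x in (0 : ℝ)..(2 * Real.pi), f x * ‖deriv γ x‖

/-- The unit tangent `τ = ∂ₛγ`. -/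
def tangent (γ : ℝ → Plane) : ℝ → Plane := arcDeriv γ γ

/-- The unit normal `ν = Jτ`. -/
def normal (γ : ℝ → Plane) (x : ℝ) : Plane := rotJ (tangent γ x)

/-- The oriented curvature, `∂ₛτ = κν`. -/
def curvature (γ : ℝ → Plane) (x : ℝ) : ℝ := ⟪arcDeriv γ (tangent γ) x, normal γ x⟫

/-- The length of `γ`. -/
def curveLength (γ : ℝ → Plane) : ℝ := ∫ x in (0 : ℝ)..(2 * Real.pi), ‖deriv γ x‖

/-- The signed enclosed area `-½ ∫₀^{2π} ⟨γ, J∂ₓγ⟩ dx`. -/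
def curveArea (γ : ℝ → Plane) : ℝ :=
  -(1 / 2) * ∫ x in (0 : ℝ)..(2 * Real.pi), ⟪γ x, rotJ (deriv γ x)⟫

/-- `γ` is parametrized proportional to arc length. -/
def IsArcProportional (γ : ℝ → Plane) : Prop :=
  ∀ x, ‖deriv γ x‖ = curveLength γ / (2 * Real.pi)

/-- The divergence `div_γ η = ⟨∂ₛη, τ⟩`. -/
def curveDiv (γ η : ℝ → Plane) (x : ℝ) : ℝ := ⟪arcDeriv γ η x, tangent γ x⟫

/-- The gradient `∇_γ η = ∂ₛη ⊗ τ`, whose rows are the gradients of the components of `η`. -/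
def curveGrad (γ η : ℝ → Plane) (x : ℝ) : Matrix (Fin 2) (Fin 2) ℝ :=
  Matrix.of fun i j => arcDeriv γ η x i * tangent γ x j

/-- The energy `E(γ,η) = ½ ∫_γ (κ + δ div_γ η)² ds + (λ/2) ∫_γ |∇_γ η|² ds`. -/
def energyE (δ lam : ℝ) (γ η : ℝ → Plane) : ℝ :=
  1 / 2 * arcIntegral γ (fun x => (curvature γ x + δ * curveDiv γ η x) ^ 2) +
  lam / 2 * arcIntegral γ (fun x => ∑ i, ∑ j, curveGrad γ η x i j ^ 2)

/-- The energy `E_LM(γ,η) = E(γ,η) + L(γ)`. -/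
def energyLM (δ lam : ℝ) (γ η : ℝ → Plane) : ℝ := energyE δ lam γ η + curveLength γ

/-! ### Constrained critical points and Lagrange multipliers -/

/-- The constraint map `S(η) = |η|² - 1`. -/
def constraintS (η : ℝ → Plane) (x : ℝ) : ℝ := ‖η x‖ ^ 2 - 1

/-- The derivative `S'(η)[ψ] = 2⟨η, ψ⟩`. -/
def constraintSDeriv (η ψ : ℝ → Plane) (x : ℝ) : ℝ := 2 * ⟪η x, ψ x⟫

/-- `(γ,η)` is a critical point of `Φ` subject to the constraints `F i (γ) = c i` and `S(η) = 0`: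
the constraints hold, and the first variation of `Φ` vanishes in each direction
`(φ,ψ) ∈ H²_per × H¹_per` in which the derivatives of all the constraints vanish. -/
structure IsConstrainedCritical {m : ℕ} (Φ : (ℝ → Plane) → (ℝ → Plane) → ℝ)
    (F : Fin m → (ℝ → Plane) → ℝ) (c : Fin m → ℝ) (γ η : ℝ → Plane) : Prop where
  constraint : ∀ i, F i γ = c i
  unit : ∀ x, constraintS η x = 0
  stationary : ∀ φ ψ : ℝ → Plane, IsH2per φ → IsH1per ψ →
    (∀ i, HasDerivAt (fun ε : ℝ => F i (γ + ε • φ)) 0 0) →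
    (∀ x, constraintSDeriv η ψ x = 0) →
    HasDerivAt (fun ε : ℝ => Φ (γ + ε • φ) (η + ε • ψ)) 0 0

/-- `μ ∈ ℝ^m` and `Ψ ∈ H⁻¹_per` are Lagrange multipliers at `(γ,η)` for the constraints `F i` and
`S`: `Φ'(γ,η)[φ,ψ] + ∑ i, μ i F i'(γ)[φ] + ⟨Ψ, S'(η)[ψ]⟩ = 0` for all
`(φ,ψ) ∈ H²_per × H¹_per`. -/
structure IsLagrangeMultiplier {m : ℕ} (Φ : (ℝ → Plane) → (ℝ → Plane) → ℝ)
    (F : Fin m → (ℝ → Plane) → ℝ) (γ η : ℝ → Plane)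
    (μ : Fin m → ℝ) (Ψ : (ℝ → ℝ) → ℝ) : Prop where
  isHMinusOne : IsHMinusOne Ψ
  equation : ∀ φ ψ : ℝ → Plane, IsH2per φ → IsH1per ψ →
    HasDerivAt (fun ε : ℝ => Φ (γ + ε • φ) (η + ε • ψ) + ∑ i, μ i * F i (γ + ε • φ))
      (-Ψ (constraintSDeriv η ψ)) 0

/-- `Ψ = ψ₀ + ∂ₛψ₁` in `H⁻¹_per`, that is, `⟨Ψ, g⟩ = ∫_γ (ψ₀ g - ψ₁ ∂ₛg) ds` for `g ∈ H¹_per`. -/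
def IsRepresentedBy (γ : ℝ → Plane) (Ψ : (ℝ → ℝ) → ℝ) (ψ₀ ψ₁ : ℝ → ℝ) : Prop :=
  ∀ g : ℝ → ℝ, IsH1per g →
    Ψ g = arcIntegral γ (fun x => ψ₀ x * g x - ψ₁ x * arcDeriv γ g x)

/-- `κ` is constant (almost everywhere). -/
def HasConstCurvature (γ : ℝ → Plane) : Prop :=
  ∃ c : ℝ, ∀ᵐ x ∂(volume.restrict (Ioc 0 (2 * Real.pi))), curvature γ x = c

/-- The sum of norms `‖γ‖_{W^{k+2,∞}} + ‖η‖_{W^{k+1,∞}} + ‖ψ₀‖_{W^{k,∞}} + ‖ψ₁‖_{W^{k,∞}}`. -/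
def totalNorm (k : ℕ) (γ η : ℝ → Plane) (ψ₀ ψ₁ : ℝ → ℝ) : ℝ≥0∞ :=
  wInftyNorm (k + 2) γ + wInftyNorm (k + 1) η + wInftyNorm k ψ₀ + wInftyNorm k ψ₁

end

/-! Along a curve of constant speed r the first variation of E is the integral of ⟨A,φ''⟩ + ⟨B,φ'⟩ +
⟨C,ψ'⟩ with A, C in L² and B in L¹. Put w = κ + δ div η and, since |η| = 1, ∂ₛη = ω Jη. Then A =
(w/r) ν and ⟨C,Jη⟩ = λω + δw⟨Jη,τ⟩. By the lemma of du Bois-Reymond (`exists_primitive_of_weak`)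
both agree almost everywhere with absolutely continuous functions. Because λ > 0, these two momenta
together with τ and η determine w, ω and κ polynomially. Hence γ, τ, η, the momenta, the multipliers
a, ℓ, the speed and two integration constants c form a state in ℝ¹⁴ that solves an autonomous
polynomial equation (`IsWeakSolution.exists_state`). Smoothness follows at once. Every derivative is
a fixed smooth function of the state, and so are ψ₀ and ψ₁, so a bound on the state alone yields
every C_k.

To bound the state, let H be the integral over a period of w²/2 + λω²/2, T that of ⟨Jγ,τ⟩, and Q
that of |γ - γ̄|², with γ̄ the mean. The conserved Hamiltonian reads w²/2 + λω²/2 = ℓ + a⟨Jγ,τ⟩ +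
⟨c,τ⟩ (`ham_eq`) and integrates to H = 2πℓ + aT. Testing the curve equation with J(γ - γ̄) gives I +
ℓT + aQ = 0, where |I| is at most affine in H (`perInt_innerForce`). Since Q is bounded below by the
bending of the curve (`spread_lower`), a is controlled by ℓ; then c is controlled as a mean force,
and the conservation law turns the integral bounds into pointwise ones (`exists_state_bound`).

In case (i) ℓ = 1 and what remains is a lower bound for r (`exists_speed_lower`). If A₀ ≠ 0, area is
at most a multiple of r². If A₀ = 0, then T = 0 and H = 2π, which bounds ∫κ², hence Q from below,
while Q is at most a multiple of r².

In case (ii) r is fixed and ℓ has to be bounded. Eliminating a gives ℓ(2πQ - T²) = QH + TI. The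
defect 2πQ - T² is nonnegative, and `circle_deviation` with `exists_defect_lower` bounds it away
from zero unless |A₀| is the area of a circle of length L₀ covered n times. In that exceptional case
a bound on ℓ is assumed. -/

/-- Lebesgue measure on one period. -/
noncomputable abbrev perVol : Measure ℝ := volume.restrict (Ioc 0 (2 * Real.pi))

/-! ### Periodic functions and the calculus of H¹_per -/

lemma two_pi_nonneg : (0 : ℝ) ≤ 2 * Real.pi := Real.two_pi_pos.le

lemma periodic_deriv_of_periodic {E : Type*} [NormedAddCommGroup E] [NormedSpace ℝ E]
    {f : ℝ → E} {T : ℝ} (hf : Function.Periodic f T) : Function.Periodic (deriv f) T := by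
  intro x
  have h : (fun y => f (y + T)) = f := funext hf
  rw [← deriv_comp_add_const, h]

/-- A periodic property holding almost everywhere on one period holds almost everywhere. -/
lemma ae_of_ae_perVol {Q : ℝ → Prop} (hper : ∀ x, Q (x + 2 * Real.pi) ↔ Q x)
    (h : ∀ᵐ x ∂perVol, Q x) : ∀ᵐ x, Q x := by
  rw [ae_restrict_iff' measurableSet_Ioc] at h
  have hz : ∀ (n : ℤ) (x : ℝ), Q (x + n * (2 * Real.pi)) ↔ Q x := by
    intro n
    induction n using Int.induction_on with
    | zero => simp
    | succ n ih =>
      intro x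
      have := hper (x + n * (2 * Real.pi))
      push_cast
      rw [← ih x]
      push_cast at *
      rw [← this]
      ring_nf
    | pred n ih =>
      intro x
      rw [← ih x]
      have := hper (x + (-(n : ℝ) - 1) * (2 * Real.pi))
      push_cast at *
      rw [← this]
      ring_nf
  -- Translations preserve null sets, and countably many translates of one period cover the line.
  have hall : ∀ᵐ x : ℝ, ∀ n : ℤ,
      (x + n * (2 * Real.pi) ∈ Ioc 0 (2 * Real.pi) → Q (x + n * (2 * Real.pi))) := by
    rw [ae_all_iff]
    intro n
    exact (measurePreserving_add_right volume ((n : ℝ) * (2 * Real.pi))).quasiMeasurePreserving.ae h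
  filter_upwards [hall] with x hx
  obtain ⟨n, hn, -⟩ := existsUnique_add_zsmul_mem_Ioc Real.two_pi_pos x 0
  have h1 := hx n (by simpa using hn)
  exact (hz n x).1 h1

lemma MeasureTheory.MemLp.intervalIntegrable_of_periodic {E : Type*} [NormedAddCommGroup E] {g : ℝ → E} {p : ℝ≥0∞}
    (hg : MemLp g p perVol)
    (hp : 1 ≤ p) (hper : Function.Periodic g (2 * Real.pi)) (a b : ℝ) :
    IntervalIntegrable g volume a b := by
  refine hper.intervalIntegrable₀ Real.two_pi_pos.ne' ?_ a b
  rw [intervalIntegrable_iff_integrableOn_Ioc_of_le two_pi_nonneg]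
  exact hg.integrable hp

lemma memLp_perVol_of_continuous {E : Type*} [NormedAddCommGroup E] {f : ℝ → E} (hf : Continuous f) (p : ℝ≥0∞) :
    MemLp f p perVol := by
  obtain ⟨C, hC⟩ := isCompact_Icc.exists_bound_of_continuousOn
    (s := Icc 0 (2 * Real.pi)) hf.continuousOn
  have hm : AEStronglyMeasurable f perVol :=
    ((hf.continuousOn (s := Icc 0 (2 * Real.pi))).aestronglyMeasurable_of_isCompact
      isCompact_Icc measurableSet_Icc).mono_set Ioc_subset_Icc_self
  refine MemLp.of_bound hm C ?_
  filter_upwards [ae_restrict_mem measurableSet_Ioc] with x hx using hC x (Ioc_subset_Icc_self hx)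

section Vector

variable {E F : Type*} [NormedAddCommGroup E] [NormedSpace ℝ E] [NormedAddCommGroup F]
  [NormedSpace ℝ F]

lemma IsH1per.intervalIntegrable_deriv {f : ℝ → E} (hf : IsH1per f) (a b : ℝ) :
    IntervalIntegrable (deriv f) volume a b :=
  hf.2.1.intervalIntegrable_of_periodic (by norm_num) (periodic_deriv_of_periodic hf.1) a b

lemma continuous_of_integral {f g : ℝ → E} (hg : ∀ a b, IntervalIntegrable g volume a b)
    (h : ∀ x : ℝ, f x = f 0 + ∫ t in (0 : ℝ)..x, g t) : Continuous f := by
  have := intervalIntegral.continuous_primitive hg 0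
  rw [show f = fun x => f 0 + ∫ t in (0 : ℝ)..x, g t from funext h]
  exact continuous_const.add this

lemma IsH1per.continuous {f : ℝ → E} (hf : IsH1per f) : Continuous f :=
  continuous_of_integral hf.intervalIntegrable_deriv hf.2.2

lemma ae_hasDerivAt_of_integral [CompleteSpace E] {f g : ℝ → E}
    (hg : ∀ a b, IntervalIntegrable g volume a b)
    (h : ∀ x : ℝ, f x = f 0 + ∫ t in (0 : ℝ)..x, g t) : ∀ᵐ x, HasDerivAt f (g x) x := by
  have hl : LocallyIntegrable g volume := by
    rw [locallyIntegrable_iff]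
    intro k hk
    obtain ⟨R, hR⟩ := hk.isBounded.subset_closedBall 0
    rw [Real.closedBall_eq_Icc] at hR
    refine IntegrableOn.mono_set ?_ hR
    by_cases hle : (0 - R) ≤ 0 + R
    · rw [integrableOn_Icc_iff_integrableOn_Ioc]
      exact (intervalIntegrable_iff_integrableOn_Ioc_of_le hle).1 (hg _ _)
    · rw [Icc_eq_empty hle]; exact integrableOn_empty
  filter_upwards [LocallyIntegrable.ae_hasDerivAt_integral hl] with x hx
  rw [show f = fun x => f 0 + ∫ t in (0 : ℝ)..x, g t from funext h]
  simpa using (hx 0).const_add (f 0)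

lemma IsH1per.ae_hasDerivAt [CompleteSpace E] {f : ℝ → E} (hf : IsH1per f) :
    ∀ᵐ x, HasDerivAt f (deriv f x) x :=
  ae_hasDerivAt_of_integral hf.intervalIntegrable_deriv hf.2.2

/-- A periodic integral of an `L²` function is in `H¹_per`. -/
lemma isH1per_of_integral [CompleteSpace E] {f g : ℝ → E} (hper : Function.Periodic f (2 * Real.pi))
    (hg2 : MemLp g 2 perVol) (hg : ∀ a b, IntervalIntegrable g volume a b)
    (h : ∀ x : ℝ, f x = f 0 + ∫ t in (0 : ℝ)..x, g t) : IsH1per f ∧ deriv f =ᵐ[volume] g := by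
  -- By Lebesgue differentiation the pointwise derivative is the given density, so membership in
  -- `IsH1per`, which speaks of `deriv`, can be read off from any integral representation.
  have hd : deriv f =ᵐ[volume] g := by
    filter_upwards [ae_hasDerivAt_of_integral hg h] with x hx using hx.deriv
  refine ⟨⟨hper, ?_, fun x => ?_⟩, hd⟩
  · exact (memLp_congr_ae (ae_restrict_of_ae hd)).2 hg2
  · rw [h x, intervalIntegral.integral_congr_ae_restrict (ae_restrict_of_ae hd.symm)]

lemma IsH1per.clm_comp [CompleteSpace E] [CompleteSpace F] {f : ℝ → E} (hf : IsH1per f)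
    (T : E →L[ℝ] F) :
    IsH1per (fun x => T (f x)) ∧ deriv (fun x => T (f x)) =ᵐ[volume] fun x => T (deriv f x) := by
  refine isH1per_of_integral (fun x => by rw [hf.1 x]) (hf.2.1.continuousLinearMap_comp T) ?_ ?_
  · intro a b
    have := hf.intervalIntegrable_deriv a b
    exact ⟨T.integrable_comp this.1, T.integrable_comp this.2⟩
  · intro x
    rw [T.intervalIntegral_comp_comm (hf.intervalIntegrable_deriv 0 x), ← map_add, ← hf.2.2 x]

lemma IsH1per.add [CompleteSpace E] {f g : ℝ → E} (hf : IsH1per f) (hg : IsH1per g) :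
    IsH1per (f + g) ∧ deriv (f + g) =ᵐ[volume] deriv f + deriv g := by
  refine isH1per_of_integral (hf.1.add hg.1) (hf.2.1.add hg.2.1) ?_ ?_
  · exact fun a b => (hf.intervalIntegrable_deriv a b).add (hg.intervalIntegrable_deriv a b)
  · intro x
    have := intervalIntegral.integral_add (hf.intervalIntegrable_deriv 0 x)
      (hg.intervalIntegrable_deriv 0 x)
    rw [Pi.add_apply, Pi.add_apply, hf.2.2 x, hg.2.2 x]
    erw [this]
    abel

lemma isH1per_const (c : E) : IsH1per (fun _ => c) := by
  refine ⟨fun x => rfl, ?_, fun x => ?_⟩ <;> simp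

lemma IsH1per.const_smul [CompleteSpace E] {f : ℝ → E} (hf : IsH1per f) (c : ℝ) :
    IsH1per (c • f) ∧ deriv (c • f) =ᵐ[volume] c • deriv f :=
  hf.clm_comp (c • ContinuousLinearMap.id ℝ E)

lemma IsH1per.exists_bound {f : ℝ → E} (hf : IsH1per f) : ∃ C, 0 < C ∧ ∀ x, ‖f x‖ ≤ C := by
  obtain ⟨C, hC⟩ := isCompact_Icc.exists_bound_of_continuousOn
    (s := Icc 0 (2 * Real.pi)) hf.continuous.continuousOn
  refine ⟨max C 1, by positivity, fun x => ?_⟩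
  obtain ⟨y, hy, hxy⟩ := hf.1.exists_mem_Ico₀ Real.two_pi_pos x
  rw [hxy]
  exact (hC y (Ico_subset_Icc_self hy)).trans (le_max_left _ _)

end Vector

/-! ### Products and integration by parts in H¹_per -/

section Scalar

lemma IsH1per.absolutelyContinuousOnInterval {f : ℝ → ℝ} (hf : IsH1per f) (a b : ℝ) :
    AbsolutelyContinuousOnInterval f a b := by
  have h1 := (hf.intervalIntegrable_deriv a b).absolutelyContinuousOnInterval_intervalIntegral
    (c := a) left_mem_uIcc
  have h2 : AbsolutelyContinuousOnInterval (fun _ : ℝ => f a) a b :=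
    (contDiff_const (n := 1)).contDiffOn.absolutelyContinuousOnInterval
  have : f = (fun _ : ℝ => f a) + fun x => ∫ v in a..x, deriv f v := by
    funext x
    have := intervalIntegral.integral_interval_sub_left (hf.intervalIntegrable_deriv 0 x)
      (hf.intervalIntegrable_deriv 0 a)
    simp only [Pi.add_apply]
    rw [← this]
    have hx := hf.2.2 x
    have ha := hf.2.2 a
    linarith
  rw [this]
  exact h2.add h1

/-- Integration by parts for absolutely continuous functions shows that the product is the primitive
of the Leibniz expression, which is in L² because both factors are bounded on a period. -/
lemma IsH1per.mul {f g : ℝ → ℝ} (hf : IsH1per f) (hg : IsH1per g) :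
    IsH1per (fun x => f x * g x) ∧
      deriv (fun x => f x * g x) =ᵐ[volume] fun x => deriv f x * g x + f x * deriv g x := by
  have hint : ∀ a b, IntervalIntegrable (fun x => deriv f x * g x + f x * deriv g x) volume a b :=
    fun a b => ((hf.intervalIntegrable_deriv a b).mul_continuousOn hg.continuous.continuousOn).add
      ((hg.intervalIntegrable_deriv a b).continuousOn_mul hf.continuous.continuousOn)
  refine isH1per_of_integral (hf.1.mul hg.1) ?_ hint ?_
  · have h1 : MemLp (fun x => deriv f x * g x) 2 perVol :=
      MemLp.mul (p := 2) (q := ∞) (memLp_perVol_of_continuous hg.continuous ∞) hf.2.1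
    have h2 : MemLp (fun x => f x * deriv g x) 2 perVol :=
      MemLp.mul (p := ∞) (q := 2) hg.2.1 (memLp_perVol_of_continuous hf.continuous ∞)
    exact h1.add h2
  · intro x
    rw [AbsolutelyContinuousOnInterval.integral_deriv_mul_eq_sub
      (hf.absolutelyContinuousOnInterval 0 x) (hg.absolutelyContinuousOnInterval 0 x)]
    ring

lemma IsH1per.integral_deriv_eq_zero {f : ℝ → ℝ} (hf : IsH1per f) :
    ∫ x in (0 : ℝ)..(2 * Real.pi), deriv f x = 0 := by
  have h := hf.2.2 (2 * Real.pi)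
  have h2 := hf.1 0
  rw [zero_add] at h2
  linarith

end Scalar

/-! ### Coordinates in the plane -/

lemma plane_ext {v w : Plane} (h0 : v 0 = w 0) (h1 : v 1 = w 1) : v = w := by
  ext i; fin_cases i
  · exact h0
  · exact h1

lemma plane_inner (v w : Plane) : ⟪v, w⟫ = v 0 * w 0 + v 1 * w 1 := by
  simp [PiLp.inner_apply, Fin.sum_univ_two, mul_comm]

lemma plane_norm_sq (v : Plane) : ‖v‖ ^ 2 = v 0 ^ 2 + v 1 ^ 2 := by
  rw [EuclideanSpace.norm_sq_eq]; simp [Fin.sum_univ_two]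

@[simp] lemma rotJ_zero (v : Plane) : rotJ v 0 = -(v 1) := by simp [rotJ]

@[simp] lemma rotJ_one (v : Plane) : rotJ v 1 = v 0 := by simp [rotJ]

lemma hasDerivAt_coord {f : ℝ → Plane} {f' : Plane} {x : ℝ} (h : HasDerivAt f f' x) (i : Fin 2) :
    HasDerivAt (fun y => f y i) (f' i) x :=
  ((EuclideanSpace.proj i : Plane →L[ℝ] ℝ).hasFDerivAt.comp_hasDerivAt x h)

/-- The plane curve with given coordinates. -/
def planeMk (f g : ℝ → ℝ) (x : ℝ) : Plane := !₂[f x, g x]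

@[simp] lemma planeMk_zero (f g : ℝ → ℝ) (x : ℝ) : planeMk f g x 0 = f x := by simp [planeMk]

@[simp] lemma planeMk_one (f g : ℝ → ℝ) (x : ℝ) : planeMk f g x 1 = g x := by simp [planeMk]

lemma hasDerivAt_planeMk {f g : ℝ → ℝ} {f' g' x : ℝ} (hf : HasDerivAt f f' x)
    (hg : HasDerivAt g g' x) : HasDerivAt (planeMk f g) !₂[f', g'] x := by
  have h := (hf.smul_const (!₂[1, 0] : Plane)).add (hg.smul_const (!₂[0, 1] : Plane))
  have e1 : ((fun y => f y • (!₂[1, 0] : Plane)) + fun y => g y • (!₂[0, 1] : Plane))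
      = planeMk f g := by
    funext y; apply plane_ext <;> simp
  have e2 : f' • (!₂[1, 0] : Plane) + g' • (!₂[0, 1] : Plane) = !₂[f', g'] := by
    apply plane_ext <;> simp
  rwa [e1, e2] at h

lemma IsH1per.coord {f : ℝ → Plane} (hf : IsH1per f) (i : Fin 2) :
    IsH1per (fun x => f x i) ∧ deriv (fun x => f x i) =ᵐ[volume] fun x => deriv f x i :=
  hf.clm_comp (EuclideanSpace.proj i : Plane →L[ℝ] ℝ)

lemma IsH1per.planeMk {f g : ℝ → ℝ} (hf : IsH1per f) (hg : IsH1per g) :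
    IsH1per (planeMk f g) ∧
      deriv (planeMk f g) =ᵐ[volume] planeMk (deriv f) (deriv g) := by
  let T (v : Plane) : ℝ →L[ℝ] Plane := (ContinuousLinearMap.id ℝ ℝ).smulRight v
  have h0 := hf.clm_comp (T !₂[1, 0])
  have h1 := hg.clm_comp (T !₂[0, 1])
  have h := h0.1.add h1.1
  have he : ∀ f g : ℝ → ℝ, (fun x => T !₂[1, 0] (f x)) + (fun x => T !₂[0, 1] (g x))
      = _root_.planeMk f g := by
    intro f g
    funext x
    apply plane_ext <;> simp [T]
  rw [he] at h
  refine ⟨h.1, ?_⟩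
  filter_upwards [h.2, h0.2, h1.2] with x e e0 e1
  rw [e, ← he, Pi.add_apply, Pi.add_apply, e0, e1]

lemma planeMk_coord (f : ℝ → Plane) : planeMk (fun x => f x 0) (fun x => f x 1) = f := by
  funext x; apply plane_ext <;> simp

/-- Products of a scalar and a vector valued function in `H¹_per`. -/
lemma IsH1per.smul {g : ℝ → ℝ} {f : ℝ → Plane} (hg : IsH1per g) (hf : IsH1per f) :
    IsH1per (fun x => g x • f x) ∧
      deriv (fun x => g x • f x) =ᵐ[volume] fun x => deriv g x • f x + g x • deriv f x := by
  have h0 := hg.mul (hf.coord 0).1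
  have h1 := hg.mul (hf.coord 1).1
  have h := h0.1.planeMk h1.1
  have he : _root_.planeMk (fun x => g x * f x 0) (fun x => g x * f x 1) = fun x => g x • f x := by
    funext x; apply plane_ext <;> simp
  rw [he] at h
  refine ⟨h.1, ?_⟩
  filter_upwards [h.2, h0.2, h1.2, (hf.coord 0).2, (hf.coord 1).2] with x e e0 e1 e2 e3
  rw [e]
  apply plane_ext
  · simp [e0, e2]
  · simp [e1, e3]

/-- `J` as a continuous linear map. -/
noncomputable def rotJL : Plane →L[ℝ] Plane :=
  LinearMap.toContinuousLinearMap
    { toFun := rotJ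
      map_add' := fun v w => by apply plane_ext <;> simp [add_comm]
      map_smul' := fun c v => by apply plane_ext <;> simp }

lemma IsH1per.rotJ {f : ℝ → Plane} (hf : IsH1per f) :
    IsH1per (fun x => rotJ (f x)) ∧
      deriv (fun x => rotJ (f x)) =ᵐ[volume] fun x => rotJ (deriv f x) :=
  hf.clm_comp rotJL

/-! ### `H²_per` -/

section H2

variable {E : Type*} [NormedAddCommGroup E] [NormedSpace ℝ E] [CompleteSpace E]

lemma IsH2per.hasDerivAt {f : ℝ → E} (hf : IsH2per f) (x : ℝ) : HasDerivAt f (deriv f x) x := by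
  have h : f = fun x => f 0 + ∫ t in (0 : ℝ)..x, deriv f t := funext hf.1.2.2
  have h2 := (hf.2.continuous.integral_hasStrictDerivAt 0 x).hasDerivAt.const_add (f 0)
  rwa [← h] at h2

lemma IsH2per.add {f g : ℝ → E} (hf : IsH2per f) (hg : IsH2per g) :
    IsH2per (f + g) ∧ deriv (f + g) = deriv f + deriv g ∧
      deriv (deriv (f + g)) =ᵐ[volume] deriv (deriv f) + deriv (deriv g) := by
  have h : deriv (f + g) = deriv f + deriv g :=
    funext fun x => ((hf.hasDerivAt x).add (hg.hasDerivAt x)).deriv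
  refine ⟨⟨(hf.1.add hg.1).1, ?_⟩, h, ?_⟩ <;> rw [h]
  · exact (hf.2.add hg.2).1
  · exact (hf.2.add hg.2).2

lemma IsH2per.const_smul {f : ℝ → E} (hf : IsH2per f) (c : ℝ) :
    IsH2per (c • f) ∧ deriv (c • f) = c • deriv f ∧
      deriv (deriv (c • f)) =ᵐ[volume] c • deriv (deriv f) := by
  have h : deriv (c • f) = c • deriv f :=
    funext fun x => ((hf.hasDerivAt x).const_smul c).deriv
  refine ⟨⟨(hf.1.const_smul c).1, ?_⟩, h, ?_⟩ <;> rw [h]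
  · exact (hf.2.const_smul c).1
  · exact (hf.2.const_smul c).2

/-- The primitive of a mean-free function in `H¹_per` is in `H²_per`. -/
lemma IsH1per.exists_primitive {h : ℝ → E} (hh : IsH1per h)
    (h0 : ∫ x in (0 : ℝ)..(2 * Real.pi), h x = 0) : ∃ g, IsH2per g ∧ deriv g = h := by
  have hi : ∀ a b, IntervalIntegrable h volume a b := fun a b => hh.continuous.intervalIntegrable a b
  have hd : deriv (fun x => ∫ t in (0 : ℝ)..x, h t) = h :=
    funext fun x => (hh.continuous.integral_hasStrictDerivAt 0 x).hasDerivAt.deriv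
  -- The vanishing mean is what makes the primitive periodic.
  have hp : Function.Periodic (fun x => ∫ t in (0 : ℝ)..x, h t) (2 * Real.pi) := by
    intro x
    have h1 := hh.1.intervalIntegral_add_eq_add 0 x hi
    rw [zero_add, h0, add_zero] at h1
    exact h1
  refine ⟨fun x => ∫ t in (0 : ℝ)..x, h t, ⟨?_, by rwa [hd]⟩, hd⟩
  exact (isH1per_of_integral hp (memLp_perVol_of_continuous hh.continuous 2) hi (by simp)).1

end H2

lemma isH2per_const {E : Type*} [NormedAddCommGroup E] [NormedSpace ℝ E] (c : E) : IsH2per (fun _ : ℝ => c) :=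
  ⟨isH1per_const c, by simpa using isH1per_const (0 : E)⟩

lemma IsH2per.planeMk {f g : ℝ → ℝ} (hf : IsH2per f) (hg : IsH2per g) :
    IsH2per (planeMk f g) ∧ deriv (planeMk f g) = planeMk (deriv f) (deriv g) := by
  have h : deriv (_root_.planeMk f g) = _root_.planeMk (deriv f) (deriv g) := by
    exact funext fun x => (hasDerivAt_planeMk (hf.hasDerivAt x) (hg.hasDerivAt x)).deriv
  exact ⟨⟨(hf.1.planeMk hg.1).1, by rw [h]; exact (hf.2.planeMk hg.2).1⟩, h⟩

/-! ### The lemma of du Bois-Reymond -/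

/-- A square integrable function on a period is the derivative of some `H¹_per` function with any
prescribed mean, up to its own mean. -/
lemma exists_isH1per_deriv_ae_eq {k : ℝ → ℝ} (hk : MemLp k 2 perVol)
    (h0 : ∫ x in (0 : ℝ)..(2 * Real.pi), k x = 0) :
    ∃ h : ℝ → ℝ, IsH1per h ∧ (∫ x in (0 : ℝ)..(2 * Real.pi), h x = 0) ∧ deriv h =ᵐ[perVol] k := by
  set kp : ℝ → ℝ := fun x => k (toIocMod Real.two_pi_pos 0 x) with hkp
  have hper : Function.Periodic kp (2 * Real.pi) := fun x => by simp [hkp]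
  have hae : kp =ᵐ[perVol] k := by
    filter_upwards [ae_restrict_mem measurableSet_Ioc] with x hx
    simp only [hkp]
    rw [(toIocMod_eq_self Real.two_pi_pos).2 (by simpa using hx)]
  have hk2 : MemLp kp 2 perVol := (memLp_congr_ae hae).2 hk
  have hi := fun a b => hk2.intervalIntegrable_of_periodic (by norm_num) hper a b
  have h0' : ∫ x in (0 : ℝ)..(2 * Real.pi), kp x = 0 := by
    refine Eq.trans ?_ h0
    rw [intervalIntegral.integral_of_le two_pi_nonneg,
      intervalIntegral.integral_of_le two_pi_nonneg]
    exact integral_congr_ae hae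
  -- The constant m is the mean of the primitive; subtracting it makes h mean-free without changing
  -- its derivative.
  set m : ℝ := (∫ x in (0 : ℝ)..(2 * Real.pi), ∫ t in (0 : ℝ)..x, kp t) / (2 * Real.pi) with hm
  set h : ℝ → ℝ := fun x => -m + ∫ t in (0 : ℝ)..x, kp t with hh
  have hp : Function.Periodic h (2 * Real.pi) := by
    intro x
    have h1 := hper.intervalIntegral_add_eq_add 0 x hi
    rw [zero_add, h0', add_zero] at h1
    simp only [hh, h1]
  obtain ⟨h1, h2⟩ := isH1per_of_integral hp hk2 hi (by simp [hh])
  refine ⟨h, h1, ?_, Filter.EventuallyEq.trans (ae_restrict_of_ae h2) hae⟩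
  simp only [hh]
  have hc : Continuous fun x => ∫ t in (0 : ℝ)..x, kp t :=
    intervalIntegral.continuous_primitive hi 0
  rw [intervalIntegral.integral_add (by simp) (hc.intervalIntegrable _ _)]
  simp only [intervalIntegral.integral_const, smul_eq_mul, hm]
  field_simp
  ring

/-- Integration by parts over a period against a mean-free function. -/
lemma IsH1per.integral_mul_eq_neg {h F : ℝ → ℝ} (hh : IsH1per h)
    (hF : ∀ a b, IntervalIntegrable F volume a b)
    (hF0 : ∫ x in (0 : ℝ)..(2 * Real.pi), F x = 0) :
    ∫ x in (0 : ℝ)..(2 * Real.pi), F x * h x =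
      -∫ x in (0 : ℝ)..(2 * Real.pi), (∫ t in (0 : ℝ)..x, F t) * deriv h x := by
  have hac := (hF 0 (2 * Real.pi)).absolutelyContinuousOnInterval_intervalIntegral
    (c := 0) left_mem_uIcc
  have key := AbsolutelyContinuousOnInterval.integral_mul_deriv_eq_deriv_mul hac
    (hh.absolutelyContinuousOnInterval 0 (2 * Real.pi))
  -- Both boundary terms vanish: the primitive is 0 at 0, and its value at 2π is the vanishing mean
  -- of F.
  rw [key, hF0]
  simp only [intervalIntegral.integral_same, zero_mul, sub_zero, zero_sub, neg_neg]
  have hd := ae_hasDerivAt_of_integral (f := fun x => ∫ t in (0 : ℝ)..x, F t) hF (by simp)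
  apply intervalIntegral.integral_congr_ae
  filter_upwards [hd] with x hx _
  rw [hx.deriv]

/-- The lemma of du Bois-Reymond: if `f' = F + c` weakly, for test functions of mean zero, then `f`
agrees with a periodic absolutely continuous function. -/
lemma exists_primitive_of_weak {f F : ℝ → ℝ} (hf : MemLp f 2 perVol)
    (hF : ∀ a b, IntervalIntegrable F volume a b) (hper : Function.Periodic F (2 * Real.pi))
    (hw : ∀ h : ℝ → ℝ, IsH1per h → (∫ x in (0 : ℝ)..(2 * Real.pi), h x = 0) →
      ∫ x in (0 : ℝ)..(2 * Real.pi), (f x * deriv h x + F x * h x) = 0) :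
    ∃ (c : ℝ) (W : ℝ → ℝ), Function.Periodic W (2 * Real.pi) ∧
      (∀ x, W x = W 0 + ∫ t in (0 : ℝ)..x, (F t + c)) ∧ f =ᵐ[perVol] W := by
  -- This c makes F + c mean-free, so that its primitive G is periodic.
  set c : ℝ := -(∫ x in (0 : ℝ)..(2 * Real.pi), F x) / (2 * Real.pi) with hc
  have hFc : ∀ a b, IntervalIntegrable (fun x => F x + c) volume a b :=
    fun a b => (hF a b).add (by simp)
  have hFc0 : ∫ x in (0 : ℝ)..(2 * Real.pi), (F x + c) = 0 := by
    rw [intervalIntegral.integral_add (hF _ _) (by simp)]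
    simp only [intervalIntegral.integral_const, smul_eq_mul, hc]
    field_simp
    ring
  set G : ℝ → ℝ := fun x => ∫ t in (0 : ℝ)..x, (F t + c) with hG
  have hGc : Continuous G := intervalIntegral.continuous_primitive hFc 0
  have hG2 : MemLp G 2 perVol := memLp_perVol_of_continuous hGc 2
  have hu2 : MemLp (fun x => f x - G x) 2 perVol := hf.sub hG2
  set m : ℝ := (∫ x in (0 : ℝ)..(2 * Real.pi), (f x - G x)) / (2 * Real.pi) with hm
  have hk2 : MemLp (fun x => f x - G x - m) 2 perVol :=
    hu2.sub (memLp_perVol_of_continuous continuous_const 2)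
  have hk0 : ∫ x in (0 : ℝ)..(2 * Real.pi), (f x - G x - m) = 0 := by
    rw [intervalIntegral.integral_sub _ (by simp)]
    · simp only [intervalIntegral.integral_const, smul_eq_mul, hm]
      field_simp
      ring
    · rw [intervalIntegrable_iff_integrableOn_Ioc_of_le two_pi_nonneg]
      exact hu2.integrable (by norm_num)
  -- The test function has derivative f - G - m, m being the mean of f - G. The weak equation then
  -- says that the L² norm of f - G - m is zero.
  obtain ⟨h, hh, hh0, hhd⟩ := exists_isH1per_deriv_ae_eq hk2 hk0
  have hfi : IntervalIntegrable (fun x => f x * deriv h x) volume 0 (2 * Real.pi) := by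
    rw [intervalIntegrable_iff_integrableOn_Ioc_of_le two_pi_nonneg]
    exact hf.integrable_mul hh.2.1
  have hGi : IntervalIntegrable (fun x => G x * deriv h x) volume 0 (2 * Real.pi) := by
    rw [intervalIntegrable_iff_integrableOn_Ioc_of_le two_pi_nonneg]
    exact hG2.integrable_mul hh.2.1
  have hFhi : IntervalIntegrable (fun x => F x * h x) volume 0 (2 * Real.pi) :=
    (hF _ _).mul_continuousOn hh.continuous.continuousOn
  have hFchi : IntervalIntegrable (fun x => (F x + c) * h x) volume 0 (2 * Real.pi) :=
    (hFc _ _).mul_continuousOn hh.continuous.continuousOn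
  have h1 := hw h hh hh0
  rw [intervalIntegral.integral_add hfi hFhi] at h1
  have h2 := hh.integral_mul_eq_neg hFc hFc0
  have h3 : ∫ x in (0 : ℝ)..(2 * Real.pi), (F x + c) * h x
      = ∫ x in (0 : ℝ)..(2 * Real.pi), F x * h x := by
    have : ∀ x, (F x + c) * h x = F x * h x + c * h x := fun x => by ring
    simp_rw [this]
    rw [intervalIntegral.integral_add hFhi ((hh.continuous.intervalIntegrable _ _).const_mul c),
      intervalIntegral.integral_const_mul, hh0]
    ring
  have h4 : ∫ x in (0 : ℝ)..(2 * Real.pi), (f x * deriv h x - G x * deriv h x) = 0 := by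
    rw [intervalIntegral.integral_sub hfi hGi]
    simp only [hG] at h2 ⊢
    linarith
  have h5 : ∫ x in (0 : ℝ)..(2 * Real.pi), m * deriv h x = 0 := by
    rw [intervalIntegral.integral_const_mul, hh.integral_deriv_eq_zero, mul_zero]
  have h6 : ∫ x in (0 : ℝ)..(2 * Real.pi), (f x - G x - m) ^ 2 = 0 := by
    have : ∫ x in (0 : ℝ)..(2 * Real.pi), (f x - G x - m) ^ 2 =
        ∫ x in (0 : ℝ)..(2 * Real.pi), (f x * deriv h x - G x * deriv h x - m * deriv h x) := by
      rw [intervalIntegral.integral_of_le two_pi_nonneg,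
        intervalIntegral.integral_of_le two_pi_nonneg]
      apply integral_congr_ae
      filter_upwards [hhd] with x hx
      rw [hx]; ring
    rw [this, intervalIntegral.integral_sub (hfi.sub hGi)
      ((hh.intervalIntegrable_deriv _ _).const_mul m), h4, h5, sub_zero]
  rw [intervalIntegral.integral_of_le two_pi_nonneg] at h6
  rw [integral_eq_zero_iff_of_nonneg (fun x => sq_nonneg _) hk2.integrable_sq] at h6
  refine ⟨c, fun x => m + G x, fun x => ?_, fun x => ?_, ?_⟩
  · have hpF : Function.Periodic (fun x => F x + c) (2 * Real.pi) := fun x => by simp [hper x]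
    have h1 := hpF.intervalIntegral_add_eq_add 0 x hFc
    rw [zero_add, hFc0, add_zero] at h1
    simp only [hG, h1]
  · simp [hG]
  · filter_upwards [h6] with x hx
    have : f x - G x - m = 0 := by simpa using hx
    linarith

/-! ### Differentiation of parameter dependent integrals -/

lemma integral_period {E : Type*} [NormedAddCommGroup E] [NormedSpace ℝ E] (f : ℝ → E) :
    ∫ x in (0 : ℝ)..(2 * Real.pi), f x = ∫ x, f x ∂perVol :=
  intervalIntegral.integral_of_le two_pi_nonneg

/-- `u e x` is differentiable in the parameter `e ∈ (-ρ, ρ)` with derivative `du e x`, and both are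
dominated by a function of `x` in `L^p` over one period. -/
structure DiffFamily (p : ℝ≥0∞) (ρ : ℝ) (u du : ℝ → ℝ → ℝ) : Prop where
  hasDerivAt : ∀ᵐ x ∂perVol, ∀ e, |e| < ρ → HasDerivAt (fun e => u e x) (du e x) e
  meas : ∀ e, |e| < ρ → AEStronglyMeasurable (u e) perVol
  meas_deriv : ∀ e, |e| < ρ → AEStronglyMeasurable (du e) perVol
  bound : ∃ b : ℝ → ℝ, MemLp b p perVol ∧
    ∀ᵐ x ∂perVol, ∀ e, |e| < ρ → |u e x| ≤ b x ∧ |du e x| ≤ b x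

namespace DiffFamily

variable {p q r : ℝ≥0∞} {ρ : ℝ} {u du v dv : ℝ → ℝ → ℝ}

lemma add (hu : DiffFamily p ρ u du) (hv : DiffFamily p ρ v dv) :
    DiffFamily p ρ (fun e x => u e x + v e x) (fun e x => du e x + dv e x) := by
  obtain ⟨b, hb, hbu⟩ := hu.bound
  obtain ⟨c, hc, hcv⟩ := hv.bound
  refine ⟨?_, fun e he => (hu.meas e he).add (hv.meas e he),
    fun e he => (hu.meas_deriv e he).add (hv.meas_deriv e he), fun x => b x + c x, hb.add hc, ?_⟩
  · filter_upwards [hu.hasDerivAt, hv.hasDerivAt] with x h1 h2 e he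
    exact (h1 e he).add (h2 e he)
  · filter_upwards [hbu, hcv] with x h1 h2 e he
    exact ⟨(abs_add_le _ _).trans (add_le_add (h1 e he).1 (h2 e he).1),
      (abs_add_le _ _).trans (add_le_add (h1 e he).2 (h2 e he).2)⟩

/-- Hölder's inequality for the dominating functions. Thus the exponents can be tracked from L²
second derivatives and L^∞ first derivatives to the integrable energy density. -/
lemma mul [ENNReal.HolderTriple p q r] (hu : DiffFamily p ρ u du) (hv : DiffFamily q ρ v dv) :
    DiffFamily r ρ (fun e x => u e x * v e x) (fun e x => du e x * v e x + u e x * dv e x) := by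
  obtain ⟨b, hb, hbu⟩ := hu.bound
  obtain ⟨c, hc, hcv⟩ := hv.bound
  have hbc : MemLp (fun x => b x * c x) r perVol := MemLp.mul (p := p) (q := q) hc hb
  refine ⟨?_, fun e he => (hu.meas e he).mul (hv.meas e he),
    fun e he => ((hu.meas_deriv e he).mul (hv.meas e he)).add
      ((hu.meas e he).mul (hv.meas_deriv e he)), fun x => b x * c x + b x * c x, hbc.add hbc, ?_⟩
  · filter_upwards [hu.hasDerivAt, hv.hasDerivAt] with x h1 h2 e he
    exact (h1 e he).mul (h2 e he)
  · filter_upwards [hbu, hcv] with x h1 h2 e he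
    obtain ⟨a1, a2⟩ := h1 e he
    obtain ⟨a3, a4⟩ := h2 e he
    have hb0 : 0 ≤ b x := (abs_nonneg _).trans a1
    have hc0 : 0 ≤ c x := (abs_nonneg _).trans a3
    have e1 : |u e x * v e x| ≤ b x * c x := by
      rw [abs_mul]; exact mul_le_mul a1 a3 (abs_nonneg _) hb0
    have e2 : |du e x * v e x| ≤ b x * c x := by
      rw [abs_mul]; exact mul_le_mul a2 a3 (abs_nonneg _) hb0
    have e3 : |u e x * dv e x| ≤ b x * c x := by
      rw [abs_mul]; exact mul_le_mul a1 a4 (abs_nonneg _) hb0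
    exact ⟨by nlinarith [mul_nonneg hb0 hc0], (abs_add_le _ _).trans (add_le_add e2 e3)⟩

lemma const_mul (c : ℝ) (hu : DiffFamily p ρ u du) :
    DiffFamily p ρ (fun e x => c * u e x) (fun e x => c * du e x) := by
  obtain ⟨b, hb, hbu⟩ := hu.bound
  refine ⟨?_, fun e he => (hu.meas e he).const_mul c,
    fun e he => (hu.meas_deriv e he).const_mul c, fun x => |c| * b x, hb.const_mul |c|, ?_⟩
  · filter_upwards [hu.hasDerivAt] with x h1 e he
    exact (h1 e he).const_mul c
  · filter_upwards [hbu] with x h1 e he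
    rw [abs_mul, abs_mul]
    exact ⟨mul_le_mul_of_nonneg_left (h1 e he).1 (abs_nonneg c),
      mul_le_mul_of_nonneg_left (h1 e he).2 (abs_nonneg c)⟩

lemma affine {f g : ℝ → ℝ} (hf : MemLp f p perVol) (hg : MemLp g p perVol) :
    DiffFamily p ρ (fun e x => f x + e * g x) (fun _ x => g x) := by
  refine ⟨?_, fun e _ => hf.1.add (hg.1.const_mul e), fun e _ => hg.1,
    fun x => |f x| + (|ρ| + 1) * |g x|, hf.abs.add (hg.abs.const_mul _), ?_⟩
  · refine .of_forall fun x e _ => ?_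
    simpa using ((hasDerivAt_id e).mul_const (g x)).const_add (f x)
  · refine .of_forall fun x e he => ⟨?_, ?_⟩
    · refine (abs_add_le _ _).trans ?_
      rw [abs_mul]
      have : |e| ≤ |ρ| + 1 := by linarith [le_abs_self ρ]
      nlinarith [abs_nonneg (g x)]
    · nlinarith [abs_nonneg (g x), abs_nonneg (f x), abs_nonneg ρ]

lemma inv_sqrt {c : ℝ} (hc : 0 < c) (hu : DiffFamily ∞ ρ u du)
    (hlow : ∀ᵐ x ∂perVol, ∀ e, |e| < ρ → c ≤ u e x) :
    DiffFamily ∞ ρ (fun e x => (√(u e x))⁻¹)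
      (fun e x => -(du e x) / 2 * ((√(u e x))⁻¹ * (√(u e x))⁻¹ * (√(u e x))⁻¹)) := by
  obtain ⟨b, hb, hbu⟩ := hu.bound
  -- The number s bounds the inverse root and b s³ bounds its derivative; their sum dominates both.
  obtain ⟨s, hs⟩ : ∃ s : ℝ, s = (√c)⁻¹ := ⟨_, rfl⟩
  have hs0 : 0 < s := by rw [hs]; positivity
  have hB : MemLp (fun x => s + b x * (s * s * s)) ∞ perVol :=
    (memLp_perVol_of_continuous (f := fun _ => s) continuous_const ∞).add (hb.mul_const (s * s * s))
  have hms : ∀ e, |e| < ρ → AEStronglyMeasurable (fun x => (√(u e x))⁻¹) perVol :=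
    fun e he => (hu.meas e he).aemeasurable.sqrt.inv.aestronglyMeasurable
  refine ⟨?_, hms, fun e he => ?_, _, hB, ?_⟩
  · filter_upwards [hu.hasDerivAt, hlow] with x h1 h2 e he
    have hpos : 0 < u e x := hc.trans_le (h2 e he)
    have hsp : 0 < √(u e x) := Real.sqrt_pos.2 hpos
    refine (((h1 e he).sqrt hpos.ne').inv hsp.ne').congr_deriv ?_
    field_simp
  · have h2 := ((hu.meas_deriv e he).mul_const (-(1 / 2))).mul
      (((hms e he).mul (hms e he)).mul (hms e he))
    refine h2.congr (.of_forall fun x => ?_)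
    simp only [Pi.mul_apply]
    ring
  · filter_upwards [hbu, hlow] with x h1 h2 e he
    have hle : (√(u e x))⁻¹ ≤ s := by
      rw [hs]
      exact inv_anti₀ (Real.sqrt_pos.2 hc) (Real.sqrt_le_sqrt (h2 e he))
    have h0 : 0 ≤ (√(u e x))⁻¹ := by positivity
    have hb0 : 0 ≤ b x := (abs_nonneg _).trans (h1 e he).1
    constructor
    · rw [abs_of_nonneg h0]
      have : 0 ≤ b x * (s * s * s) := by positivity
      linarith
    · have h3 : 0 ≤ (√(u e x))⁻¹ * (√(u e x))⁻¹ * (√(u e x))⁻¹ :=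
        mul_nonneg (mul_nonneg h0 h0) h0
      rw [abs_mul, abs_of_nonneg h3, abs_div, abs_neg, abs_two]
      have e1 : |du e x| / 2 ≤ b x := by linarith [(h1 e he).2, abs_nonneg (du e x)]
      have e2 : (√(u e x))⁻¹ * (√(u e x))⁻¹ * (√(u e x))⁻¹ ≤ s * s * s := by gcongr
      have := mul_le_mul e1 e2 h3 hb0
      linarith

/-- Differentiation under the integral sign. -/
lemma hasDerivAt_integral (hρ : 0 < ρ) (hu : DiffFamily 1 ρ u du) :
    Integrable (du 0) perVol ∧
      HasDerivAt (fun e => ∫ x, u e x ∂perVol) (∫ x, du 0 x ∂perVol) 0 := by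
  obtain ⟨b, hb, hbu⟩ := hu.bound
  have h0 : |(0 : ℝ)| < ρ := by simpa
  have hball : ∀ e ∈ Metric.ball (0 : ℝ) ρ, |e| < ρ := fun e he => by simpa using he
  refine hasDerivAt_integral_of_dominated_loc_of_deriv_le (bound := b)
    (Metric.ball_mem_nhds (0 : ℝ) hρ) ?_ ?_ (hu.meas_deriv 0 h0) ?_ (memLp_one_iff_integrable.1 hb) ?_
  · filter_upwards [Metric.ball_mem_nhds (0 : ℝ) hρ] with e he using hu.meas e (hball e he)
  · refine (memLp_one_iff_integrable.1 hb).mono' (hu.meas 0 h0) ?_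
    filter_upwards [hbu] with x hx using (hx 0 h0).1
  · filter_upwards [hbu] with x hx e he using (hx e (hball e he)).2
  · filter_upwards [hu.hasDerivAt] with x hx e he using hx e (hball e he)

end DiffFamily

/-! ### The energies in coordinates -/

/-- The derivative of the inverse speed contributes a tangential vector only, which the inner
product with the normal removes. No assumption of constant speed is made, since γ + εφ does not have
constant speed. -/
lemma curvature_eq {c : ℝ → Plane} {x : ℝ} (h0 : deriv c x ≠ 0)
    (hd : DifferentiableAt ℝ (deriv c) x) :
    curvature c x = ‖deriv c x‖⁻¹ ^ 3 * ⟪deriv (deriv c) x, rotJ (deriv c x)⟫ := by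
  have hn : DifferentiableAt ℝ (fun y => ‖deriv c y‖⁻¹) x :=
    (hd.norm ℝ h0).inv (norm_ne_zero_iff.2 h0)
  have ht : HasDerivAt (tangent c) (‖deriv c x‖⁻¹ • deriv (deriv c) x +
      deriv (fun y => ‖deriv c y‖⁻¹) x • deriv c x) x :=
    hn.hasDerivAt.smul hd.hasDerivAt
  unfold curvature arcDeriv
  rw [ht.deriv]
  simp only [normal, tangent, arcDeriv, plane_inner, rotJ_zero, rotJ_one, PiLp.smul_apply,
    PiLp.add_apply, smul_eq_mul]
  ring

lemma sum_curveGrad_sq {c n : ℝ → Plane} {x : ℝ} (h0 : deriv c x ≠ 0) :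
    ∑ i, ∑ j, curveGrad c n x i j ^ 2 =
      ‖deriv c x‖⁻¹ ^ 2 * (deriv n x 0 ^ 2 + deriv n x 1 ^ 2) := by
  have h1 : ‖deriv c x‖ ≠ 0 := norm_ne_zero_iff.2 h0
  have h2 := plane_norm_sq (deriv c x)
  simp only [curveGrad, Matrix.of_apply, arcDeriv, tangent, Fin.sum_univ_two, PiLp.smul_apply,
    smul_eq_mul]
  field_simp
  rw [h2]

/-- The inverse of the speed, in coordinates. -/
noncomputable def invSpeed (p : Plane) : ℝ := (√(p 0 * p 0 + p 1 * p 1))⁻¹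

lemma invSpeed_eq (p : Plane) : invSpeed p = ‖p‖⁻¹ := by
  rw [invSpeed, EuclideanSpace.norm_eq]
  simp [Fin.sum_univ_two, sq]

/-- The integrands are written as the sums and products that the operations on `DiffFamily` produce,
including the factors -1 and the repeated products in place of powers. This allows the
differentiated family to be matched with the energy. -/
lemma energyE_eq (δ lam : ℝ) {c n : ℝ → Plane}
    (h : ∀ᵐ x ∂perVol, deriv c x ≠ 0 ∧ DifferentiableAt ℝ (deriv c) x) :
    energyE δ lam c n =
      1 / 2 * (∫ x, (invSpeed (deriv c x) * invSpeed (deriv c x) * invSpeed (deriv c x) *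
          (deriv (deriv c) x 1 * deriv c x 0 + (-1) * (deriv (deriv c) x 0 * deriv c x 1)) +
          δ * (invSpeed (deriv c x) * invSpeed (deriv c x) *
            (deriv n x 0 * deriv c x 0 + deriv n x 1 * deriv c x 1))) *
          (invSpeed (deriv c x) * invSpeed (deriv c x) * invSpeed (deriv c x) *
          (deriv (deriv c) x 1 * deriv c x 0 + (-1) * (deriv (deriv c) x 0 * deriv c x 1)) +
          δ * (invSpeed (deriv c x) * invSpeed (deriv c x) *
            (deriv n x 0 * deriv c x 0 + deriv n x 1 * deriv c x 1))) *
          ((deriv c x 0 * deriv c x 0 + deriv c x 1 * deriv c x 1) * invSpeed (deriv c x)) ∂perVol) +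
      lam / 2 * ∫ x, (deriv n x 0 * deriv n x 0 + deriv n x 1 * deriv n x 1) *
        invSpeed (deriv c x) ∂perVol := by
  unfold energyE arcIntegral
  rw [integral_period, integral_period]
  congr 2
  · apply integral_congr_ae
    filter_upwards [h] with x ⟨h0, hd⟩
    have h1 : ‖deriv c x‖ ≠ 0 := norm_ne_zero_iff.2 h0
    have h2 := plane_norm_sq (deriv c x)
    rw [curvature_eq h0 hd, invSpeed_eq]
    simp only [curveDiv, plane_inner, arcDeriv, tangent, rotJ_zero, rotJ_one, PiLp.smul_apply,
      smul_eq_mul]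
    rw [show deriv c x 0 * deriv c x 0 + deriv c x 1 * deriv c x 1 = ‖deriv c x‖ ^ 2 by
      rw [h2]; ring]
    field_simp
    ring
  · apply integral_congr_ae
    filter_upwards [h] with x ⟨h0, hd⟩
    have h1 : ‖deriv c x‖ ≠ 0 := norm_ne_zero_iff.2 h0
    rw [sum_curveGrad_sq h0, invSpeed_eq]
    field_simp

lemma curveLength_eq (c : ℝ → Plane) :
    curveLength c = ∫ x, (deriv c x 0 * deriv c x 0 + deriv c x 1 * deriv c x 1) *
      invSpeed (deriv c x) ∂perVol := by
  unfold curveLength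
  rw [integral_period]
  congr 1 with x
  rw [show deriv c x 0 * deriv c x 0 + deriv c x 1 * deriv c x 1 = ‖deriv c x‖ ^ 2 by
      rw [plane_norm_sq]; ring, invSpeed_eq]
  -- Where the speed vanishes both sides are 0, since the inverse of 0 is 0.
  by_cases h : ‖deriv c x‖ = 0
  · simp [h]
  · field_simp

lemma curveArea_eq (c : ℝ → Plane) :
    curveArea c = -(1 / 2) * ∫ x, (-1) * (c x 0 * deriv c x 1) + c x 1 * deriv c x 0 ∂perVol := by
  unfold curveArea
  rw [integral_period]
  congr 2 with x
  simp [plane_inner]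

/-! ### First variations -/

/-- The density `w = κ + δ div η`, as a function of `∂ₓγ`, `∂ₓ²γ`, `∂ₓη`, along a curve with constant
speed `r`. -/
noncomputable def bendDensity (δ r : ℝ) (p q ζ : Plane) : ℝ :=
  (q 1 * p 0 - q 0 * p 1) / r ^ 3 + δ * (ζ 0 * p 0 + ζ 1 * p 1) / r ^ 2

/-- The coefficient of `∂ₓ²φ` in the first variation of the energy. -/
noncomputable def coeffA (δ r : ℝ) (p q ζ : Plane) : Plane :=
  (bendDensity δ r p q ζ / r ^ 2) • rotJ p

/-- The coefficient of `∂ₓφ` in the first variation of the energy. -/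
noncomputable def coeffB (δ lam r : ℝ) (p q ζ : Plane) : Plane :=
  (-(3 / 2) * bendDensity δ r p q ζ ^ 2 / r - lam / 2 * (ζ 0 ^ 2 + ζ 1 ^ 2) / r ^ 3) • p +
    (δ * bendDensity δ r p q ζ / r) • ζ

/-- The coefficient of `∂ₓψ` in the first variation of the energy. -/
noncomputable def coeffC (δ lam r : ℝ) (p q ζ : Plane) : Plane :=
  (δ * bendDensity δ r p q ζ / r) • p + (lam / r) • ζ

lemma memLp_coord {f : ℝ → Plane} {p : ℝ≥0∞} (hf : MemLp f p perVol) (i : Fin 2) :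
    MemLp (fun x => f x i) p perVol :=
  hf.continuousLinearMap_comp (EuclideanSpace.proj i : Plane →L[ℝ] ℝ)

lemma continuous_coord {f : ℝ → Plane} (hf : Continuous f) (i : Fin 2) :
    Continuous (fun x => f x i) :=
  (EuclideanSpace.proj i : Plane →L[ℝ] ℝ).continuous.comp hf

/-- Close to a curve of constant speed, speeds are bounded below. -/
lemma exists_speed_lower_bound {γ φ : ℝ → Plane} {r : ℝ} (hr : 0 < r) (hφ : IsH2per φ)
    (hs : ∀ x, ‖deriv γ x‖ = r) :
    ∃ ρ > 0, ∀ e, |e| < ρ → ∀ x, r ^ 2 / 4 ≤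
      (deriv γ x 0 + e * deriv φ x 0) * (deriv γ x 0 + e * deriv φ x 0) +
      (deriv γ x 1 + e * deriv φ x 1) * (deriv γ x 1 + e * deriv φ x 1) := by
  obtain ⟨C, hC, hb⟩ := hφ.2.exists_bound
  -- With this radius the perturbation of the velocity is at most r/2, which leaves a speed of at
  -- least r/2.
  refine ⟨r / (2 * C), by positivity, fun e he x => ?_⟩
  have h1 : ‖e • deriv φ x‖ ≤ r / 2 := by
    rw [norm_smul, Real.norm_eq_abs]
    calc |e| * ‖deriv φ x‖ ≤ r / (2 * C) * C := by
          gcongr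
          exact hb x
      _ = r / 2 := by field_simp
  have h2 : r / 2 ≤ ‖deriv γ x + e • deriv φ x‖ := by
    have := norm_sub_le_norm_add (deriv γ x) (e • deriv φ x)
    rw [hs x] at this
    linarith
  have h3 := plane_norm_sq (deriv γ x + e • deriv φ x)
  simp only [PiLp.add_apply, PiLp.smul_apply, smul_eq_mul] at h3
  nlinarith

lemma ae_variation {γ φ η ψ : ℝ → Plane} (hγ : IsH2per γ) (hφ : IsH2per φ) (hη : IsH1per η)
    (hψ : IsH1per ψ) (e : ℝ) :
    ∀ᵐ x ∂perVol, deriv (γ + e • φ) x = deriv γ x + e • deriv φ x ∧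
      DifferentiableAt ℝ (deriv (γ + e • φ)) x ∧
      deriv (deriv (γ + e • φ)) x = deriv (deriv γ) x + e • deriv (deriv φ) x ∧
      deriv (η + e • ψ) x = deriv η x + e • deriv ψ x := by
  apply ae_restrict_of_ae
  have h1 := hφ.const_smul e
  have h2 := hγ.add h1.1
  have h3 := hψ.const_smul e
  have h4 := hη.add h3.1
  filter_upwards [h2.1.2.ae_hasDerivAt, h1.2.2, h2.2.2, h3.2, h4.2] with x e1 e2 e3 e4 e5
  refine ⟨?_, e1.differentiableAt, ?_, ?_⟩
  · rw [h2.2.1, h1.2.1]; rfl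
  · rw [e3, Pi.add_apply, e2]; rfl
  · rw [e5, Pi.add_apply, e4]; rfl

section Variation

variable {γ φ η ψ : ℝ → Plane} {r : ℝ}

lemma diffFamily_coord {ρ : ℝ} {p : ℝ≥0∞} {f g : ℝ → Plane} (hf : MemLp f p perVol)
    (hg : MemLp g p perVol) (i : Fin 2) :
    DiffFamily p ρ (fun e x => f x i + e * g x i) (fun _ x => g x i) :=
  DiffFamily.affine (memLp_coord hf i) (memLp_coord hg i)

/-- Along a curve of constant speed the second derivative is orthogonal to the first. -/
lemma ae_orthogonal (hγ : IsH2per γ) (hs : ∀ x, ‖deriv γ x‖ = r) :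
    ∀ᵐ x, deriv γ x 0 * deriv (deriv γ) x 0 + deriv γ x 1 * deriv (deriv γ) x 1 = 0 := by
  filter_upwards [hγ.2.ae_hasDerivAt] with x hx
  have h0 := hasDerivAt_coord hx 0
  have h1 := hasDerivAt_coord hx 1
  have h2 := (h0.mul h0).add (h1.mul h1)
  have h3 : ((fun y => deriv γ y 0) * (fun y => deriv γ y 0) +
      (fun y => deriv γ y 1) * (fun y => deriv γ y 1)) = fun _ => r ^ 2 := by
    funext y
    rw [← hs y, plane_norm_sq]
    simp only [Pi.add_apply, Pi.mul_apply]
    ring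
  rw [h3] at h2
  have := h2.unique (hasDerivAt_const x (r ^ 2))
  linarith

/-- The first variation of the energy at a curve of constant speed. -/
lemma hasDerivAt_energyE (δ lam : ℝ) (hγ : IsH2per γ) (hφ : IsH2per φ) (hη : IsH1per η)
    (hψ : IsH1per ψ) (hr : 0 < r) (hs : ∀ x, ‖deriv γ x‖ = r) :
    HasDerivAt (fun e : ℝ => energyE δ lam (γ + e • φ) (η + e • ψ))
      (∫ x, (⟪coeffA δ r (deriv γ x) (deriv (deriv γ) x) (deriv η x), deriv (deriv φ) x⟫ +
        ⟪coeffB δ lam r (deriv γ x) (deriv (deriv γ) x) (deriv η x), deriv φ x⟫ +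
        ⟪coeffC δ lam r (deriv γ x) (deriv (deriv γ) x) (deriv η x), deriv ψ x⟫) ∂perVol) 0 := by
  obtain ⟨ρ, hρ, hlow⟩ := exists_speed_lower_bound hr hφ hs
  have hp0 := diffFamily_coord (ρ := ρ) (memLp_perVol_of_continuous hγ.2.continuous ∞)
    (memLp_perVol_of_continuous hφ.2.continuous ∞) 0
  have hp1 := diffFamily_coord (ρ := ρ) (memLp_perVol_of_continuous hγ.2.continuous ∞)
    (memLp_perVol_of_continuous hφ.2.continuous ∞) 1
  have hq0 := diffFamily_coord (ρ := ρ) hγ.2.2.1 hφ.2.2.1 0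
  have hq1 := diffFamily_coord (ρ := ρ) hγ.2.2.1 hφ.2.2.1 1
  have hz0 := diffFamily_coord (ρ := ρ) hη.2.1 hψ.2.1 0
  have hz1 := diffFamily_coord (ρ := ρ) hη.2.1 hψ.2.1 1
  have hV := ((hp0.mul (r := ∞) hp0).add (hp1.mul (r := ∞) hp1))
  have hi := hV.inv_sqrt (c := r ^ 2 / 4) (by positivity) (.of_forall fun x e he => hlow e he x)
  have hi2 := hi.mul (r := ∞) hi
  have hi3 := hi2.mul (r := ∞) hi
  have hK := (hq1.mul (r := 2) hp0).add ((hq0.mul (r := 2) hp1).const_mul (-1))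
  have hS := (hz0.mul (r := 2) hp0).add (hz1.mul (r := 2) hp1)
  have hw := (hi3.mul (r := 2) hK).add ((hi2.mul (r := 2) hS).const_mul δ)
  have hVi := hV.mul (r := ∞) hi
  obtain ⟨hI1, hD1⟩ := ((hw.mul (r := 1) hw).mul (r := 1) hVi).hasDerivAt_integral hρ
  obtain ⟨hI2, hD2⟩ := (((hz0.mul (r := 1) hz0).add (hz1.mul (r := 1) hz1)).mul (r := 1)
    hi).hasDerivAt_integral hρ
  have hD := (hD1.const_mul (1 / 2)).add (hD2.const_mul (lam / 2))
  refine (hD.congr_of_eventuallyEq ?_).congr_deriv ?_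
  · refine Filter.eventually_of_mem (Metric.ball_mem_nhds (0 : ℝ) hρ) fun e he => ?_
    have he' : |e| < ρ := by simpa using he
    have hv := ae_variation hγ hφ hη hψ e
    have hne : ∀ x, deriv γ x + e • deriv φ x ≠ 0 := by
      intro x h0
      have h1 := hlow e he' x
      have h2 := congrArg (fun v : Plane => v 0) h0
      have h3 := congrArg (fun v : Plane => v 1) h0
      simp only [PiLp.add_apply, PiLp.smul_apply, smul_eq_mul, PiLp.zero_apply] at h2 h3
      rw [h2, h3] at h1
      have : 0 < r ^ 2 := by positivity
      linarith
    beta_reduce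
    rw [energyE_eq δ lam (hv.mono fun x hx => ⟨by rw [hx.1]; exact hne x, hx.2.1⟩)]
    simp only [Pi.add_apply]
    congr 2
    · apply integral_congr_ae
      filter_upwards [hv] with x ⟨e1, _, e2, e3⟩
      simp only [e1, e2, e3, invSpeed, PiLp.add_apply, PiLp.smul_apply, smul_eq_mul]
    · apply integral_congr_ae
      filter_upwards [hv] with x ⟨e1, _, _, e3⟩
      simp only [e1, e3, invSpeed, PiLp.add_apply, PiLp.smul_apply, smul_eq_mul]
  rw [← integral_const_mul, ← integral_const_mul,
    ← integral_add (hI1.const_mul _) (hI2.const_mul _)]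
  apply integral_congr_ae
  filter_upwards [ae_restrict_of_ae (ae_orthogonal hγ hs)] with x horth
  have hV0 : deriv γ x 0 * deriv γ x 0 + deriv γ x 1 * deriv γ x 1 = r ^ 2 := by
    rw [← hs x, plane_norm_sq]; ring
  simp only [zero_mul, add_zero, hV0, Real.sqrt_sq hr.le, coeffA, coeffB, coeffC, plane_inner,
    PiLp.add_apply, PiLp.smul_apply, smul_eq_mul, rotJ_zero, rotJ_one, bendDensity]
  generalize deriv γ x 0 = p0 at *
  generalize deriv γ x 1 = p1 at *
  generalize deriv (deriv γ) x 0 = q0 at *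
  generalize deriv (deriv γ) x 1 = q1 at *
  generalize deriv φ x 0 = h0 at *
  generalize deriv φ x 1 = h1 at *
  generalize deriv (deriv φ) x 0 = k0 at *
  generalize deriv (deriv φ) x 1 = k1 at *
  generalize deriv η x 0 = z0 at *
  generalize deriv η x 1 = z1 at *
  generalize deriv ψ x 0 = y0 at *
  generalize deriv ψ x 1 = y1 at *
  -- At constant speed q is orthogonal to p, hence q = (K/r²) Jp. Substituting this turns the raw
  -- derivative into the form with `coeffA`, `coeffB`, `coeffC`.
  obtain ⟨K, hK⟩ : ∃ K, K = (q1 * p0 - q0 * p1) := ⟨_, rfl⟩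
  have e0 : q0 = -(K * p1) / r ^ 2 := by
    rw [hK]; field_simp; linear_combination -q0 * hV0 + p0 * horth
  have e1 : q1 = K * p0 / r ^ 2 := by
    rw [hK]; field_simp; linear_combination -q1 * hV0 + p1 * horth
  have hqh : q1 * h0 + -1 * (q0 * h1) = K * (p0 * h0 + p1 * h1) / r ^ 2 := by
    rw [e0, e1]; field_simp
  have hK' : q1 * p0 + -1 * (q0 * p1) = K := by rw [hK]; ring
  have hA : k1 * p0 + q1 * h0 + -1 * (k0 * p1 + q0 * h1) =
      k1 * p0 - k0 * p1 + K * (p0 * h0 + p1 * h1) / r ^ 2 := by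
    rw [← hqh]; ring
  rw [← hK, hK', hA]
  field_simp
  ring

/-- The first variation of length at a curve of constant speed. -/
lemma hasDerivAt_curveLength (hγ : IsH2per γ) (hφ : IsH2per φ) (hr : 0 < r)
    (hs : ∀ x, ‖deriv γ x‖ = r) :
    HasDerivAt (fun e : ℝ => curveLength (γ + e • φ))
      (∫ x, ⟪r⁻¹ • deriv γ x, deriv φ x⟫ ∂perVol) 0 := by
  obtain ⟨ρ, hρ, hlow⟩ := exists_speed_lower_bound hr hφ hs
  have hp0 := diffFamily_coord (ρ := ρ) (memLp_perVol_of_continuous hγ.2.continuous ∞)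
    (memLp_perVol_of_continuous hφ.2.continuous ∞) 0
  have hp1 := diffFamily_coord (ρ := ρ) (memLp_perVol_of_continuous hγ.2.continuous ∞)
    (memLp_perVol_of_continuous hφ.2.continuous ∞) 1
  -- Multiplication by the constant 1, seen as a family in L¹, lowers the exponent from ∞ to 1, as
  -- differentiation under the integral requires.
  have hone : DiffFamily 1 ρ (fun _ _ => 1) (fun _ _ => 0) := by
    simpa using DiffFamily.affine (ρ := ρ) (p := 1)
      (memLp_perVol_of_continuous (f := fun _ => (1 : ℝ)) continuous_const 1)
      (memLp_perVol_of_continuous (f := fun _ => (0 : ℝ)) continuous_const 1)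
  have hV := ((hp0.mul (r := ∞) hp0).add (hp1.mul (r := ∞) hp1))
  have hi := hV.inv_sqrt (c := r ^ 2 / 4) (by positivity) (.of_forall fun x e he => hlow e he x)
  obtain ⟨-, hD⟩ := ((hV.mul (r := ∞) hi).mul (r := 1) hone).hasDerivAt_integral hρ
  refine (hD.congr_of_eventuallyEq (.of_forall fun e => ?_)).congr_deriv ?_
  · beta_reduce
    rw [curveLength_eq]
    apply integral_congr_ae
    filter_upwards [ae_variation hγ hφ hγ.1 hφ.1 e] with x ⟨e1, _⟩
    simp only [e1, invSpeed, PiLp.add_apply, PiLp.smul_apply, smul_eq_mul, mul_one]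
  · congr 1 with x
    have hV0 : deriv γ x 0 * deriv γ x 0 + deriv γ x 1 * deriv γ x 1 = r ^ 2 := by
      rw [← hs x, plane_norm_sq]; ring
    simp only [zero_mul, add_zero, hV0, Real.sqrt_sq hr.le, plane_inner, PiLp.smul_apply,
      smul_eq_mul]
    field_simp
    ring

/-- The first variation of area. -/
lemma hasDerivAt_curveArea (hγ : IsH2per γ) (hφ : IsH2per φ) :
    HasDerivAt (fun e : ℝ => curveArea (γ + e • φ))
      (∫ x, ⟪rotJ (γ x), deriv φ x⟫ ∂perVol) 0 := by
  have hc (f g : ℝ → Plane) (hf : Continuous f) (hg : Continuous g) (i : Fin 2) :=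
    diffFamily_coord (ρ := 1) (memLp_perVol_of_continuous hf ∞) (memLp_perVol_of_continuous hg ∞) i
  have hone : DiffFamily 1 1 (fun _ _ => 1) (fun _ _ => 0) := by
    simpa using DiffFamily.affine (ρ := 1) (p := 1)
      (memLp_perVol_of_continuous (f := fun _ => (1 : ℝ)) continuous_const 1)
      (memLp_perVol_of_continuous (f := fun _ => (0 : ℝ)) continuous_const 1)
  have hp := hc _ _ hγ.2.continuous hφ.2.continuous
  have hg := hc _ _ hγ.1.continuous hφ.1.continuous
  have hsum := (((hg 0).mul (r := ∞) (hp 1)).const_mul (-1)).add ((hg 1).mul (r := ∞) (hp 0))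
  obtain ⟨-, hD⟩ := (hsum.mul (r := 1) hone).hasDerivAt_integral one_pos
  refine ((hD.const_mul (-(1 / 2))).congr_of_eventuallyEq (.of_forall fun e => ?_)).congr_deriv ?_
  · beta_reduce
    rw [curveArea_eq]
    congr 1
    apply integral_congr_ae
    filter_upwards [ae_variation hγ hφ hγ.1 hφ.1 e] with x ⟨e1, _⟩
    simp only [e1, PiLp.add_apply, Pi.add_apply, Pi.smul_apply, PiLp.smul_apply, smul_eq_mul,
      mul_one]
  · have hG := fun i => (hγ.1.coord i)
    have hF := fun i => (hφ.1.coord i)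
    have h01 := (hG 0).1.mul (hF 1).1
    have h10 := (hG 1).1.mul (hF 0).1
    have i01 := h01.1.integral_deriv_eq_zero
    have i10 := h10.1.integral_deriv_eq_zero
    rw [integral_period] at i01 i10
    have hcp : ∀ f : ℝ → ℝ, Continuous f → Integrable f perVol := fun f hf =>
      memLp_one_iff_integrable.1 (memLp_perVol_of_continuous hf 1)
    have c0 := continuous_coord hγ.1.continuous
    have c1 := continuous_coord hφ.1.continuous
    have c2 := continuous_coord hγ.2.continuous
    have c3 := continuous_coord hφ.2.continuous
    -- Integrals of derivatives of the periodic products γ₀φ₁ and γ₁φ₀ vanish; adding them moves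
    -- every derivative from γ to φ.
    have j01 : ∫ x, (deriv γ x 0 * φ x 1 + γ x 0 * deriv φ x 1) ∂perVol = 0 := by
      rw [← i01]
      apply integral_congr_ae
      filter_upwards [ae_restrict_of_ae h01.2, ae_restrict_of_ae (hG 0).2,
        ae_restrict_of_ae (hF 1).2] with x a b c
      rw [a, b, c]
    have j10 : ∫ x, (deriv γ x 1 * φ x 0 + γ x 1 * deriv φ x 0) ∂perVol = 0 := by
      rw [← i10]
      apply integral_congr_ae
      filter_upwards [ae_restrict_of_ae h10.2, ae_restrict_of_ae (hG 1).2,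
        ae_restrict_of_ae (hF 0).2] with x a b c
      rw [a, b, c]
    have k01 : Integrable (fun x => deriv γ x 0 * φ x 1 + γ x 0 * deriv φ x 1) perVol :=
      hcp _ (((c2 0).mul (c1 1)).add ((c0 0).mul (c3 1)))
    have k10 : Integrable (fun x => deriv γ x 1 * φ x 0 + γ x 1 * deriv φ x 0) perVol :=
      hcp _ (((c2 1).mul (c1 0)).add ((c0 1).mul (c3 0)))
    have k : Integrable (fun x => ⟪rotJ (γ x), deriv φ x⟫) perVol := by
      simp only [plane_inner, rotJ_zero, rotJ_one]
      exact hcp _ (((c0 1).neg.mul (c3 0)).add ((c0 0).mul (c3 1)))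
    rw [← integral_const_mul]
    have : ∫ x, ⟪rotJ (γ x), deriv φ x⟫ ∂perVol = ∫ x, (⟪rotJ (γ x), deriv φ x⟫ +
        (1 / 2 * (deriv γ x 1 * φ x 0 + γ x 1 * deriv φ x 0) +
        (-(1 / 2)) * (deriv γ x 0 * φ x 1 + γ x 0 * deriv φ x 1))) ∂perVol := by
      have kk : Integrable (fun x => 1 / 2 * (deriv γ x 1 * φ x 0 + γ x 1 * deriv φ x 0) +
        (-(1 / 2)) * (deriv γ x 0 * φ x 1 + γ x 0 * deriv φ x 1)) perVol :=
        (k10.const_mul _).add (k01.const_mul _)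
      rw [integral_add k kk,
        integral_add (k10.const_mul _) (k01.const_mul _), integral_const_mul, integral_const_mul,
        j01, j10]
      simp
    rw [this]
    congr 1 with x
    simp only [plane_inner, rotJ_zero, rotJ_one, zero_mul, add_zero, mul_one, mul_zero]
    ring

/-- The density `w` of a pair of curves. -/
lemma memLp_bendDensity (δ : ℝ) (hγ : IsH2per γ) (hη : IsH1per η) :
    MemLp (fun x => bendDensity δ r (deriv γ x) (deriv (deriv γ) x) (deriv η x)) 2 perVol := by
  have hp := fun i => memLp_perVol_of_continuous (continuous_coord hγ.2.continuous i) ∞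
  have hq := fun i => memLp_coord hγ.2.2.1 i
  have hz := fun i => memLp_coord hη.2.1 i
  have h1 : ∀ i j, MemLp (fun x => deriv (deriv γ) x i * deriv γ x j) 2 perVol :=
    fun i j => MemLp.mul (p := 2) (q := ∞) (hp j) (hq i)
  have h2 : ∀ i j, MemLp (fun x => deriv η x i * deriv γ x j) 2 perVol :=
    fun i j => MemLp.mul (p := 2) (q := ∞) (hp j) (hz i)
  have h := (((h1 1 0).sub (h1 0 1)).mul_const (r ^ 3)⁻¹).add
    (((h2 0 0).add (h2 1 1)).const_mul (δ * (r ^ 2)⁻¹))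
  refine (memLp_congr_ae (.of_forall fun x => ?_)).1 h
  simp only [bendDensity, Pi.add_apply, Pi.sub_apply]
  ring

lemma memLp_smul_continuous {u : ℝ → ℝ} {f : ℝ → Plane} {p : ℝ≥0∞} (hu : MemLp u p perVol)
    (hf : Continuous f) : MemLp (fun x => u x • f x) p perVol :=
  MemLp.smul (p := p) (q := ∞) (memLp_perVol_of_continuous hf ∞) hu

lemma memLp_coeffA (δ : ℝ) (hγ : IsH2per γ) (hη : IsH1per η) :
    MemLp (fun x => coeffA δ r (deriv γ x) (deriv (deriv γ) x) (deriv η x)) 2 perVol :=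
  memLp_smul_continuous ((memLp_bendDensity δ hγ hη).mul_const (r ^ 2)⁻¹)
    (rotJL.continuous.comp hγ.2.continuous)

lemma memLp_coeffC (δ lam : ℝ) (hγ : IsH2per γ) (hη : IsH1per η) :
    MemLp (fun x => coeffC δ lam r (deriv γ x) (deriv (deriv γ) x) (deriv η x)) 2 perVol := by
  have h := (memLp_smul_continuous ((memLp_bendDensity (r := r) δ hγ hη).const_mul (δ * r⁻¹))
    hγ.2.continuous).add (hη.2.1.const_smul (lam / r))
  refine (memLp_congr_ae (.of_forall fun x => ?_)).1 h
  simp only [coeffC, Pi.add_apply, Pi.smul_apply]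
  ring_nf

/-- This coefficient is quadratic in w and ∂ₓη, which are only in L², so it is merely integrable.
That suffices because it is paired with the continuous function ∂ₓφ. -/
lemma memLp_coeffB (δ lam : ℝ) (hγ : IsH2per γ) (hη : IsH1per η) :
    MemLp (fun x => coeffB δ lam r (deriv γ x) (deriv (deriv γ) x) (deriv η x)) 1 perVol := by
  have hw := memLp_bendDensity (r := r) δ hγ hη
  have hz := fun i => memLp_coord hη.2.1 i
  have h1 := MemLp.mul (p := 2) (q := 2) (r := 1) hw hw
  have h2 := fun i => MemLp.mul (p := 2) (q := 2) (r := 1) (hz i) (hz i)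
  have h3 : MemLp (fun x => (δ * r⁻¹ * bendDensity δ r (deriv γ x) (deriv (deriv γ) x) (deriv η x)) •
      deriv η x) 1 perVol :=
    MemLp.smul (p := 2) (q := 2) (r := 1) hη.2.1 (hw.const_mul (δ * r⁻¹))
  have h4 := (memLp_smul_continuous ((h1.const_mul (-(3 / 2) * r⁻¹)).sub
    (((h2 0).add (h2 1)).const_mul (lam / 2 * (r ^ 3)⁻¹))) hγ.2.continuous).add h3
  refine (memLp_congr_ae (.of_forall fun x => ?_)).1 h4
  simp only [coeffB, Pi.add_apply, Pi.sub_apply, Pi.mul_apply]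
  congr 2 <;> ring

end Variation

/-! ### Inequalities in `L²` and `H¹` -/

lemma integrable_mul_of_memLp {f g : ℝ → ℝ} (hf : MemLp f 2 perVol) (hg : MemLp g 2 perVol) :
    Integrable (fun x => f x * g x) perVol := hf.integrable_mul hg

/-- The Cauchy-Schwarz inequality on a period. -/
lemma sq_integral_mul_le {f g : ℝ → ℝ} (hf : MemLp f 2 perVol) (hg : MemLp g 2 perVol) :
    (∫ x, f x * g x ∂perVol) ^ 2 ≤ (∫ x, f x ^ 2 ∂perVol) * ∫ x, g x ^ 2 ∂perVol := by
  have hfg := integrable_mul_of_memLp hf hg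
  -- The quadratic polynomial ∫(f + tg)² in t is nonnegative, so its discriminant is not positive.
  have key : ∀ t : ℝ, 0 ≤ (∫ x, g x ^ 2 ∂perVol) * (t * t) + 2 * (∫ x, f x * g x ∂perVol) * t +
      ∫ x, f x ^ 2 ∂perVol := by
    intro t
    have h1 : 0 ≤ ∫ x, (f x + t * g x) ^ 2 ∂perVol := integral_nonneg fun x => sq_nonneg _
    have h2 : ∫ x, (f x + t * g x) ^ 2 ∂perVol =
        ∫ x, (f x ^ 2 + (2 * t) * (f x * g x)) + t ^ 2 * g x ^ 2 ∂perVol := by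
      congr 1 with x; ring
    have h3 : Integrable (fun x => f x ^ 2 + (2 * t) * (f x * g x)) perVol :=
      hf.integrable_sq.add (hfg.const_mul _)
    rw [h2, integral_add h3 (hg.integrable_sq.const_mul _),
      integral_add hf.integrable_sq (hfg.const_mul _), integral_const_mul, integral_const_mul] at h1
    linarith
  have := discrim_le_zero key
  rw [discrim] at this
  nlinarith

lemma sq_integral_abs_le {f : ℝ → ℝ} (hf : MemLp f 2 perVol) :
    (∫ x, |f x| ∂perVol) ^ 2 ≤ 2 * Real.pi * ∫ x, f x ^ 2 ∂perVol := by
  have h := sq_integral_mul_le (f := fun _ => 1) (g := fun x => |f x|)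
    (memLp_perVol_of_continuous continuous_const 2) hf.abs
  simpa [Real.pi_nonneg] using h

lemma hNorm_nonneg {E : Type*} [NormedAddCommGroup E] [NormedSpace ℝ E] (k : ℕ) (f : ℝ → E) :
    0 ≤ hNorm k f := Real.sqrt_nonneg _

lemma hNorm_sq {E : Type*} [NormedAddCommGroup E] [NormedSpace ℝ E] (k : ℕ) (f : ℝ → E) :
    hNorm k f ^ 2 = ∑ j ∈ Finset.range (k + 1), ∫ x, ‖iteratedDeriv j f x‖ ^ 2 ∂perVol := by
  rw [hNorm, Real.sq_sqrt]
  · simp_rw [integral_period]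
  · simp_rw [integral_period]
    exact Finset.sum_nonneg fun j _ => integral_nonneg fun x => sq_nonneg _

lemma integral_sq_iteratedDeriv_le {E : Type*} [NormedAddCommGroup E] [NormedSpace ℝ E] {k j : ℕ}
    (hj : j ≤ k) (f : ℝ → E) :
    ∫ x, ‖iteratedDeriv j f x‖ ^ 2 ∂perVol ≤ hNorm k f ^ 2 := by
  rw [hNorm_sq]
  exact Finset.single_le_sum (f := fun j => ∫ x, ‖iteratedDeriv j f x‖ ^ 2 ∂perVol)
    (fun j _ => integral_nonneg fun x => sq_nonneg _) (Finset.mem_range.2 (by omega))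

lemma IsH1per.abs_sub_le {g : ℝ → ℝ} (hg : IsH1per g) {x y : ℝ} (hx : x ∈ Icc 0 (2 * Real.pi))
    (hy : y ∈ Icc 0 (2 * Real.pi)) : |g x - g y| ≤ ∫ t, |deriv g t| ∂perVol := by
  have h1 : g x - g y = ∫ t in y..x, deriv g t := by
    have := intervalIntegral.integral_interval_sub_left (hg.intervalIntegrable_deriv 0 x)
      (hg.intervalIntegrable_deriv 0 y)
    rw [← this, hg.2.2 x, hg.2.2 y]; ring
  rw [h1]
  refine (intervalIntegral.norm_integral_le_integral_norm_uIoc (E := ℝ)).trans ?_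
  refine setIntegral_mono_set (hg.2.1.integrable (by norm_num)).abs
    (.of_forall fun t => abs_nonneg _) (.of_forall fun t ht => ?_)
  rcases mem_uIoc.1 ht with h | h
  · exact ⟨hy.1.trans_lt h.1, h.2.trans hx.2⟩
  · exact ⟨hx.1.trans_lt h.1, h.2.trans hy.2⟩

/-- The Sobolev embedding of `H¹` in `L^∞`. -/
lemma IsH1per.abs_le_hNorm {g : ℝ → ℝ} (hg : IsH1per g) {x : ℝ} (hx : x ∈ Icc 0 (2 * Real.pi)) :
    |g x| ≤ 4 * hNorm 1 g := by
  have hN := hNorm_nonneg 1 g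
  have h0 := integral_sq_iteratedDeriv_le (k := 1) (j := 0) (by norm_num) g
  have h1 := integral_sq_iteratedDeriv_le (k := 1) (j := 1) le_rfl g
  simp only [iteratedDeriv_zero, iteratedDeriv_one, Real.norm_eq_abs, sq_abs] at h0 h1
  have hm0 := memLp_perVol_of_continuous hg.continuous 2
  have a0 := sq_integral_abs_le hm0
  have a1 := sq_integral_abs_le hg.2.1
  have hpi := Real.pi_pos
  have hpi4 := Real.pi_lt_four
  have hpi3 := Real.pi_gt_three
  set I0 := ∫ x, |g x| ∂perVol
  set I1 := ∫ x, |deriv g x| ∂perVol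
  have hI0 : 0 ≤ I0 := integral_nonneg fun x => abs_nonneg _
  have hI1 : 0 ≤ I1 := integral_nonneg fun x => abs_nonneg _
  -- Average |g x| ≤ |g y| + ∫|g'| over y. Since √(2π) < 3, both L¹ norms are at most 3 times the H¹
  -- norm, and 3/(2π) + 3 < 4.
  have key : 2 * Real.pi * |g x| ≤ I0 + 2 * Real.pi * I1 := by
    have e1 : ∫ _y, |g x| ∂perVol ≤ ∫ y, (|g y| + I1) ∂perVol := by
      refine integral_mono_ae (integrable_const _)
        ((hm0.integrable (by norm_num)).abs.add (integrable_const _)) ?_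
      filter_upwards [ae_restrict_mem measurableSet_Ioc] with y hy
      have := hg.abs_sub_le hx (Ioc_subset_Icc_self hy)
      have h2 := abs_sub_abs_le_abs_sub (g x) (g y)
      simp only [I1] at *
      linarith
    rw [integral_add ((hm0.integrable (by norm_num)).abs) (integrable_const _)] at e1
    simpa [Real.pi_nonneg] using e1
  have b0 : I0 ≤ 3 * hNorm 1 g := by
    refine abs_le_of_sq_le_sq' (a := I0) ?_ (by positivity) |>.2
    nlinarith
  have b1 : I1 ≤ 3 * hNorm 1 g := by
    refine abs_le_of_sq_le_sq' (a := I1) ?_ (by positivity) |>.2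
    nlinarith
  nlinarith

/-! ### Functionals on `H¹` -/

/-- The functional `g ↦ ∫ (α g + β g')`. -/
noncomputable def weakFunctional (α β : ℝ → ℝ) (g : ℝ → ℝ) : ℝ :=
  ∫ x, (α x * g x + β x * deriv g x) ∂perVol

lemma integrable_weakFunctional {α β g : ℝ → ℝ} (hα : Integrable α perVol)
    (hβ : MemLp β 2 perVol) (hg : IsH1per g) :
    Integrable (fun x => α x * g x) perVol ∧ Integrable (fun x => β x * deriv g x) perVol :=
  ⟨memLp_one_iff_integrable.1 (MemLp.mul (p := 1) (q := ∞)
    (memLp_perVol_of_continuous hg.continuous ∞) (memLp_one_iff_integrable.2 hα)),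
    integrable_mul_of_memLp hβ hg.2.1⟩

/-- The term with α is bounded by the embedding of H¹ in L^∞, the one with β by the Cauchy-Schwarz
inequality. -/
lemma isHMinusOne_weakFunctional {α β : ℝ → ℝ} (hα : Integrable α perVol)
    (hβ : MemLp β 2 perVol) : IsHMinusOne (weakFunctional α β) := by
  refine ⟨fun f g hf hg => ?_, fun c f hf => ?_, ?_⟩
  · obtain ⟨f1, f2⟩ := integrable_weakFunctional hα hβ hf
    obtain ⟨g1, g2⟩ := integrable_weakFunctional hα hβ hg
    unfold weakFunctional
    have h1 := integral_add (f1.add f2) (g1.add g2)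
    simp only [Pi.add_apply] at h1
    rw [← h1]
    apply integral_congr_ae
    filter_upwards [ae_restrict_of_ae (hf.add hg).2] with x hx
    rw [hx, Pi.add_apply, Pi.add_apply]; ring
  · unfold weakFunctional
    rw [← integral_const_mul]
    apply integral_congr_ae
    filter_upwards [ae_restrict_of_ae (hf.const_smul c).2] with x hx
    rw [hx, Pi.smul_apply, Pi.smul_apply, smul_eq_mul, smul_eq_mul]; ring
  · refine ⟨4 * (∫ x, |α x| ∂perVol) + √(∫ x, β x ^ 2 ∂perVol), fun g hg => ?_⟩
    obtain ⟨g1, g2⟩ := integrable_weakFunctional hα hβ hg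
    have hN := hNorm_nonneg 1 g
    unfold weakFunctional
    rw [integral_add g1 g2, add_mul]
    refine (abs_add_le _ _).trans (add_le_add ?_ ?_)
    · refine (abs_integral_le_integral_abs).trans ?_
      have : 4 * (∫ x, |α x| ∂perVol) * hNorm 1 g = ∫ x, |α x| * (4 * hNorm 1 g) ∂perVol := by
        rw [integral_mul_const]; ring
      rw [this]
      refine integral_mono_ae g1.abs (hα.abs.mul_const _) ?_
      filter_upwards [ae_restrict_mem measurableSet_Ioc] with x hx
      rw [abs_mul]
      exact mul_le_mul_of_nonneg_left (hg.abs_le_hNorm (Ioc_subset_Icc_self hx)) (abs_nonneg _)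
    · have h := sq_integral_mul_le hβ hg.2.1
      have h1 := integral_sq_iteratedDeriv_le (k := 1) (j := 1) le_rfl g
      simp only [iteratedDeriv_one, Real.norm_eq_abs, sq_abs] at h1
      have hb : 0 ≤ ∫ x, β x ^ 2 ∂perVol := integral_nonneg fun x => sq_nonneg _
      refine abs_le_of_sq_le_sq ?_ (by positivity)
      rw [mul_pow, Real.sq_sqrt hb]
      exact h.trans (mul_le_mul_of_nonneg_left h1 hb)

/-! ### Existence of Lagrange multipliers -/

lemma integrable_inner_of_memLp {f g : ℝ → Plane} (hf : MemLp f 2 perVol)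
    (hg : MemLp g 2 perVol) : Integrable (fun x => ⟪f x, g x⟫) perVol := by
  simp only [plane_inner]
  exact (integrable_mul_of_memLp (memLp_coord hf 0) (memLp_coord hg 0)).add
    (integrable_mul_of_memLp (memLp_coord hf 1) (memLp_coord hg 1))

lemma integrable_inner_of_continuous {f g : ℝ → Plane} (hf : MemLp f 1 perVol)
    (hg : Continuous g) : Integrable (fun x => ⟪f x, g x⟫) perVol := by
  simp only [plane_inner]
  have := fun i => memLp_one_iff_integrable.1 (MemLp.mul (p := 1) (q := ∞) (r := 1)
    (memLp_perVol_of_continuous (continuous_coord hg i) ∞) (memLp_coord hf i))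
  exact (this 0).add (this 1)

/-- The space `H²_per`. -/
def h2Submodule : Submodule ℝ (ℝ → Plane) where
  carrier := {φ | IsH2per φ}
  add_mem' := fun h h' => (IsH2per.add h h').1
  zero_mem' := isH2per_const (0 : Plane)
  smul_mem' := fun c _ h => (IsH2per.const_smul h c).1

/-- The linear functional `φ ↦ ∫ (⟨A, φ''⟩ + ⟨B, φ'⟩)` on `H²_per`. -/
noncomputable def h2Functional {A B : ℝ → Plane} (hA : MemLp A 2 perVol) (hB : MemLp B 1 perVol) :
    h2Submodule →ₗ[ℝ] ℝ where
  toFun φ := ∫ x, (⟪A x, deriv (deriv (φ : ℝ → Plane)) x⟫ +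
    ⟪B x, deriv (φ : ℝ → Plane) x⟫) ∂perVol
  map_add' := fun φ χ => by
    have h := IsH2per.add φ.2 χ.2
    rw [← integral_add]
    · apply integral_congr_ae
      filter_upwards [ae_restrict_of_ae h.2.2] with x hx
      rw [Submodule.coe_add, hx, h.2.1, Pi.add_apply, Pi.add_apply, inner_add_right,
        inner_add_right]
      ring
    · exact (integrable_inner_of_memLp hA φ.2.2.2.1).add
        (integrable_inner_of_continuous hB φ.2.2.continuous)
    · exact (integrable_inner_of_memLp hA χ.2.2.2.1).add
        (integrable_inner_of_continuous hB χ.2.2.continuous)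
  map_smul' := fun c φ => by
    have h := IsH2per.const_smul φ.2 c
    rw [RingHom.id_apply, smul_eq_mul, ← integral_const_mul]
    apply integral_congr_ae
    filter_upwards [ae_restrict_of_ae h.2.2] with x hx
    rw [Submodule.coe_smul, hx, h.2.1, Pi.smul_apply, Pi.smul_apply, inner_smul_right,
      inner_smul_right]
    ring

/-- The data of a pair of curves at which the functional `Φ` and the constraints `F i` have first
variations with coefficients `A, B, C` and `G i`. -/
structure HasFirstVariation {m : ℕ} (Φ : (ℝ → Plane) → (ℝ → Plane) → ℝ)
    (F : Fin m → (ℝ → Plane) → ℝ) (γ η A B C : ℝ → Plane) (G : Fin m → ℝ → Plane) : Prop where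
  h1 : IsH1per η
  memA : MemLp A 2 perVol
  memB : MemLp B 1 perVol
  memC : MemLp C 2 perVol
  contG : ∀ i, Continuous (G i)
  functional : ∀ φ ψ : ℝ → Plane, IsH2per φ → IsH1per ψ →
    HasDerivAt (fun ε : ℝ => Φ (γ + ε • φ) (η + ε • ψ))
      (∫ x, (⟪A x, deriv (deriv φ) x⟫ + ⟪B x, deriv φ x⟫ + ⟪C x, deriv ψ x⟫) ∂perVol) 0
  constraint : ∀ i, ∀ φ : ℝ → Plane, IsH2per φ →
    HasDerivAt (fun ε : ℝ => F i (γ + ε • φ)) (∫ x, ⟪G i x, deriv φ x⟫ ∂perVol) 0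

lemma IsH1per.inner {f g : ℝ → Plane} (hf : IsH1per f) (hg : IsH1per g) :
    IsH1per (fun x => ⟪f x, g x⟫) := by
  simp only [plane_inner]
  exact (((hf.coord 0).1.mul (hg.coord 0).1).1.add ((hf.coord 1).1.mul (hg.coord 1).1).1).1

namespace HasFirstVariation

variable {m : ℕ} {Φ : (ℝ → Plane) → (ℝ → Plane) → ℝ} {F : Fin m → (ℝ → Plane) → ℝ}
  {γ η A B C : ℝ → Plane} {G : Fin m → ℝ → Plane} {c : Fin m → ℝ}

lemma integral_split (h : HasFirstVariation Φ F γ η A B C G) {φ ψ : ℝ → Plane} (hφ : IsH2per φ)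
    (hψ : IsH1per ψ) :
    ∫ x, (⟪A x, deriv (deriv φ) x⟫ + ⟪B x, deriv φ x⟫ + ⟪C x, deriv ψ x⟫) ∂perVol =
      ∫ x, (⟪A x, deriv (deriv φ) x⟫ + ⟪B x, deriv φ x⟫) ∂perVol +
      ∫ x, ⟪C x, deriv ψ x⟫ ∂perVol := by
  have h1 : Integrable (fun x => ⟪A x, deriv (deriv φ) x⟫ + ⟪B x, deriv φ x⟫) perVol :=
    (integrable_inner_of_memLp h.memA hφ.2.2.1).add
      (integrable_inner_of_continuous h.memB hφ.2.continuous)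
  exact integral_add h1 (integrable_inner_of_memLp h.memC hψ.2.1)

/-- Lagrange multipliers exist at a constrained critical point. -/
lemma exists_multipliers (h : HasFirstVariation Φ F γ η A B C G)
    (hc : IsConstrainedCritical Φ F c γ η) :
    ∃ (μ : Fin m → ℝ) (Ψ : (ℝ → ℝ) → ℝ), IsLagrangeMultiplier Φ F γ η μ Ψ := by
  have hG0 := fun i => (memLp_perVol_of_continuous (h.contG i) 1)
  have hz2 : MemLp (fun _ : ℝ => (0 : Plane)) 2 perVol := MemLp.zero
  let T := h2Functional h.memA h.memB
  let L : Fin m → h2Submodule →ₗ[ℝ] ℝ := fun i => h2Functional hz2 (hG0 i)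
  have hL : ∀ i (φ : h2Submodule), L i φ = ∫ x, ⟪G i x, deriv (φ : ℝ → Plane) x⟫ ∂perVol := by
    intro i φ
    simp [L, h2Functional]
  have hz : IsH1per (fun _ : ℝ => (0 : Plane)) := isH1per_const 0
  have hz' : IsH2per (fun _ : ℝ => (0 : Plane)) := isH2per_const 0
  -- With ψ = 0 the linearized unit length constraint holds automatically, so T vanishes wherever
  -- all the finitely many L i do. Linear algebra puts T in their span, without any surjectivity of
  -- the constraint derivatives.
  have hker : ⨅ i, LinearMap.ker (L i) ≤ LinearMap.ker T := by
    intro φ hφ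
    rw [Submodule.mem_iInf] at hφ
    rw [LinearMap.mem_ker]
    have h1 := hc.stationary φ (fun _ => 0) φ.2 hz (fun i => ?_) (fun x => ?_)
    · have h2 := (h.functional φ (fun _ => 0) φ.2 hz).unique h1
      simp only [deriv_const', inner_zero_right, add_zero] at h2
      exact h2
    · have h2 := h.constraint i φ φ.2
      rwa [← hL, LinearMap.mem_ker.1 (hφ i)] at h2
    · simp [constraintSDeriv]
  obtain ⟨a, ha⟩ := (Submodule.mem_span_range_iff_exists_fun ℝ).1 (mem_span_of_iInf_ker_le_ker hker)
  -- With g = ⟨η,ψ⟩ the variation ψ - gη is admissible, hence ∫⟨C,ψ'⟩ = ∫⟨C,(gη)'⟩. The functional Ψ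
  -- has to take the negative of this value at S'(η)[ψ] = 2g, which explains the factor -1/2 and, by
  -- the product rule, both densities.
  have hα : Integrable (fun x => -(1 / 2) * ⟪C x, deriv η x⟫) perVol :=
    (integrable_inner_of_memLp h.memC h.h1.2.1).const_mul _
  have hβ : MemLp (fun x => -(1 / 2) * ⟪C x, η x⟫) 2 perVol := by
    simp only [plane_inner]
    have := fun i => MemLp.mul (p := 2) (q := ∞) (r := 2)
      (memLp_perVol_of_continuous (continuous_coord h.h1.continuous i) ∞) (memLp_coord h.memC i)
    exact ((this 0).add (this 1)).const_mul _
  refine ⟨fun i => -a i, weakFunctional (fun x => -(1 / 2) * ⟪C x, deriv η x⟫)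
    (fun x => -(1 / 2) * ⟪C x, η x⟫), isHMinusOne_weakFunctional hα hβ, fun φ ψ hφ hψ => ?_⟩
  have hd := (h.functional φ ψ hφ hψ).add
    (HasDerivAt.fun_sum (u := Finset.univ) fun i _ => (h.constraint i φ hφ).const_mul (-a i))
  refine hd.congr_deriv ?_
  have hT : T ⟨φ, hφ⟩ = ∑ i, a i * ∫ x, ⟪G i x, deriv φ x⟫ ∂perVol := by
    rw [← ha]
    simp [hL]
  have hT' : T ⟨φ, hφ⟩ = ∫ x, (⟪A x, deriv (deriv φ) x⟫ + ⟪B x, deriv φ x⟫) ∂perVol := rfl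
  rw [h.integral_split hφ hψ, ← hT', hT]
  simp only [neg_mul, Finset.sum_neg_distrib]
  -- the tangential part of `ψ` does not contribute
  have hg : IsH1per (fun x => ⟪η x, ψ x⟫) := h.h1.inner hψ
  have hgη := hg.smul h.h1
  have hχ := hψ.add (hgη.1.const_smul (-1)).1
  have h1 := hc.stationary (fun _ => 0) _ hz' hχ.1 (fun i => ?_) (fun x => ?_)
  · have h2 := (h.functional _ _ hz' hχ.1).unique h1
    rw [h.integral_split hz' hχ.1] at h2
    simp only [deriv_const', inner_zero_right, add_zero, integral_zero, zero_add] at h2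
    have h3 : ∫ x, ⟪C x, deriv ψ x⟫ ∂perVol -
        ∫ x, (⟪η x, ψ x⟫ * ⟪C x, deriv η x⟫ + deriv (fun x => ⟪η x, ψ x⟫) x * ⟪C x, η x⟫) ∂perVol
          = 0 := by
      rw [← integral_sub (integrable_inner_of_memLp h.memC hψ.2.1)]
      · rw [← h2]
        apply integral_congr_ae
        filter_upwards [ae_restrict_of_ae hχ.2, ae_restrict_of_ae hgη.2,
          ae_restrict_of_ae (hgη.1.const_smul (-1)).2] with x e1 e2 e3
        rw [e1, Pi.add_apply, e3, Pi.smul_apply, e2]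
        simp only [inner_add_right, inner_smul_right]
        ring
      · have hint := integrable_weakFunctional hα hβ hg
        refine ((hint.1.add hint.2).const_mul (-2)).congr (.of_forall fun x => ?_)
        simp only [Pi.add_apply]; ring
    have h4 : constraintSDeriv η ψ = (2 : ℝ) • fun x => ⟪η x, ψ x⟫ := by
      funext x; simp [constraintSDeriv]
    have h5 := (isHMinusOne_weakFunctional hα hβ).map_smul 2 _ hg
    simp only [neg_mul] at h5
    rw [sub_eq_zero] at h3
    rw [h4, h5, h3, weakFunctional, ← integral_const_mul, ← integral_neg, add_right_comm,
      add_neg_cancel, zero_add]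
    congr 1 with x
    ring
  · simpa using h.constraint i _ hz'
  · have h2 := hc.unit x
    simp only [constraintS] at h2
    simp only [constraintSDeriv, Pi.add_apply, Pi.smul_apply, inner_add_right, inner_smul_right,
      real_inner_self_eq_norm_sq]
    rw [show ‖η x‖ ^ 2 = 1 by linarith]
    ring

/-- The weak Euler-Lagrange equation. -/
lemma weak_equation (h : HasFirstVariation Φ F γ η A B C G) {μ : Fin m → ℝ} {Ψ : (ℝ → ℝ) → ℝ}
    (hm : IsLagrangeMultiplier Φ F γ η μ Ψ) {φ ψ : ℝ → Plane} (hφ : IsH2per φ) (hψ : IsH1per ψ) :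
    ∫ x, (⟪A x, deriv (deriv φ) x⟫ + ⟪B x, deriv φ x⟫) ∂perVol + ∫ x, ⟪C x, deriv ψ x⟫ ∂perVol +
      ∑ i, μ i * ∫ x, ⟪G i x, deriv φ x⟫ ∂perVol = -Ψ (constraintSDeriv η ψ) := by
  have hd := (h.functional φ ψ hφ hψ).add
    (HasDerivAt.fun_sum (u := Finset.univ) fun i _ => (h.constraint i φ hφ).const_mul (μ i))
  rw [← h.integral_split hφ hψ]
  exact hd.unique (hm.equation φ ψ hφ hψ)

/-- The Euler-Lagrange equation for variations of the curve. -/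
lemma curve_equation (h : HasFirstVariation Φ F γ η A B C G) {μ : Fin m → ℝ} {Ψ : (ℝ → ℝ) → ℝ}
    (hm : IsLagrangeMultiplier Φ F γ η μ Ψ) {φ : ℝ → Plane} (hφ : IsH2per φ) :
    ∫ x, (⟪A x, deriv (deriv φ) x⟫ + ⟪B x + ∑ i, μ i • G i x, deriv φ x⟫) ∂perVol = 0 := by
  have h1 := h.weak_equation hm hφ (isH1per_const 0)
  have h2 : constraintSDeriv η (fun _ => 0) = (0 : ℝ) • fun _ => (0 : ℝ) := by
    funext x; simp [constraintSDeriv]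
  rw [h2, hm.isHMinusOne.map_smul 0 _ (isH1per_const 0)] at h1
  simp only [deriv_const', inner_zero_right, integral_zero, zero_mul, neg_zero, add_zero] at h1
  rw [← h1]
  have hi := fun i => ((integrable_inner_of_continuous
    (memLp_perVol_of_continuous (h.contG i) 1) hφ.2.continuous).const_mul (μ i))
  simp_rw [← integral_const_mul]
  rw [← integral_finsetSum _ fun i _ => hi i, ← integral_add]
  · congr 1 with x
    rw [inner_add_left, sum_inner]
    simp only [real_inner_smul_left]
    ring
  · exact (integrable_inner_of_memLp h.memA hφ.2.2.1).add
      (integrable_inner_of_continuous h.memB hφ.2.continuous)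
  · exact integrable_finsetSum _ fun i _ => hi i

/-- The Euler-Lagrange equation for variations of the director tangent to the unit circle. -/
lemma director_equation (h : HasFirstVariation Φ F γ η A B C G) {μ : Fin m → ℝ}
    {Ψ : (ℝ → ℝ) → ℝ} (hm : IsLagrangeMultiplier Φ F γ η μ Ψ) {g : ℝ → ℝ} (hg : IsH1per g) :
    ∫ x, (deriv g x * ⟪C x, rotJ (η x)⟫ + g x * ⟪C x, rotJ (deriv η x)⟫) ∂perVol = 0 := by
  -- Directions g Jη are tangent to the unit circle, so the multiplier Ψ drops out.
  have hψ := hg.smul h.h1.rotJ.1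
  have h1 := h.weak_equation hm (isH2per_const 0) hψ.1
  have h2 : constraintSDeriv η (fun x => g x • rotJ (η x)) = (0 : ℝ) • fun _ => (0 : ℝ) := by
    funext x; simp [constraintSDeriv, plane_inner]; ring
  rw [h2, hm.isHMinusOne.map_smul 0 _ (isH1per_const 0)] at h1
  simp only [deriv_const', inner_zero_right, integral_zero, zero_mul, neg_zero, add_zero, mul_zero,
    Finset.sum_const_zero, zero_add] at h1
  rw [← h1]
  apply integral_congr_ae
  filter_upwards [ae_restrict_of_ae hψ.2, ae_restrict_of_ae h.h1.rotJ.2] with x e1 e2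
  rw [e1, e2, inner_add_right, inner_smul_right, inner_smul_right]

/-- The multiplier of the unit length constraint in terms of the first variation. -/
lemma multiplier_eq (h : HasFirstVariation Φ F γ η A B C G) {μ : Fin m → ℝ}
    {Ψ : (ℝ → ℝ) → ℝ} (hm : IsLagrangeMultiplier Φ F γ η μ Ψ) (hunit : ∀ x, ‖η x‖ ^ 2 = 1)
    {g : ℝ → ℝ} (hg : IsH1per g) :
    Ψ g = -(1 / 2) * ∫ x, (deriv g x * ⟪C x, η x⟫ + g x * ⟪C x, deriv η x⟫) ∂perVol := by
  have hψ := hg.smul h.h1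
  -- Since |η| = 1, the direction gη/2 gives S'(η)[gη/2] = g. Thus Ψ is determined by C and η.
  have hψ2 := hψ.1.const_smul (1 / 2)
  have h1 := h.weak_equation hm (isH2per_const 0) hψ2.1
  have h2 : constraintSDeriv η ((1 / 2 : ℝ) • fun x => g x • η x) = g := by
    funext x
    simp only [constraintSDeriv, Pi.smul_apply, inner_smul_right, real_inner_self_eq_norm_sq,
      hunit x]
    ring
  rw [h2] at h1
  simp only [deriv_const', inner_zero_right, integral_zero, add_zero, mul_zero,
    Finset.sum_const_zero, zero_add] at h1
  have h3 : Ψ g = -∫ x, ⟪C x, deriv ((1 / 2 : ℝ) • fun x => g x • η x) x⟫ ∂perVol := by linarith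
  rw [h3, neg_mul, ← integral_const_mul]
  congr 1
  apply integral_congr_ae
  filter_upwards [ae_restrict_of_ae hψ.2, ae_restrict_of_ae hψ2.2] with x e1 e2
  rw [e2, Pi.smul_apply, e1]
  simp only [inner_add_right, inner_smul_right]

end HasFirstVariation

/-! ### Weak solutions solve an ordinary differential equation -/

/-- The weak form of the Euler-Lagrange equations, with multiplier `ℓ` for the length and `a` for
the area, at a curve of constant speed `r`. -/
structure IsWeakSolution (δ lam r ℓ a : ℝ) (γ η : ℝ → Plane) : Prop where
  h2 : IsH2per γ
  h1 : IsH1per η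
  pos : 0 < r
  speed : ∀ x, ‖deriv γ x‖ = r
  unit : ∀ x, ‖η x‖ ^ 2 = 1
  curve : ∀ φ : ℝ → Plane, IsH2per φ →
    ∫ x, (⟪coeffA δ r (deriv γ x) (deriv (deriv γ) x) (deriv η x), deriv (deriv φ) x⟫ +
      ⟪coeffB δ lam r (deriv γ x) (deriv (deriv γ) x) (deriv η x) + (ℓ • r⁻¹ • deriv γ x +
        a • rotJ (γ x)), deriv φ x⟫) ∂perVol = 0
  director : ∀ g : ℝ → ℝ, IsH1per g →
    ∫ x, (deriv g x * ⟪coeffC δ lam r (deriv γ x) (deriv (deriv γ) x) (deriv η x), rotJ (η x)⟫ +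
      g x * ⟪coeffC δ lam r (deriv γ x) (deriv (deriv γ) x) (deriv η x), rotJ (deriv η x)⟫)
      ∂perVol = 0

/-- The states of the Euler-Lagrange system: the point, the unit tangent, the vector `κ + δ div η`
times the normal, the director, the momentum of the director, and the constants
`a`, `c`, `r`, `ℓ`. -/
abbrev SolState : Type := Fin 14 → ℝ

namespace SolState

/-- `κ + δ div η`. -/
def w (y : SolState) : ℝ := -(y 4) * y 3 + y 5 * y 2

/-- `⟨Jη, τ⟩`. -/
def s (y : SolState) : ℝ := -(y 7) * y 2 + y 6 * y 3

/-- `⟨η, τ⟩`. -/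
def d (y : SolState) : ℝ := y 6 * y 2 + y 7 * y 3

/-- `⟨∂ₛη, Jη⟩`. -/
noncomputable def om (δ lam : ℝ) (y : SolState) : ℝ := (y 8 - δ * w y * s y) / lam

/-- The curvature. -/
noncomputable def kap (δ lam : ℝ) (y : SolState) : ℝ := w y - δ * om δ lam y * s y

/-- The tangential stress. -/
noncomputable def stress (δ lam : ℝ) (y : SolState) : ℝ :=
  -(3 / 2) * w y ^ 2 - lam / 2 * om δ lam y ^ 2 + y 13

/-- The force, first component. -/
noncomputable def force0 (δ lam : ℝ) (y : SolState) : ℝ :=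
  stress δ lam y * y 2 - δ * w y * om δ lam y * y 7 - y 9 * y 1

/-- The force, second component. -/
noncomputable def force1 (δ lam : ℝ) (y : SolState) : ℝ :=
  stress δ lam y * y 3 + δ * w y * om δ lam y * y 6 + y 9 * y 0

/-- The right hand side of the Euler-Lagrange system. -/
noncomputable def field (δ lam : ℝ) (y : SolState) : SolState :=
  ![y 12 * y 2, y 12 * y 3,
    -(y 12 * kap δ lam y * y 3), y 12 * kap δ lam y * y 2,
    y 12 * (force0 δ lam y + y 10), y 12 * (force1 δ lam y + y 11),
    -(y 12 * om δ lam y * y 7), y 12 * om δ lam y * y 6,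
    -(y 12 * δ * om δ lam y * w y * d y), 0, 0, 0, 0, 0]

end SolState

/-- This is the step from weak to classical derivatives: a weak derivative with a continuous
representative is a derivative at every point. -/
lemma hasDerivAt_of_ae_eq_continuous {f g k : ℝ → ℝ}
    (h : ∀ x : ℝ, f x = f 0 + ∫ t in (0 : ℝ)..x, g t) (hk : Continuous k) (hgk : g =ᵐ[volume] k)
    (x : ℝ) : HasDerivAt f (k x) x := by
  have h2 : f = fun x => f 0 + ∫ t in (0 : ℝ)..x, k t := by
    funext x
    rw [h x, intervalIntegral.integral_congr_ae_restrict (ae_restrict_of_ae hgk)]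
  have h3 := (hk.integral_hasStrictDerivAt 0 x).hasDerivAt.const_add (f 0)
  rwa [← h2] at h3

/-- The derivative of a unit vector field is orthogonal to it. -/
lemma IsH1per.ae_orthogonal_of_unit {η : ℝ → Plane} (h : IsH1per η) (hu : ∀ x, ‖η x‖ ^ 2 = 1) :
    ∀ᵐ x, η x 0 * deriv η x 0 + η x 1 * deriv η x 1 = 0 := by
  filter_upwards [h.ae_hasDerivAt] with x hx
  have h0 := hasDerivAt_coord hx 0
  have h1 := hasDerivAt_coord hx 1
  have h2 := (h0.mul h0).add (h1.mul h1)
  have h3 : ((fun y => η y 0) * (fun y => η y 0) + (fun y => η y 1) * (fun y => η y 1))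
      = fun _ => 1 := by
    funext y
    rw [← hu y, plane_norm_sq]
    simp only [Pi.add_apply, Pi.mul_apply]
    ring
  rw [h3] at h2
  have := h2.unique (hasDerivAt_const x 1)
  linarith

namespace IsWeakSolution

variable {δ lam r ℓ a : ℝ} {γ η : ℝ → Plane}

/-- For periodic φ the derivative φ' ranges over mean-free functions only. The du Bois-Reymond lemma
therefore leaves a constant c undetermined in each component, and these constants become part of the
state. -/
lemma exists_stress (h : IsWeakSolution δ lam r ℓ a γ η) (i : Fin 2) :
    ∃ (c : ℝ) (W : ℝ → ℝ), Function.Periodic W (2 * Real.pi) ∧ Continuous W ∧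
      (∀ x, W x = W 0 + ∫ t in (0 : ℝ)..x,
        ((coeffB δ lam r (deriv γ t) (deriv (deriv γ) t) (deriv η t) + (ℓ • r⁻¹ • deriv γ t +
        a • rotJ (γ t))) i + c)) ∧
      ∀ᵐ x, coeffA δ r (deriv γ x) (deriv (deriv γ) x) (deriv η x) i = W x := by
  set A : ℝ → Plane := fun x => coeffA δ r (deriv γ x) (deriv (deriv γ) x) (deriv η x) with hAdef
  set B : ℝ → Plane := fun x => coeffB δ lam r (deriv γ x) (deriv (deriv γ) x) (deriv η x) +
    (ℓ • r⁻¹ • deriv γ x + a • rotJ (γ x)) with hBdef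
  have hA : MemLp A 2 perVol := memLp_coeffA δ h.h2 h.h1
  have hcont : Continuous fun x => ℓ • r⁻¹ • deriv γ x + a • rotJ (γ x) :=
    ((h.h2.2.continuous.const_smul r⁻¹).const_smul ℓ).add
      ((rotJL.continuous.comp h.h2.1.continuous).const_smul a)
  have hB : MemLp B 1 perVol :=
    (memLp_coeffB δ lam h.h2 h.h1).add (memLp_perVol_of_continuous hcont 1)
  have pγ := h.h2.1.1
  have pγ' := periodic_deriv_of_periodic pγ
  have pγ'' := periodic_deriv_of_periodic pγ'
  have pη' := periodic_deriv_of_periodic h.h1.1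
  have pA : Function.Periodic A (2 * Real.pi) := fun x => by
    simp only [hAdef, pγ' x, pγ'' x, pη' x]
  have pB : Function.Periodic B (2 * Real.pi) := fun x => by
    simp only [hBdef, pγ x, pγ' x, pγ'' x, pη' x]
  have hBi := fun u v => (memLp_coord hB i).intervalIntegrable_of_periodic le_rfl
    (fun x => by rw [pB x]) u v
  obtain ⟨c, W, hW1, hW2, hW3⟩ := exists_primitive_of_weak (memLp_coord hA i) hBi
    (fun x => by rw [pB x]) (fun k hk hk0 => by
      obtain ⟨G, hG, hGd⟩ := hk.exists_primitive hk0
      have hz := isH2per_const (0 : ℝ)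
      rw [integral_period]
      fin_cases i
      · have hφ := hG.planeMk hz
        have h2 := h.curve _ hφ.1
        rw [← h2]
        apply integral_congr_ae
        have h3 := (hG.2.planeMk hz.2).2
        filter_upwards [ae_restrict_of_ae h3] with x hx
        rw [hφ.2, hx]
        simp [plane_inner, hGd, hAdef, hBdef]
      · have hφ := hz.planeMk hG
        have h2 := h.curve _ hφ.1
        rw [← h2]
        apply integral_congr_ae
        have h3 := (hz.2.planeMk hG.2).2
        filter_upwards [ae_restrict_of_ae h3] with x hx
        rw [hφ.2, hx]
        simp [plane_inner, hGd, hAdef, hBdef])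
  refine ⟨c, W, hW1, ?_, hW2, ae_of_ae_perVol (fun x => ?_) hW3⟩
  · exact continuous_of_integral (fun u v => (hBi u v).add (by simp)) hW2
  · rw [hW1 x]
    have := pA x
    simp only [hAdef] at this
    rw [this]

/-- Here every g in H¹_per is an admissible test function, not only the mean-free ones, so no
integration constant survives. -/
lemma exists_momentum (h : IsWeakSolution δ lam r ℓ a γ η) :
    ∃ (P : ℝ → ℝ), Function.Periodic P (2 * Real.pi) ∧ Continuous P ∧
      (∀ x, P x = P 0 + ∫ t in (0 : ℝ)..x,
        ⟪coeffC δ lam r (deriv γ t) (deriv (deriv γ) t) (deriv η t), rotJ (deriv η t)⟫) ∧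
      ∀ᵐ x, ⟪coeffC δ lam r (deriv γ x) (deriv (deriv γ) x) (deriv η x), rotJ (η x)⟫ = P x := by
  set C : ℝ → Plane := fun x => coeffC δ lam r (deriv γ x) (deriv (deriv γ) x) (deriv η x) with hCdef
  have hC : MemLp C 2 perVol := memLp_coeffC δ lam h.h2 h.h1
  have pγ' := periodic_deriv_of_periodic h.h2.1.1
  have pγ'' := periodic_deriv_of_periodic pγ'
  have pη := h.h1.1
  have pη' := periodic_deriv_of_periodic pη
  have pC : Function.Periodic C (2 * Real.pi) := fun x => by
    simp only [hCdef, pγ' x, pγ'' x, pη' x]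
  have hJ : MemLp (fun x => rotJ (deriv η x)) 2 perVol := h.h1.2.1.continuousLinearMap_comp rotJL
  have hF : MemLp (fun x => ⟪C x, rotJ (deriv η x)⟫) 1 perVol :=
    memLp_one_iff_integrable.2 (integrable_inner_of_memLp hC hJ)
  have hf : MemLp (fun x => ⟪C x, rotJ (η x)⟫) 2 perVol := by
    have hc := (rotJL.continuous.comp h.h1.continuous)
    simp only [plane_inner]
    have := fun i => MemLp.mul (p := 2) (q := ∞) (r := 2)
      (memLp_perVol_of_continuous (continuous_coord hc i) ∞) (memLp_coord hC i)
    exact (this 0).add (this 1)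
  have pF : Function.Periodic (fun x => ⟪C x, rotJ (deriv η x)⟫) (2 * Real.pi) := fun x => by
    simp only [pC x, pη' x]
  have hFi := fun u v => hF.intervalIntegrable_of_periodic le_rfl pF u v
  obtain ⟨c, P, hP1, hP2, hP3⟩ := exists_primitive_of_weak hf hFi pF (fun g hg _ => by
    rw [integral_period, ← h.director g hg]
    congr 1 with x
    simp only [hCdef]; ring)
  -- The test function 1 shows that the right hand side already has mean zero.
  have hc0 : c = 0 := by
    have h1 := h.director _ (isH1per_const 1)
    simp only [deriv_const', zero_mul, zero_add, one_mul] at h1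
    have h2 := hP2 (2 * Real.pi)
    have h3 := hP1 0
    rw [zero_add] at h3
    rw [h3, intervalIntegral.integral_add (hFi _ _) (by simp), integral_period, h1] at h2
    simpa [Real.pi_ne_zero] using h2
  rw [hc0] at hP2
  simp only [add_zero] at hP2
  refine ⟨P, hP1, continuous_of_integral hFi hP2, hP2, ae_of_ae_perVol (fun x => ?_) hP3⟩
  have := pC x
  simp only [hCdef] at this
  rw [hP1 x, this, pη x]

end IsWeakSolution

/-- A periodic solution of the Euler-Lagrange system, with the constraints satisfied by the state. -/
structure IsStateSolution (δ lam r ℓ a : ℝ) (γ η : ℝ → Plane) (y : ℝ → SolState) : Prop where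
  ode : ∀ x, HasDerivAt y (SolState.field δ lam (y x)) x
  periodic : Function.Periodic y (2 * Real.pi)
  pos : 0 < r
  point0 : ∀ x, γ x 0 = y x 0
  point1 : ∀ x, γ x 1 = y x 1
  director0 : ∀ x, η x 0 = y x 6
  director1 : ∀ x, η x 1 = y x 7
  area : ∀ x, y x 9 = a
  const0 : ∀ x, y x 10 = y 0 10
  const1 : ∀ x, y x 11 = y 0 11
  speed : ∀ x, y x 12 = r
  length : ∀ x, y x 13 = ℓ
  tangent : ∀ x, y x 2 ^ 2 + y x 3 ^ 2 = 1
  unit : ∀ x, y x 6 ^ 2 + y x 7 ^ 2 = 1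
  normal : ∀ x, y x 4 * y x 2 + y x 5 * y x 3 = 0

namespace SolState

/-- The state with the given components. -/
def mk (g0 g1 t0 t1 v0 v1 e0 e1 P a c0 c1 r ℓ : ℝ) : SolState :=
  ![g0, g1, t0, t1, v0, v1, e0, e1, P, a, c0, c1, r, ℓ]

lemma hasDerivAt_mk {g0 g1 t0 t1 v0 v1 e0 e1 P : ℝ → ℝ} {a c0 c1 r ℓ x : ℝ}
    {g0' g1' t0' t1' v0' v1' e0' e1' P' : ℝ} (h0 : HasDerivAt g0 g0' x) (h1 : HasDerivAt g1 g1' x)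
    (h2 : HasDerivAt t0 t0' x) (h3 : HasDerivAt t1 t1' x) (h4 : HasDerivAt v0 v0' x)
    (h5 : HasDerivAt v1 v1' x) (h6 : HasDerivAt e0 e0' x) (h7 : HasDerivAt e1 e1' x)
    (h8 : HasDerivAt P P' x) :
    HasDerivAt (fun x => mk (g0 x) (g1 x) (t0 x) (t1 x) (v0 x) (v1 x) (e0 x) (e1 x) (P x) a c0 c1
      r ℓ) (mk g0' g1' t0' t1' v0' v1' e0' e1' P' 0 0 0 0 0) x := by
  rw [hasDerivAt_pi]
  intro i
  have hc := fun c : ℝ => hasDerivAt_const x c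
  fin_cases i
  exacts [h0, h1, h2, h3, h4, h5, h6, h7, h8, hc _, hc _, hc _, hc _, hc _]

end SolState

-- The momenta W and P are continuous and, as λ > 0, can be solved algebraically for w, ω and hence
-- κ. The almost everywhere defined ∂ₓη and ∂ₓ²γ thereby coincide with continuous functions of the
-- state, and all integral equations become classical differential equations.
open SolState in
lemma IsWeakSolution.exists_state {δ lam r ℓ a : ℝ} {γ η : ℝ → Plane} (hlam : 0 < lam)
    (h : IsWeakSolution δ lam r ℓ a γ η) : ∃ y, IsStateSolution δ lam r ℓ a γ η y := by
  obtain ⟨c0, W0, pW0, cW0, iW0, eW0⟩ := h.exists_stress 0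
  obtain ⟨c1, W1, pW1, cW1, iW1, eW1⟩ := h.exists_stress 1
  obtain ⟨P, pP, cP, iP, eP⟩ := h.exists_momentum
  have hr := h.pos
  have hr0 : r ≠ 0 := hr.ne'
  have hl0 : lam ≠ 0 := hlam.ne'
  have hp : ∀ x, deriv γ x 0 ^ 2 + deriv γ x 1 ^ 2 = r ^ 2 := fun x => by
    rw [← plane_norm_sq, h.speed x]
  have hu : ∀ x, η x 0 ^ 2 + η x 1 ^ 2 = 1 := fun x => by rw [← plane_norm_sq, h.unit x]
  have cγ := continuous_coord h.h2.1.continuous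
  have cγ' := continuous_coord h.h2.2.continuous
  have cη := continuous_coord h.h1.continuous
  obtain ⟨t0, ht0⟩ : ∃ t : ℝ → ℝ, ∀ x, deriv γ x 0 = r * t x :=
    ⟨fun x => r⁻¹ * deriv γ x 0, fun x => by field_simp⟩
  obtain ⟨t1, ht1⟩ : ∃ t : ℝ → ℝ, ∀ x, deriv γ x 1 = r * t x :=
    ⟨fun x => r⁻¹ * deriv γ x 1, fun x => by field_simp⟩
  have et0 : t0 = fun x => r⁻¹ * deriv γ x 0 := funext fun x => by rw [ht0]; field_simp
  have et1 : t1 = fun x => r⁻¹ * deriv γ x 1 := funext fun x => by rw [ht1]; field_simp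
  have ct0 : Continuous t0 := by rw [et0]; exact (cγ' 0).const_mul _
  have ct1 : Continuous t1 := by rw [et1]; exact (cγ' 1).const_mul _
  have htt : ∀ x, t0 x ^ 2 + t1 x ^ 2 = 1 := fun x => by
    have := hp x
    rw [ht0, ht1] at this
    have h2 : r ^ 2 * (t0 x ^ 2 + t1 x ^ 2 - 1) = 0 := by linarith
    have := (mul_eq_zero.1 h2).resolve_left (by positivity)
    linarith
  obtain ⟨y, hy⟩ : ∃ y : ℝ → SolState, y = fun x => SolState.mk (γ x 0) (γ x 1) (t0 x) (t1 x) (r * W0 x)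
    (r * W1 x) (η x 0) (η x 1) (P x) a c0 c1 r ℓ := ⟨_, rfl⟩
  have y0 : ∀ x, y x 0 = γ x 0 := fun x => by rw [hy]; rfl
  have y1 : ∀ x, y x 1 = γ x 1 := fun x => by rw [hy]; rfl
  have y2 : ∀ x, y x 2 = t0 x := fun x => by rw [hy]; rfl
  have y3 : ∀ x, y x 3 = t1 x := fun x => by rw [hy]; rfl
  have y4 : ∀ x, y x 4 = r * W0 x := fun x => by rw [hy]; rfl
  have y5 : ∀ x, y x 5 = r * W1 x := fun x => by rw [hy]; rfl
  have y6 : ∀ x, y x 6 = η x 0 := fun x => by rw [hy]; rfl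
  have y7 : ∀ x, y x 7 = η x 1 := fun x => by rw [hy]; rfl
  have y8 : ∀ x, y x 8 = P x := fun x => by rw [hy]; rfl
  have y9 : ∀ x, y x 9 = a := fun x => by rw [hy]; rfl
  have y10 : ∀ x, y x 10 = c0 := fun x => by rw [hy]; rfl
  have y11 : ∀ x, y x 11 = c1 := fun x => by rw [hy]; rfl
  have y12 : ∀ x, y x 12 = r := fun x => by rw [hy]; rfl
  have y13 : ∀ x, y x 13 = ℓ := fun x => by rw [hy]; rfl
  have cw : Continuous fun x => w (y x) := by
    simp only [w, y4, y3, y5, y2]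
    fun_prop
  have cs : Continuous fun x => s (y x) := by
    simp only [s, y7, y3, y6, y2]
    exact ((cη 1).neg.mul ct0).add ((cη 0).mul ct1)
  have cd : Continuous fun x => d (y x) := by
    simp only [d, y7, y3, y6, y2]
    exact ((cη 0).mul ct0).add ((cη 1).mul ct1)
  have com : Continuous fun x => om δ lam (y x) := by
    simp only [om, y8]
    fun_prop
  have ckap : Continuous fun x => kap δ lam (y x) := by
    simp only [kap]
    fun_prop
  have cstress : Continuous fun x => stress δ lam (y x) := by
    simp only [stress, y13]
    fun_prop
  have cf0 : Continuous fun x => force0 δ lam (y x) := by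
    simp only [force0, y2, y7, y9, y1]
    exact ((cstress.mul ct0).sub (((cw.const_mul δ).mul com).mul (cη 1))).sub ((cγ 1).const_mul a)
  have cf1 : Continuous fun x => force1 δ lam (y x) := by
    simp only [force1, y3, y6, y9, y0]
    exact ((cstress.mul ct1).add (((cw.const_mul δ).mul com).mul (cη 0))).add ((cγ 0).const_mul a)
  -- the relations between the components, almost everywhere
  have hae : ∀ᵐ x, bendDensity δ r (deriv γ x) (deriv (deriv γ) x) (deriv η x) = w (y x) ∧
      deriv η x 0 = -(r * om δ lam (y x) * η x 1) ∧ deriv η x 1 = r * om δ lam (y x) * η x 0 ∧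
      deriv (deriv γ) x 0 = -(r ^ 2 * kap δ lam (y x) * t1 x) ∧
      deriv (deriv γ) x 1 = r ^ 2 * kap δ lam (y x) * t0 x ∧
      W0 x * t0 x + W1 x * t1 x = 0 := by
    filter_upwards [eW0, eW1, eP, ae_orthogonal h.h2 h.speed,
      h.h1.ae_orthogonal_of_unit h.unit] with x e0 e1 e2 e3 e4
    have ht := htt x
    have hux := hu x
    obtain ⟨wt, hwt⟩ : ∃ wt, wt = bendDensity δ r (deriv γ x) (deriv (deriv γ) x) (deriv η x) :=
      ⟨_, rfl⟩
    simp only [coeffA, coeffC, ← hwt, PiLp.smul_apply, PiLp.add_apply, smul_eq_mul, rotJ_zero,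
      rotJ_one, plane_inner, ht0, ht1] at e0 e1 e2 e3 ⊢
    simp only [bendDensity, ht0, ht1] at hwt
    -- The coefficient A equals (w/r)ν, so r W = wν and its normal component is w.
    have hwy : w (y x) = wt := by
      simp only [w, y2, y3, y4, y5, ← e0, ← e1]
      field_simp
      linear_combination wt * ht
    have hsy : s (y x) = -(η x 1) * t0 x + η x 0 * t1 x := by simp only [s, y2, y3, y6, y7]
    -- The momentum is P = λω + δw⟨Jη,τ⟩; it is solved for ω by dividing by λ.
    have hom : r * om δ lam (y x) = -(deriv η x 0) * η x 1 + deriv η x 1 * η x 0 := by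
      simp only [om, y8, hwy, hsy, ← e2]
      field_simp
      ring
    have hz0 : deriv η x 0 = -(r * om δ lam (y x) * η x 1) := by
      rw [hom]
      linear_combination (-deriv η x 0) * hux + η x 0 * e4
    have hz1 : deriv η x 1 = r * om δ lam (y x) * η x 0 := by
      rw [hom]
      linear_combination (-deriv η x 1) * hux + η x 1 * e4
    have hK : deriv (deriv γ) x 1 * t0 x - deriv (deriv γ) x 0 * t1 x
        = r ^ 2 * kap δ lam (y x) := by
      have h1 : wt = (deriv (deriv γ) x 1 * t0 x - deriv (deriv γ) x 0 * t1 x) / r ^ 2 +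
          δ * om δ lam (y x) * s (y x) := by
        rw [hwt, hz0, hz1, hsy]
        field_simp
      rw [kap, hwy, h1]
      field_simp
      ring
    have e3' : t0 x * deriv (deriv γ) x 0 + t1 x * deriv (deriv γ) x 1 = 0 := by
      have h1 : r * (t0 x * deriv (deriv γ) x 0 + t1 x * deriv (deriv γ) x 1) = 0 := by linarith
      exact (mul_eq_zero.1 h1).resolve_left hr0
    refine ⟨hwy.symm, hz0, hz1, ?_, ?_, ?_⟩
    · rw [← hK]
      linear_combination (-deriv (deriv γ) x 0) * ht + t0 x * e3'
    · rw [← hK]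
      linear_combination (-deriv (deriv γ) x 1) * ht + t1 x * e3'
    · rw [← e0, ← e1]
      ring
  -- An identity between continuous functions that holds almost everywhere holds everywhere.
  have hnormal : ∀ x, W0 x * t0 x + W1 x * t1 x = 0 := by
    have hc : Continuous fun x => W0 x * t0 x + W1 x * t1 x := by fun_prop
    have h0 : (fun x => W0 x * t0 x + W1 x * t1 x) = fun _ => 0 :=
      (hc.ae_eq_iff_eq volume continuous_const).1 (hae.mono fun x hx => hx.2.2.2.2.2)
    exact fun x => congrFun h0 x
  have ode : ∀ x, HasDerivAt y (field δ lam (y x)) x := by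
    intro x
    have dγ := fun i => hasDerivAt_coord (h.h2.hasDerivAt x) i
    have dt0 : HasDerivAt t0 (-(r * kap δ lam (y x) * t1 x)) x := by
      have h1 := h.h2.2.coord 0
      have h2 := hasDerivAt_of_ae_eq_continuous (k := fun x => -(r ^ 2 * kap δ lam (y x) * t1 x))
        h1.1.2.2 (by fun_prop) (by
          filter_upwards [h1.2, hae] with x e1 e2
          rw [e1, e2.2.2.2.1]) x
      rw [et0]
      refine (h2.const_mul r⁻¹).congr_deriv ?_
      rw [et1]
      field_simp
    have dt1 : HasDerivAt t1 (r * kap δ lam (y x) * t0 x) x := by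
      have h1 := h.h2.2.coord 1
      have h2 := hasDerivAt_of_ae_eq_continuous (k := fun x => r ^ 2 * kap δ lam (y x) * t0 x)
        h1.1.2.2 (by fun_prop) (by
          filter_upwards [h1.2, hae] with x e1 e2
          rw [e1, e2.2.2.2.2.1]) x
      rw [et1]
      refine (h2.const_mul r⁻¹).congr_deriv ?_
      rw [et0]
      field_simp
    have de0 : HasDerivAt (fun x => η x 0) (-(r * om δ lam (y x) * η x 1)) x := by
      have h1 := h.h1.coord 0
      refine hasDerivAt_of_ae_eq_continuous (k := fun x => -(r * om δ lam (y x) * η x 1))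
        h1.1.2.2 ((com.const_mul r).mul (cη 1)).neg ?_ x
      filter_upwards [h1.2, hae] with x e1 e2
      rw [e1, e2.2.1]
    have de1 : HasDerivAt (fun x => η x 1) (r * om δ lam (y x) * η x 0) x := by
      have h1 := h.h1.coord 1
      refine hasDerivAt_of_ae_eq_continuous (k := fun x => r * om δ lam (y x) * η x 0)
        h1.1.2.2 ((com.const_mul r).mul (cη 0)) ?_ x
      filter_upwards [h1.2, hae] with x e1 e2
      rw [e1, e2.2.2.1]
    have dW0 : HasDerivAt W0 (force0 δ lam (y x) + c0) x := by
      refine hasDerivAt_of_ae_eq_continuous (k := fun x => force0 δ lam (y x) + c0)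
        iW0 (cf0.add continuous_const) ?_ x
      filter_upwards [hae] with x e
      have hux := hu x
      simp only [coeffB, e.1, e.2.1, e.2.2.1, PiLp.smul_apply, PiLp.add_apply, smul_eq_mul,
        rotJ_zero, ht0, force0, stress, y2, y7, y9, y1, y13]
      have h1 : (-(r * om δ lam (y x) * η x 1)) ^ 2 + (r * om δ lam (y x) * η x 0) ^ 2 =
          r ^ 2 * om δ lam (y x) ^ 2 := by
        linear_combination r ^ 2 * om δ lam (y x) ^ 2 * hux
      rw [h1]
      field_simp
      ring
    have dW1 : HasDerivAt W1 (force1 δ lam (y x) + c1) x := by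
      refine hasDerivAt_of_ae_eq_continuous (k := fun x => force1 δ lam (y x) + c1)
        iW1 (cf1.add continuous_const) ?_ x
      filter_upwards [hae] with x e
      have hux := hu x
      simp only [coeffB, e.1, e.2.1, e.2.2.1, PiLp.smul_apply, PiLp.add_apply, smul_eq_mul,
        rotJ_one, ht1, force1, stress, y3, y6, y9, y0, y13]
      have h1 : (-(r * om δ lam (y x) * η x 1)) ^ 2 + (r * om δ lam (y x) * η x 0) ^ 2 =
          r ^ 2 * om δ lam (y x) ^ 2 := by
        linear_combination r ^ 2 * om δ lam (y x) ^ 2 * hux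
      rw [h1]
      field_simp
      ring
    have dP : HasDerivAt P (-(r * δ * om δ lam (y x) * w (y x) * d (y x))) x := by
      refine hasDerivAt_of_ae_eq_continuous
        (k := fun x => -(r * δ * om δ lam (y x) * w (y x) * d (y x))) iP (by fun_prop) ?_ x
      filter_upwards [hae] with x e
      simp only [coeffC, e.1, e.2.1, e.2.2.1, plane_inner, PiLp.smul_apply, PiLp.add_apply,
        smul_eq_mul, rotJ_zero, rotJ_one, ht0, ht1, d, y2, y3, y6, y7]
      field_simp
      ring
    have hmk := hasDerivAt_mk (a := a) (c0 := c0) (c1 := c1) (r := r) (ℓ := ℓ) (dγ 0) (dγ 1) dt0 dt1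
      (dW0.const_mul r) (dW1.const_mul r) de0 de1 dP
    rw [← hy] at hmk
    refine hmk.congr_deriv ?_
    simp only [field, y12, y2, y3, y6, y7, y10, y11, ht0, ht1]
    rfl
  refine ⟨y, ode, fun x => ?_, hr, fun x => (y0 x).symm, fun x => (y1 x).symm,
    fun x => (y6 x).symm, fun x => (y7 x).symm, y9, fun x => by rw [y10, y10],
    fun x => by rw [y11, y11], y12, y13, fun x => by rw [y2, y3]; exact htt x,
    fun x => by rw [y6, y7]; exact hu x, fun x => ?_⟩
  · rw [hy]
    have hγ := h.h2.1.1 x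
    have hγ' := periodic_deriv_of_periodic h.h2.1.1 x
    simp only [hγ, et0, et1, hγ', pW0 x, pW1 x, h.h1.1 x, pP x]
  · rw [y4, y2, y5, y3]
    linear_combination r * hnormal x

/-! ### Smoothness and derivative bounds for solutions of autonomous equations -/

section Autonomous

variable {V E : Type*} [NormedAddCommGroup V] [NormedSpace ℝ V] [NormedAddCommGroup E]
  [NormedSpace ℝ E]

/-- The function computing the `n`-th derivative of `G` along solutions of `y' = F y`. -/
noncomputable def odeDeriv (F : V → V) : ℕ → (V → E) → V → E
  | 0, G => G
  | n + 1, G => odeDeriv F n fun v => fderiv ℝ G v (F v)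

lemma contDiff_odeStep {F : V → V} (hF : ContDiff ℝ ∞ F) {G : V → E} (hG : ContDiff ℝ ∞ G) :
    ContDiff ℝ ∞ fun v => fderiv ℝ G v (F v) :=
  (hG.fderiv_right (m := ∞) le_rfl).clm_apply hF

lemma contDiff_odeDeriv {F : V → V} (hF : ContDiff ℝ ∞ F) (n : ℕ) {G : V → E}
    (hG : ContDiff ℝ ∞ G) : ContDiff ℝ ∞ (odeDeriv F n G) := by
  induction n generalizing G with
  | zero => exact hG
  | succ n ih => exact ih (contDiff_odeStep hF hG)

lemma hasDerivAt_comp_ode {F : V → V} {y : ℝ → V} (hy : ∀ x, HasDerivAt y (F (y x)) x) {G : V → E}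
    (hG : ContDiff ℝ ∞ G) (x : ℝ) :
    HasDerivAt (fun x => G (y x)) (fderiv ℝ G (y x) (F (y x))) x :=
  ((hG.differentiable (by simp)) (y x)).hasFDerivAt.comp_hasDerivAt x (hy x)

lemma iteratedDeriv_comp_ode {F : V → V} (hF : ContDiff ℝ ∞ F) {y : ℝ → V}
    (hy : ∀ x, HasDerivAt y (F (y x)) x) (n : ℕ) {G : V → E} (hG : ContDiff ℝ ∞ G) :
    iteratedDeriv n (fun x => G (y x)) = fun x => odeDeriv F n G (y x) := by
  induction n generalizing G with
  | zero => simp [odeDeriv]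
  | succ n ih =>
    rw [iteratedDeriv_succ', funext fun x => (hasDerivAt_comp_ode hy hG x).deriv,
      ih (contDiff_odeStep hF hG)]
    rfl

/-- Differentiating G along a solution gives another smooth function evaluated along the same
solution, so the order of regularity can be raised by induction over all G at once. -/
lemma contDiff_comp_ode {F : V → V} (hF : ContDiff ℝ ∞ F) {y : ℝ → V}
    (hy : ∀ x, HasDerivAt y (F (y x)) x) {G : V → E} (hG : ContDiff ℝ ∞ G) :
    ContDiff ℝ ∞ fun x => G (y x) := by
  rw [contDiff_infty]
  intro n
  induction n generalizing G with
  | zero =>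
    rw [Nat.cast_zero, contDiff_zero]
    exact hG.continuous.comp (continuous_iff_continuousAt.2 fun x => (hy x).continuousAt)
  | succ n ih =>
    rw [Nat.cast_succ, contDiff_succ_iff_deriv]
    refine ⟨fun x => (hasDerivAt_comp_ode hy hG x).differentiableAt, by simp, ?_⟩
    rw [funext fun x => (hasDerivAt_comp_ode hy hG x).deriv]
    exact ih (contDiff_odeStep hF hG)

/-- Derivatives of functions along solutions are bounded in terms of the size of the solution. -/
lemma exists_wInftyNorm_bound [ProperSpace V] {F : V → V} (hF : ContDiff ℝ ∞ F) {G : V → E}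
    (hG : ContDiff ℝ ∞ G) :
    ∃ K : ℕ → ℝ → ℝ, (∀ k R, 0 ≤ K k R) ∧ ∀ (y : ℝ → V) (R : ℝ),
      (∀ x, HasDerivAt y (F (y x)) x) → (∀ x, ‖y x‖ ≤ R) →
      ∀ k, wInftyNorm k (fun x => G (y x)) ≤ ENNReal.ofReal (K k R) := by
  -- Each derivative is a fixed continuous function of the state, hence bounded on a closed ball,
  -- which is compact.
  have hb : ∀ (n : ℕ) (R : ℝ), ∃ K : ℝ, 0 ≤ K ∧ ∀ v, ‖v‖ ≤ R → ‖odeDeriv F n G v‖ ≤ K := by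
    intro n R
    obtain ⟨K, hK⟩ := (isCompact_closedBall (0 : V) R).exists_bound_of_continuousOn
      (contDiff_odeDeriv hF n hG).continuous.continuousOn
    exact ⟨max K 0, le_max_right _ _, fun v hv => (hK v (by simpa using hv)).trans (le_max_left _ _)⟩
  choose K hK0 hK using hb
  refine ⟨fun k R => ∑ j ∈ Finset.range (k + 1), K j R,
    fun k R => Finset.sum_nonneg fun j _ => hK0 j R, fun y R hy hR k => ?_⟩
  rw [wInftyNorm, ENNReal.ofReal_sum_of_nonneg fun j _ => hK0 j R]
  refine Finset.sum_le_sum fun j _ => ?_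
  rw [eLpNorm_exponent_top]
  refine eLpNormEssSup_le_of_ae_bound (.of_forall fun x => ?_)
  rw [iteratedDeriv_comp_ode hF hy j hG]
  exact hK j R _ (hR x)

end Autonomous

/-! ### Smoothness of the Euler-Lagrange field and of the multiplier densities -/

namespace SolState

lemma contDiff_field (δ lam : ℝ) : ContDiff ℝ ∞ (field δ lam) := by
  rw [contDiff_pi]
  intro i
  have hw : ContDiff ℝ ∞ w := by unfold w; fun_prop
  have hs : ContDiff ℝ ∞ s := by unfold s; fun_prop
  have hd : ContDiff ℝ ∞ d := by unfold d; fun_prop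
  have hom : ContDiff ℝ ∞ (om δ lam) := by unfold om; fun_prop
  have hkap : ContDiff ℝ ∞ (kap δ lam) := by unfold kap; fun_prop
  have hst : ContDiff ℝ ∞ (stress δ lam) := by unfold stress; fun_prop
  have hf0 : ContDiff ℝ ∞ (force0 δ lam) := by unfold force0; fun_prop
  have hf1 : ContDiff ℝ ∞ (force1 δ lam) := by unfold force1; fun_prop
  have hc : ∀ i, ContDiff ℝ ∞ fun y : SolState => y i := fun i => by fun_prop
  have hz : ContDiff ℝ ∞ fun _ : SolState => (0 : ℝ) := contDiff_const
  fin_cases i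
  exacts [(hc 12).mul (hc 2), (hc 12).mul (hc 3), (((hc 12).mul hkap).mul (hc 3)).neg,
    ((hc 12).mul hkap).mul (hc 2), (hc 12).mul (hf0.add (hc 10)), (hc 12).mul (hf1.add (hc 11)),
    (((hc 12).mul hom).mul (hc 7)).neg, ((hc 12).mul hom).mul (hc 6),
    (((((hc 12).mul contDiff_const).mul hom).mul hw).mul hd).neg, hz, hz, hz, hz, hz]

/-- The regular part of the multiplier of the unit length constraint. -/
noncomputable def psi0 (δ lam : ℝ) (y : SolState) : ℝ :=
  -(1 / 2) * om δ lam y * (δ * w y * s y + lam * om δ lam y)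

/-- The potential of the singular part of the multiplier of the unit length constraint. -/
noncomputable def psi1 (δ : ℝ) (y : SolState) : ℝ := 1 / 2 * (δ * w y * d y)

lemma contDiff_psi0 (δ lam : ℝ) : ContDiff ℝ ∞ (psi0 δ lam) := by
  unfold psi0 om w s; fun_prop

lemma contDiff_psi1 (δ : ℝ) : ContDiff ℝ ∞ (psi1 δ) := by
  unfold psi1 w d; fun_prop

/-- The vector with the given components. -/
def vec (i j : Fin 14) (y : SolState) : Plane := !₂[y i, y j]

lemma contDiff_vec (i j : Fin 14) : ContDiff ℝ ∞ (vec i j) := by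
  rw [contDiff_euclidean]
  intro k
  fin_cases k
  · exact contDiff_apply ℝ ℝ i
  · exact contDiff_apply ℝ ℝ j

end SolState

open SolState in
/-- Uniform derivative bounds for state solutions. -/
lemma exists_totalNorm_bound (δ lam : ℝ) : ∃ K : ℕ → ℝ → ℝ, ∀ (y : ℝ → SolState) (R : ℝ),
    (∀ x, HasDerivAt y (field δ lam (y x)) x) → (∀ x, ‖y x‖ ≤ R) →
    ∀ k, totalNorm k (fun x => vec 0 1 (y x)) (fun x => vec 6 7 (y x))
      (fun x => psi0 δ lam (y x)) (fun x => psi1 δ (y x)) ≤ ENNReal.ofReal (K k R) := by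
  obtain ⟨K1, p1, h1⟩ := exists_wInftyNorm_bound (contDiff_field δ lam) (contDiff_vec 0 1)
  obtain ⟨K2, p2, h2⟩ := exists_wInftyNorm_bound (contDiff_field δ lam) (contDiff_vec 6 7)
  obtain ⟨K3, p3, h3⟩ := exists_wInftyNorm_bound (contDiff_field δ lam) (contDiff_psi0 δ lam)
  obtain ⟨K4, p4, h4⟩ := exists_wInftyNorm_bound (contDiff_field δ lam) (contDiff_psi1 δ)
  refine ⟨fun k R => K1 (k + 2) R + K2 (k + 1) R + K3 k R + K4 k R, fun y R hy hR k => ?_⟩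
  have q1 := p1 (k + 2) R
  have q2 := p2 (k + 1) R
  have q3 := p3 k R
  have q4 := p4 k R
  rw [totalNorm, ENNReal.ofReal_add (by positivity) q4, ENNReal.ofReal_add (by positivity) q3,
    ENNReal.ofReal_add q1 q2]
  gcongr
  exacts [h1 y R hy hR _, h2 y R hy hR _, h3 y R hy hR _, h4 y R hy hR _]

/-! ### Integrals of continuous functions over a period -/

/-- The integral over one period. -/
noncomputable def perInt (f : ℝ → ℝ) : ℝ := ∫ x, f x ∂perVol

lemma integrable_perVol {f : ℝ → ℝ} (hf : Continuous f) : Integrable f perVol :=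
  memLp_one_iff_integrable.1 (memLp_perVol_of_continuous hf 1)

lemma perInt_add {f g : ℝ → ℝ} (hf : Continuous f) (hg : Continuous g) :
    perInt (fun x => f x + g x) = perInt f + perInt g :=
  integral_add (integrable_perVol hf) (integrable_perVol hg)

lemma perInt_const_mul (c : ℝ) (f : ℝ → ℝ) : perInt (fun x => c * f x) = c * perInt f :=
  integral_const_mul c f

lemma perInt_const (c : ℝ) : perInt (fun _ => c) = 2 * Real.pi * c := by
  simp [perInt, Real.pi_nonneg]

lemma perInt_mono {f g : ℝ → ℝ} (hf : Continuous f) (hg : Continuous g) (h : ∀ x, f x ≤ g x) :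
    perInt f ≤ perInt g :=
  integral_mono (integrable_perVol hf) (integrable_perVol hg) h

lemma perInt_nonneg {f : ℝ → ℝ} (h : ∀ x, 0 ≤ f x) : 0 ≤ perInt f := integral_nonneg h

lemma abs_perInt_le {f g : ℝ → ℝ} (hf : Continuous f) (hg : Continuous g)
    (h : ∀ x, |f x| ≤ g x) : |perInt f| ≤ perInt g :=
  abs_integral_le_integral_abs.trans (perInt_mono hf.abs hg h)

lemma perInt_eq_zero_of_hasDerivAt {F f : ℝ → ℝ} (hF : ∀ x, HasDerivAt F (f x) x)
    (hf : Continuous f) (hp : Function.Periodic F (2 * Real.pi)) : perInt f = 0 := by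
  rw [perInt, ← integral_period,
    intervalIntegral.integral_eq_sub_of_hasDerivAt (fun x _ => hF x) (hf.intervalIntegrable _ _)]
  have := hp 0
  rw [zero_add] at this
  rw [this, sub_self]

lemma perInt_sq_mul_le {f g : ℝ → ℝ} (hf : Continuous f) (hg : Continuous g) :
    perInt (fun x => f x * g x) ^ 2 ≤ perInt (fun x => f x ^ 2) * perInt (fun x => g x ^ 2) :=
  sq_integral_mul_le (memLp_perVol_of_continuous hf 2) (memLp_perVol_of_continuous hg 2)

/-! ### A priori bounds -/

namespace SolState

/-- The Hamiltonian density. -/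
noncomputable def ham (δ lam : ℝ) (y : SolState) : ℝ := 1 / 2 * w y ^ 2 + lam / 2 * om δ lam y ^ 2

/-- Twice the area density. -/
def twist (y : SolState) : ℝ := -(y 1) * y 2 + y 0 * y 3

lemma continuous_w : Continuous w := by unfold w; fun_prop
lemma continuous_om (δ lam : ℝ) : Continuous (om δ lam) := by unfold om w s; fun_prop
lemma continuous_kap (δ lam : ℝ) : Continuous (kap δ lam) := by unfold kap om w s; fun_prop
lemma continuous_ham (δ lam : ℝ) : Continuous (ham δ lam) := by unfold ham om w s; fun_prop
lemma continuous_twist : Continuous twist := by unfold twist; fun_prop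
lemma continuous_force0 (δ lam : ℝ) : Continuous (force0 δ lam) := by
  unfold force0 stress om w s; fun_prop
lemma continuous_force1 (δ lam : ℝ) : Continuous (force1 δ lam) := by
  unfold force1 stress om w s; fun_prop

end SolState

section

open SolState

namespace IsStateSolution

variable {δ lam r ℓ a : ℝ} {γ η : ℝ → Plane} {y : ℝ → SolState}

lemma cont (h : IsStateSolution δ lam r ℓ a γ η y) : Continuous y :=
  continuous_iff_continuousAt.2 fun x => (h.ode x).continuousAt

lemma coord (h : IsStateSolution δ lam r ℓ a γ η y) (i : Fin 14) (x : ℝ) :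
    HasDerivAt (fun x => y x i) (field δ lam (y x) i) x := (hasDerivAt_pi.1 (h.ode x)) i

lemma d0 (h : IsStateSolution δ lam r ℓ a γ η y) (x : ℝ) :
    HasDerivAt (fun x => y x 0) (r * y x 2) x := by rw [← h.speed x]; exact h.coord 0 x

lemma d1 (h : IsStateSolution δ lam r ℓ a γ η y) (x : ℝ) :
    HasDerivAt (fun x => y x 1) (r * y x 3) x := by rw [← h.speed x]; exact h.coord 1 x

lemma d2 (h : IsStateSolution δ lam r ℓ a γ η y) (x : ℝ) :
    HasDerivAt (fun x => y x 2) (-(r * kap δ lam (y x) * y x 3)) x := by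
  rw [← h.speed x]; exact h.coord 2 x

lemma d3 (h : IsStateSolution δ lam r ℓ a γ η y) (x : ℝ) :
    HasDerivAt (fun x => y x 3) (r * kap δ lam (y x) * y x 2) x := by
  rw [← h.speed x]; exact h.coord 3 x

lemma d4 (h : IsStateSolution δ lam r ℓ a γ η y) (x : ℝ) :
    HasDerivAt (fun x => y x 4) (r * (force0 δ lam (y x) + y 0 10)) x := by
  rw [← h.speed x, ← h.const0 x]; exact h.coord 4 x

lemma d5 (h : IsStateSolution δ lam r ℓ a γ η y) (x : ℝ) :
    HasDerivAt (fun x => y x 5) (r * (force1 δ lam (y x) + y 0 11)) x := by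
  rw [← h.speed x, ← h.const1 x]; exact h.coord 5 x

lemma d6 (h : IsStateSolution δ lam r ℓ a γ η y) (x : ℝ) :
    HasDerivAt (fun x => y x 6) (-(r * om δ lam (y x) * y x 7)) x := by
  rw [← h.speed x]; exact h.coord 6 x

lemma d7 (h : IsStateSolution δ lam r ℓ a γ η y) (x : ℝ) :
    HasDerivAt (fun x => y x 7) (r * om δ lam (y x) * y x 6) x := by
  rw [← h.speed x]; exact h.coord 7 x

/-- The vector (y 4, y 5) is normal, so it is w times ν = (-y 3, y 2); pointwise bounds for w
therefore bound it. -/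
lemma stress0 (h : IsStateSolution δ lam r ℓ a γ η y) (x : ℝ) : y x 4 = -(w (y x) * y x 3) := by
  rw [w]
  linear_combination (-(y x 4)) * h.tangent x + y x 2 * h.normal x

lemma stress1 (h : IsStateSolution δ lam r ℓ a γ η y) (x : ℝ) : y x 5 = w (y x) * y x 2 := by
  rw [w]
  linear_combination (-(y x 5)) * h.tangent x + y x 3 * h.normal x

lemma abs_s_le (h : IsStateSolution δ lam r ℓ a γ η y) (x : ℝ) : s (y x) ^ 2 ≤ 1 := by
  have h1 := h.tangent x
  have h2 := h.unit x
  have : s (y x) ^ 2 + d (y x) ^ 2 = (y x 2 ^ 2 + y x 3 ^ 2) * (y x 6 ^ 2 + y x 7 ^ 2) := by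
    rw [s, d]; ring
  rw [h1, h2] at this
  nlinarith [sq_nonneg (d (y x))]

/-- Conservation of the Hamiltonian. -/
lemma ham_eq (h : IsStateSolution δ lam r ℓ a γ η y) (x : ℝ) :
    ham δ lam (y x) = ℓ + a * twist (y x) + (y 0 10 * y x 2 + y 0 11 * y x 3) := by
  -- Differentiate the relation ⟨wν,τ⟩ = 0: the force equation and τ' = rκν give ⟨force + c, τ⟩ + κw
  -- = 0, which is the conservation law after κ is expressed by w and ω.
  have h1 := ((h.d4 x).mul (h.d2 x)).add ((h.d5 x).mul (h.d3 x))
  have h2 : (fun x => y x 4) * (fun x => y x 2) + (fun x => y x 5) * (fun x => y x 3) =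
      fun _ => (0 : ℝ) := funext fun x => h.normal x
  rw [h2] at h1
  have h3 := h1.unique (hasDerivAt_const x 0)
  have hr := h.pos.ne'
  have h4 : r * ((force0 δ lam (y x) + y 0 10) * y x 2 + (force1 δ lam (y x) + y 0 11) * y x 3 +
      kap δ lam (y x) * w (y x)) = 0 := by
    rw [w]; linear_combination h3
  have h5 := (mul_eq_zero.1 h4).resolve_left hr
  rw [force0, force1, stress, h.area, h.length, kap] at h5
  rw [ham, twist]
  have ht := h.tangent x
  have hs : s (y x) = -(y x 7) * y x 2 + y x 6 * y x 3 := rfl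
  linear_combination (-1) * h5 + (-(3 / 2) * w (y x) ^ 2 - lam / 2 * om δ lam (y x) ^ 2 + ℓ) * ht -
    δ * w (y x) * om δ lam (y x) * hs

lemma perInt_tangent0 (h : IsStateSolution δ lam r ℓ a γ η y) : perInt (fun x => y x 2) = 0 := by
  have hc := h.cont
  have h1 := perInt_eq_zero_of_hasDerivAt h.d0 (by fun_prop) (fun x => by simp only [h.periodic x])
  rw [perInt_const_mul] at h1
  exact (mul_eq_zero.1 h1).resolve_left h.pos.ne'

lemma perInt_tangent1 (h : IsStateSolution δ lam r ℓ a γ η y) : perInt (fun x => y x 3) = 0 := by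
  have hc := h.cont
  have h1 := perInt_eq_zero_of_hasDerivAt h.d1 (by fun_prop) (fun x => by simp only [h.periodic x])
  rw [perInt_const_mul] at h1
  exact (mul_eq_zero.1 h1).resolve_left h.pos.ne'

/-- The identity obtained from dilations. -/
lemma perInt_ham (h : IsStateSolution δ lam r ℓ a γ η y) :
    perInt (fun x => ham δ lam (y x)) = 2 * Real.pi * ℓ + a * perInt (fun x => twist (y x)) := by
  have hc := h.cont
  have ct : Continuous fun x => twist (y x) := continuous_twist.comp hc
  rw [funext h.ham_eq, perInt_add (by fun_prop) (by fun_prop), perInt_add (by fun_prop)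
    (by fun_prop), perInt_const, perInt_const_mul, perInt_add (by fun_prop) (by fun_prop),
    perInt_const_mul, perInt_const_mul, h.perInt_tangent0, h.perInt_tangent1]
  ring

/-- The total forces vanish. -/
lemma perInt_force0 (h : IsStateSolution δ lam r ℓ a γ η y) :
    perInt (fun x => force0 δ lam (y x)) = -(2 * Real.pi * y 0 10) := by
  have hc := h.cont
  have cf : Continuous fun x => force0 δ lam (y x) := (continuous_force0 δ lam).comp hc
  have h1 := perInt_eq_zero_of_hasDerivAt h.d4 (by fun_prop) (fun x => by simp only [h.periodic x])
  rw [perInt_const_mul, perInt_add cf (by fun_prop), perInt_const] at h1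
  have := (mul_eq_zero.1 h1).resolve_left h.pos.ne'
  linarith

lemma perInt_force1 (h : IsStateSolution δ lam r ℓ a γ η y) :
    perInt (fun x => force1 δ lam (y x)) = -(2 * Real.pi * y 0 11) := by
  have hc := h.cont
  have cf : Continuous fun x => force1 δ lam (y x) := (continuous_force1 δ lam).comp hc
  have h1 := perInt_eq_zero_of_hasDerivAt h.d5 (by fun_prop) (fun x => by simp only [h.periodic x])
  rw [perInt_const_mul, perInt_add cf (by fun_prop), perInt_const] at h1
  have := (mul_eq_zero.1 h1).resolve_left h.pos.ne'
  linarith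

end IsStateSolution

/-- The deviation of a component from its mean. -/
noncomputable def centred (y : ℝ → SolState) (i : Fin 14) (x : ℝ) : ℝ :=
  y x i - perInt (fun x => y x i) / (2 * Real.pi)

/-- The variance of the curve. -/
noncomputable def spread (y : ℝ → SolState) : ℝ :=
  perInt (fun x => centred y 0 x ^ 2 + centred y 1 x ^ 2)

/-- The force contributions of the energy in the identity obtained from the centred curve. -/
noncomputable def innerForce (δ lam : ℝ) (y : ℝ → SolState) (x : ℝ) : ℝ :=
  w (y x) + (-(3 / 2) * w (y x) ^ 2 - lam / 2 * om δ lam (y x) ^ 2) *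
    (-(centred y 1 x) * y x 2 + centred y 0 x * y x 3) +
  δ * w (y x) * om δ lam (y x) * (y x 6 * centred y 0 x + y x 7 * centred y 1 x)

namespace IsStateSolution

variable {δ lam r ℓ a : ℝ} {γ η : ℝ → Plane} {y : ℝ → SolState}

lemma continuous_centred (h : IsStateSolution δ lam r ℓ a γ η y) (i : Fin 14) :
    Continuous (centred y i) := by
  have := h.cont
  unfold centred; fun_prop

lemma continuous_innerForce (h : IsStateSolution δ lam r ℓ a γ η y) :
    Continuous (innerForce δ lam y) := by
  have hc := h.cont
  have h0 := h.continuous_centred 0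
  have h1 := h.continuous_centred 1
  have hw : Continuous fun x => w (y x) := continuous_w.comp hc
  have ho : Continuous fun x => om δ lam (y x) := (continuous_om δ lam).comp hc
  unfold innerForce; fun_prop

lemma perInt_centred (h : IsStateSolution δ lam r ℓ a γ η y) (i : Fin 14) :
    perInt (centred y i) = 0 := by
  have hc := h.cont
  have : perInt (centred y i) = perInt (fun x => y x i +
      (-(perInt (fun x => y x i) / (2 * Real.pi)))) := rfl
  rw [this, perInt_add (by fun_prop) (by fun_prop), perInt_const]
  have := Real.pi_ne_zero
  field_simp
  ring

/-- Translating the curve changes the integral by a multiple of ∫τ, which is zero for a closed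
curve. -/
lemma perInt_twist_centred (h : IsStateSolution δ lam r ℓ a γ η y) :
    perInt (fun x => -(centred y 1 x) * y x 2 + centred y 0 x * y x 3) =
      perInt (fun x => twist (y x)) := by
  have hc := h.cont
  have ct : Continuous fun x => twist (y x) := continuous_twist.comp hc
  have : (fun x => -(centred y 1 x) * y x 2 + centred y 0 x * y x 3) = fun x =>
      twist (y x) + ((perInt (fun x => y x 1) / (2 * Real.pi)) * y x 2 +
        (-(perInt (fun x => y x 0) / (2 * Real.pi))) * y x 3) := by
    funext x
    simp only [centred, twist]
    ring
  rw [this, perInt_add ct (by fun_prop), perInt_add (by fun_prop) (by fun_prop),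
    perInt_const_mul, perInt_const_mul, h.perInt_tangent0, h.perInt_tangent1]
  ring

lemma hasDerivAt_centred0 (h : IsStateSolution δ lam r ℓ a γ η y) (x : ℝ) :
    HasDerivAt (centred y 0) (r * y x 2) x := (h.d0 x).sub_const _

lemma hasDerivAt_centred1 (h : IsStateSolution δ lam r ℓ a γ η y) (x : ℝ) :
    HasDerivAt (centred y 1) (r * y x 3) x := (h.d1 x).sub_const _

lemma periodic_centred (h : IsStateSolution δ lam r ℓ a γ η y) (i : Fin 14) :
    Function.Periodic (centred y i) (2 * Real.pi) := fun x => by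
  simp only [centred, h.periodic x]

/-- The identity obtained by testing the equation of the curve with its rotated primitive. -/
lemma perInt_innerForce (h : IsStateSolution δ lam r ℓ a γ η y) :
    perInt (innerForce δ lam y) + ℓ * perInt (fun x => twist (y x)) + a * spread y = 0 := by
  have hc := h.cont
  have k0 := h.continuous_centred 0
  have k1 := h.continuous_centred 1
  have kf0 : Continuous fun x => force0 δ lam (y x) := (continuous_force0 δ lam).comp hc
  have kf1 : Continuous fun x => force1 δ lam (y x) := (continuous_force1 δ lam).comp hc
  have ki := h.continuous_innerForce
  -- The derivative of ⟨wν, J(γ - γ̄)⟩ has integral zero. Centring makes the constant forces, and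
  -- the part of the area force due to γ̄, drop out.
  have h1 := perInt_eq_zero_of_hasDerivAt
    (fun x => ((h.d5 x).mul (h.hasDerivAt_centred0 x)).sub ((h.d4 x).mul (h.hasDerivAt_centred1 x)))
    (by fun_prop) (fun x => by
      simp only [Pi.sub_apply, Pi.mul_apply, h.periodic x, h.periodic_centred 0 x,
        h.periodic_centred 1 x])
  set m0 := perInt (fun x => y x 0) / (2 * Real.pi) with hm0
  set m1 := perInt (fun x => y x 1) / (2 * Real.pi) with hm1
  have h2 : (fun x => r * (force1 δ lam (y x) + y 0 11) * centred y 0 x + y x 5 * (r * y x 2) -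
      (r * (force0 δ lam (y x) + y 0 10) * centred y 1 x + y x 4 * (r * y x 3))) = fun x =>
      r * ((innerForce δ lam y x + ℓ * (-(centred y 1 x) * y x 2 + centred y 0 x * y x 3) +
        a * (centred y 0 x ^ 2 + centred y 1 x ^ 2)) +
        ((y 0 11 + a * m0) * centred y 0 x + (a * m1 - y 0 10) * centred y 1 x)) := by
    funext x
    have e0 : y x 0 = centred y 0 x + m0 := by rw [centred]; ring
    have e1 : y x 1 = centred y 1 x + m1 := by rw [centred]; ring
    have e2 : w (y x) = -(y x 4) * y x 3 + y x 5 * y x 2 := rfl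
    rw [innerForce, force0, force1, stress, h.area, h.length, e0, e1]
    linear_combination (-r) * e2
  rw [h2, perInt_const_mul] at h1
  have h3 := (mul_eq_zero.1 h1).resolve_left h.pos.ne'
  rw [perInt_add (by fun_prop) (by fun_prop), perInt_add (by fun_prop) (by fun_prop),
    perInt_add (by fun_prop) (by fun_prop), perInt_add (by fun_prop) (by fun_prop),
    perInt_const_mul, perInt_const_mul, perInt_const_mul, perInt_const_mul,
    h.perInt_centred, h.perInt_centred, h.perInt_twist_centred] at h3
  rw [spread]
  linarith

/-- A lower bound for the variance. -/
lemma spread_lower (h : IsStateSolution δ lam r ℓ a γ η y) :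
    (2 * Real.pi) ^ 2 ≤ 2 * spread y * perInt (fun x => kap δ lam (y x) ^ 2) := by
  have hc := h.cont
  have k0 := h.continuous_centred 0
  have k1 := h.continuous_centred 1
  have kk : Continuous fun x => kap δ lam (y x) := (continuous_kap δ lam).comp hc
  -- The derivative of ⟨τ, γ - γ̄⟩ is r(1 + κ⟨ν, γ - γ̄⟩). Hence the integral of κ⟨ν, γ - γ̄⟩ is
  -- -2π, and the Cauchy-Schwarz inequality gives the bound.
  have h1 := perInt_eq_zero_of_hasDerivAt
    (fun x => ((h.d2 x).mul (h.hasDerivAt_centred0 x)).add ((h.d3 x).mul (h.hasDerivAt_centred1 x)))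
    (by fun_prop) (fun x => by
      simp only [Pi.add_apply, Pi.mul_apply, h.periodic x, h.periodic_centred 0 x,
        h.periodic_centred 1 x])
  have h2 : (fun x => -(r * kap δ lam (y x) * y x 3) * centred y 0 x + y x 2 * (r * y x 2) +
      (r * kap δ lam (y x) * y x 2 * centred y 1 x + y x 3 * (r * y x 3))) = fun x =>
      r * ((y x 2 * centred y 1 x - y x 3 * centred y 0 x) * kap δ lam (y x) + 1) := by
    funext x
    linear_combination r * h.tangent x
  rw [h2, perInt_const_mul] at h1
  have h3 := (mul_eq_zero.1 h1).resolve_left h.pos.ne'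
  rw [perInt_add (by fun_prop) (by fun_prop), perInt_const] at h3
  have h4 := perInt_sq_mul_le (f := fun x => y x 2 * centred y 1 x - y x 3 * centred y 0 x)
    (g := fun x => kap δ lam (y x)) (by fun_prop) kk
  rw [show perInt (fun x => (y x 2 * centred y 1 x - y x 3 * centred y 0 x) * kap δ lam (y x)) =
    -(2 * Real.pi * 1) by linarith] at h4
  have h5 : perInt (fun x => (y x 2 * centred y 1 x - y x 3 * centred y 0 x) ^ 2) ≤ spread y := by
    refine perInt_mono (by fun_prop) (by fun_prop) fun x => ?_
    have := h.tangent x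
    have e : centred y 0 x ^ 2 + centred y 1 x ^ 2 =
      (y x 2 ^ 2 + y x 3 ^ 2) * (centred y 0 x ^ 2 + centred y 1 x ^ 2) := by rw [this, one_mul]
    rw [e]
    nlinarith [sq_nonneg (y x 2 * centred y 0 x + y x 3 * centred y 1 x)]
  have h6 : 0 ≤ perInt (fun x => kap δ lam (y x) ^ 2) := perInt_nonneg fun x => sq_nonneg _
  have h7 := mul_le_mul_of_nonneg_right h5 h6
  have h8 : 0 ≤ spread y := perInt_nonneg fun x => by positivity
  nlinarith [mul_nonneg h8 h6]

/-- A component with Lipschitz constant r varies by at most 2πr over a period, and its deviation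
from the mean is an average of such differences. -/
lemma abs_centred_le (h : IsStateSolution δ lam r ℓ a γ η y) {i : Fin 14}
    (hi : ∀ x, ∃ t, |t| ≤ 1 ∧ HasDerivAt (fun x => y x i) (r * t) x) (x : ℝ) :
    |centred y i x| ≤ 2 * Real.pi * r := by
  have hc := h.cont
  have hd : ∀ x z, x ∈ Icc 0 (2 * Real.pi) → z ∈ Icc 0 (2 * Real.pi) →
      |y x i - y z i| ≤ 2 * Real.pi * r := by
    intro x z hx hz
    have h1 := Convex.norm_image_sub_le_of_norm_hasDerivWithin_le (C := r) (s := univ)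
      (f := fun x => y x i) (f' := fun x => r * (hi x).choose)
      (fun x _ => (hi x).choose_spec.2.hasDerivWithinAt) (fun x _ => by
        have := (hi x).choose_spec.1
        rw [Real.norm_eq_abs, abs_mul, abs_of_pos h.pos]
        nlinarith [h.pos]) convex_univ (mem_univ z) (mem_univ x)
    rw [Real.norm_eq_abs, Real.norm_eq_abs] at h1
    have h2 : |x - z| ≤ 2 * Real.pi := by
      rw [abs_le]; constructor <;> linarith [hx.1, hx.2, hz.1, hz.2]
    nlinarith [h.pos]
  obtain ⟨z, hz, hxz⟩ := (h.periodic_centred i).exists_mem_Ico₀ Real.two_pi_pos x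
  rw [hxz]
  have h1 : 2 * Real.pi * centred y i z = perInt (fun x => y z i + (-1) * y x i) := by
    rw [perInt_add (by fun_prop) (by fun_prop), perInt_const, perInt_const_mul, centred]
    have := Real.pi_ne_zero
    field_simp
    ring
  have h2 : |perInt (fun x => y z i + (-1) * y x i)| ≤ 2 * Real.pi * (2 * Real.pi * r) := by
    rw [← perInt_const]
    refine abs_integral_le_integral_abs.trans ?_
    refine integral_mono_ae (integrable_perVol (by fun_prop)) (integrable_perVol (by fun_prop)) ?_
    filter_upwards [ae_restrict_mem measurableSet_Ioc] with x hx
    have := hd z x (Ico_subset_Icc_self hz) (Ioc_subset_Icc_self hx)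
    rwa [show y z i + (-1) * y x i = y z i - y x i by ring]
  rw [← h1, abs_mul, abs_of_pos Real.two_pi_pos] at h2
  exact le_of_mul_le_mul_left h2 Real.two_pi_pos

lemma abs_tangent0_le (h : IsStateSolution δ lam r ℓ a γ η y) (x : ℝ) : |y x 2| ≤ 1 :=
  abs_le_one_iff_mul_self_le_one.2 (by nlinarith [h.tangent x, sq_nonneg (y x 3)])

lemma abs_tangent1_le (h : IsStateSolution δ lam r ℓ a γ η y) (x : ℝ) : |y x 3| ≤ 1 :=
  abs_le_one_iff_mul_self_le_one.2 (by nlinarith [h.tangent x, sq_nonneg (y x 2)])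

lemma abs_director0_le (h : IsStateSolution δ lam r ℓ a γ η y) (x : ℝ) : |y x 6| ≤ 1 :=
  abs_le_one_iff_mul_self_le_one.2 (by nlinarith [h.unit x, sq_nonneg (y x 7)])

lemma abs_director1_le (h : IsStateSolution δ lam r ℓ a γ η y) (x : ℝ) : |y x 7| ≤ 1 :=
  abs_le_one_iff_mul_self_le_one.2 (by nlinarith [h.unit x, sq_nonneg (y x 6)])

lemma abs_centred0_le (h : IsStateSolution δ lam r ℓ a γ η y) (x : ℝ) :
    |centred y 0 x| ≤ 2 * Real.pi * r :=
  h.abs_centred_le (fun x => ⟨_, h.abs_tangent0_le x, h.d0 x⟩) x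

lemma abs_centred1_le (h : IsStateSolution δ lam r ℓ a γ η y) (x : ℝ) :
    |centred y 1 x| ≤ 2 * Real.pi * r :=
  h.abs_centred_le (fun x => ⟨_, h.abs_tangent1_le x, h.d1 x⟩) x

end IsStateSolution

/-! ### Bounds on the states -/

namespace SolState

lemma sq_w_le {δ lam : ℝ} (hlam : 0 < lam) (y : SolState) : w y ^ 2 ≤ 2 * ham δ lam y := by
  have : 0 ≤ lam * om δ lam y ^ 2 := by positivity
  rw [ham]; linarith

lemma sq_om_le {δ lam : ℝ} (hlam : 0 < lam) (y : SolState) :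
    om δ lam y ^ 2 ≤ lam⁻¹ * (2 * ham δ lam y) := by
  rw [le_inv_mul_iff₀ hlam, ham]
  linarith [sq_nonneg (w y)]

lemma ham_nonneg {δ lam : ℝ} (hlam : 0 < lam) (y : SolState) : 0 ≤ ham δ lam y := by
  rw [ham]; positivity

lemma abs_w_mul_om_le {δ lam : ℝ} (hlam : 0 < lam) (y : SolState) :
    |w y * om δ lam y| ≤ (1 + lam⁻¹) * ham δ lam y := by
  have h1 := sq_w_le (δ := δ) hlam y
  have h2 := sq_om_le (δ := δ) hlam y
  rw [abs_mul]
  nlinarith [two_mul_le_add_sq |w y| |om δ lam y|, sq_abs (w y), sq_abs (om δ lam y)]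

lemma abs_bulk_le {δ lam : ℝ} (hlam : 0 < lam) (y : SolState) :
    |-(3 / 2) * w y ^ 2 - lam / 2 * om δ lam y ^ 2| ≤ 3 * ham δ lam y := by
  have h1 : 0 ≤ lam * om δ lam y ^ 2 := by positivity
  have h2 := sq_nonneg (w y)
  rw [ham, abs_le]
  constructor <;> linarith

end SolState

lemma abs_add_mul_le {p q u v P Q : ℝ} (hp : |p| ≤ P) (hq : |q| ≤ P) (hu : |u| ≤ Q) (hv : |v| ≤ Q) :
    |p * u + q * v| ≤ 2 * (P * Q) := by
  have h1 := mul_le_mul hp hu (abs_nonneg _) ((abs_nonneg _).trans hp)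
  have h2 := mul_le_mul hq hv (abs_nonneg _) ((abs_nonneg _).trans hp)
  calc _ ≤ |p * u| + |q * v| := abs_add_le _ _
    _ ≤ _ := by rw [abs_mul, abs_mul]; linarith

namespace IsStateSolution

variable {δ lam r ℓ a : ℝ} {γ η : ℝ → Plane} {y : ℝ → SolState}

lemma abs_twist_centred_le (h : IsStateSolution δ lam r ℓ a γ η y) (x : ℝ) :
    |-(centred y 1 x) * y x 2 + centred y 0 x * y x 3| ≤ 4 * Real.pi * r := by
  have := abs_add_mul_le (p := -(centred y 1 x)) (by rw [abs_neg]; exact h.abs_centred1_le x)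
    (h.abs_centred0_le x) (h.abs_tangent0_le x) (h.abs_tangent1_le x)
  linarith

lemma abs_perInt_twist_le (h : IsStateSolution δ lam r ℓ a γ η y) :
    |perInt (fun x => twist (y x))| ≤ 8 * Real.pi ^ 2 * r := by
  have hc := h.cont
  have h0 := h.continuous_centred 0
  have h1 := h.continuous_centred 1
  rw [← h.perInt_twist_centred]
  refine (abs_perInt_le (by fun_prop) (by fun_prop) h.abs_twist_centred_le).trans ?_
  rw [perInt_const]
  linarith

lemma spread_nonneg (y : ℝ → SolState) : 0 ≤ spread y := perInt_nonneg fun x => by positivity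

lemma spread_le (h : IsStateSolution δ lam r ℓ a γ η y) : spread y ≤ 16 * Real.pi ^ 3 * r ^ 2 := by
  have h0 := h.continuous_centred 0
  have h1 := h.continuous_centred 1
  have h2 : spread y ≤ perInt fun _ => 2 * (2 * Real.pi * r) ^ 2 :=
    perInt_mono (by fun_prop) (by fun_prop) fun x => by
      have e0 := sq_le_sq' (abs_le.1 (h.abs_centred0_le x)).1 (abs_le.1 (h.abs_centred0_le x)).2
      have e1 := sq_le_sq' (abs_le.1 (h.abs_centred1_le x)).1 (abs_le.1 (h.abs_centred1_le x)).2
      linarith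
  rw [perInt_const] at h2
  linarith

/-- Apart from the linear term w, the integrand is quadratic in (w, ω) with coefficients bounded by
the size of the centred curve. So the Hamiltonian density dominates it, the linear term costing an
additional 1. -/
lemma abs_innerForce_le (h : IsStateSolution δ lam r ℓ a γ η y) (hlam : 0 < lam) (x : ℝ) :
    |innerForce δ lam y x| ≤
      1 + (2 + (3 + |δ| * (1 + lam⁻¹)) * (4 * Real.pi * r)) * ham δ lam (y x) := by
  have hr := h.pos
  have hpi := Real.pi_pos
  have h1 := h.abs_twist_centred_le x
  have h2 := abs_add_mul_le (h.abs_director0_le x) (h.abs_director1_le x) (h.abs_centred0_le x)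
    (h.abs_centred1_le x)
  have h3 := sq_w_le (δ := δ) hlam (y x)
  have h4 : |w (y x)| ≤ 1 + 2 * ham δ lam (y x) := by
    nlinarith [sq_nonneg (|w (y x)| - 1), sq_abs (w (y x)), abs_nonneg (w (y x))]
  have h5 := abs_bulk_le (δ := δ) hlam (y x)
  have h6 := abs_w_mul_om_le (δ := δ) hlam (y x)
  have hn := ham_nonneg (δ := δ) hlam (y x)
  have k1 := mul_le_mul h5 h1 (abs_nonneg _) (by positivity)
  have k2 := mul_le_mul (mul_le_mul_of_nonneg_left h6 (abs_nonneg δ)) h2 (abs_nonneg _)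
    (by positivity)
  rw [← abs_mul] at k1
  rw [← abs_mul, ← abs_mul] at k2
  unfold innerForce
  refine (abs_add_le _ _).trans ?_
  have := abs_add_le (w (y x)) ((-(3 / 2) * w (y x) ^ 2 - lam / 2 * om δ lam (y x) ^ 2) *
    (-(centred y 1 x) * y x 2 + centred y 0 x * y x 3))
  rw [mul_assoc δ]
  linarith

lemma abs_perInt_innerForce_le (h : IsStateSolution δ lam r ℓ a γ η y) (hlam : 0 < lam) :
    |perInt (innerForce δ lam y)| ≤ 2 * Real.pi +
      (2 + (3 + |δ| * (1 + lam⁻¹)) * (4 * Real.pi * r)) * perInt (fun x => ham δ lam (y x)) := by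
  have hc : Continuous fun x => ham δ lam (y x) := (continuous_ham δ lam).comp h.cont
  refine (abs_perInt_le h.continuous_innerForce (by fun_prop) (h.abs_innerForce_le hlam)).trans ?_
  rw [perInt_add (by fun_prop) (by fun_prop), perInt_const_mul, perInt_const, mul_one]

/-- A bound for the multiplier of the area constraint. -/
lemma abs_area_le (h : IsStateSolution δ lam r ℓ a γ η y) (hlam : 0 < lam) {R H K M : ℝ}
    (hR : r ≤ R) (hH : perInt (fun x => ham δ lam (y x)) ≤ H)
    (hK : perInt (fun x => kap δ lam (y x) ^ 2) ≤ K) (hM : |ℓ| ≤ M) :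
    |a| ≤ K * (2 * Real.pi + (2 + (3 + |δ| * (1 + lam⁻¹)) * (4 * Real.pi * R)) * H +
      M * (8 * Real.pi ^ 2 * R)) := by
  have hr := h.pos
  have hR0 : 0 < R := hr.trans_le hR
  have hH0 : 0 ≤ H := (perInt_nonneg fun x => ham_nonneg hlam (y x)).trans hH
  have hM0 : 0 ≤ M := (abs_nonneg _).trans hM
  have hpi := Real.pi_gt_three
  have h1 := h.perInt_innerForce
  have h2 := h.abs_perInt_innerForce_le hlam
  have h3 := h.abs_perInt_twist_le
  have h4 := h.spread_lower
  have hQ := spread_nonneg y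
  have hK0 : 0 ≤ K := (perInt_nonneg fun x => sq_nonneg _).trans hK
  set T := perInt fun x => twist (y x)
  set X := perInt (innerForce δ lam y)
  have h5 : |a| * spread y ≤ |X| + |ℓ| * |T| := by
    rw [← abs_of_nonneg hQ, ← abs_mul, ← abs_mul, show a * spread y = -(X + ℓ * T) by linarith,
      abs_neg]
    exact abs_add_le _ _
  have h6 : |X| + |ℓ| * |T| ≤ 2 * Real.pi + (2 + (3 + |δ| * (1 + lam⁻¹)) * (4 * Real.pi * R)) * H +
      M * (8 * Real.pi ^ 2 * R) := by
    refine add_le_add (h2.trans ?_) (mul_le_mul hM (h3.trans ?_) (abs_nonneg _) hM0)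
    · gcongr
      exact perInt_nonneg fun x => ham_nonneg hlam (y x)
    · gcongr
  -- This follows from `spread_lower`, where (2π)² exceeds 2. It permits division by the variance in
  -- the bound for a.
  have h7 : 1 ≤ spread y * K := by
    have := mul_le_mul_of_nonneg_left hK hQ
    nlinarith
  calc |a| ≤ |a| * (spread y * K) := le_mul_of_one_le_right (abs_nonneg _) h7
    _ = K * (|a| * spread y) := by ring
    _ ≤ _ := mul_le_mul_of_nonneg_left (h5.trans h6) hK0

/-- A pointwise bound for a component with bounded derivative. -/
lemma abs_le_of_centred (h : IsStateSolution δ lam r ℓ a γ η y) {i : Fin 14} {x R G : ℝ}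
    (hc : |centred y i x| ≤ 2 * Real.pi * r) (hR : r ≤ R)
    (hG : perInt (fun x => y x i ^ 2) ≤ G) : |y x i| ≤ 1 + G + 2 * Real.pi * R := by
  have hcont := h.cont
  have hpi := Real.pi_gt_three
  have h1 : |perInt fun x => y x i| ≤ 2 * Real.pi + G := by
    refine (abs_perInt_le (g := fun x => 1 + y x i ^ 2) (by fun_prop) (by fun_prop)
      fun x => ?_).trans ?_
    · nlinarith [sq_nonneg (|y x i| - 1), sq_abs (y x i), abs_nonneg (y x i)]
    · rw [perInt_add (by fun_prop) (by fun_prop), perInt_const]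
      linarith
  have hG0 : 0 ≤ G := (perInt_nonneg fun x => sq_nonneg _).trans hG
  have h2 : |(perInt fun x => y x i) / (2 * Real.pi)| ≤ 1 + G := by
    rw [abs_div, abs_of_pos Real.two_pi_pos, div_le_iff₀ Real.two_pi_pos]
    nlinarith
  have h3 : y x i = centred y i x + (perInt fun x => y x i) / (2 * Real.pi) := by
    rw [centred]; ring
  have h4 : 2 * Real.pi * r ≤ 2 * Real.pi * R := by gcongr
  rw [h3]
  exact (abs_add_le _ _).trans (by linarith)

lemma abs_force_le (h : IsStateSolution δ lam r ℓ a γ η y) (hlam : 0 < lam) {A S M : ℝ}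
    (hA : |a| ≤ A) (hS0 : ∀ x, |y x 0| ≤ S) (hS1 : ∀ x, |y x 1| ≤ S) (hM : |ℓ| ≤ M) (x : ℝ) :
    |force0 δ lam (y x)| ≤ M + A * S + (3 + |δ| * (1 + lam⁻¹)) * ham δ lam (y x) ∧
    |force1 δ lam (y x)| ≤ M + A * S + (3 + |δ| * (1 + lam⁻¹)) * ham δ lam (y x) := by
  have hA0 := (abs_nonneg _).trans hA
  have hn := ham_nonneg (δ := δ) hlam (y x)
  have h5 := abs_bulk_le (δ := δ) hlam (y x)
  have h6 := mul_le_mul_of_nonneg_left (abs_w_mul_om_le (δ := δ) hlam (y x)) (abs_nonneg δ)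
  rw [← abs_mul] at h6
  have h7 : |stress δ lam (y x)| ≤ 3 * ham δ lam (y x) + M := by
    rw [stress, h.length]
    exact (abs_add_le _ _).trans (add_le_add h5 hM)
  have e : ∀ t v g : ℝ, |t| ≤ 1 → |v| ≤ 1 → |g| ≤ S →
      |stress δ lam (y x) * t + δ * (w (y x) * om δ lam (y x)) * v + a * g| ≤
        M + A * S + (3 + |δ| * (1 + lam⁻¹)) * ham δ lam (y x) := by
    intro t v g ht hv hg
    have k1 := mul_le_mul h7 ht (abs_nonneg _) ((abs_nonneg _).trans h7)
    have k2 := mul_le_mul h6 hv (abs_nonneg _) ((abs_nonneg _).trans h6)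
    have k3 := mul_le_mul hA hg (abs_nonneg _) hA0
    rw [← abs_mul] at k1 k2 k3
    refine (abs_add_three _ _ _).trans ?_
    linarith
  constructor
  · have := e (y x 2) (-(y x 7)) (-(y x 1)) (h.abs_tangent0_le x)
      (by rw [abs_neg]; exact h.abs_director1_le x) (by rw [abs_neg]; exact hS1 x)
    rw [force0, h.area]
    convert this using 2
    ring
  · have := e (y x 3) (y x 6) (y x 0) (h.abs_tangent1_le x) (h.abs_director0_le x) (hS0 x)
    rw [force1, h.area]
    convert this using 2
    ring

lemma abs_const_le (h : IsStateSolution δ lam r ℓ a γ η y) (hlam : 0 < lam) {A S M H : ℝ}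
    (hA : |a| ≤ A) (hS0 : ∀ x, |y x 0| ≤ S) (hS1 : ∀ x, |y x 1| ≤ S) (hM : |ℓ| ≤ M)
    (hH : perInt (fun x => ham δ lam (y x)) ≤ H) :
    |y 0 10| ≤ M + A * S + (3 + |δ| * (1 + lam⁻¹)) * H ∧
    |y 0 11| ≤ M + A * S + (3 + |δ| * (1 + lam⁻¹)) * H := by
  have hc := h.cont
  have ch : Continuous fun x => ham δ lam (y x) := (continuous_ham δ lam).comp hc
  have cf0 : Continuous fun x => force0 δ lam (y x) := (continuous_force0 δ lam).comp hc
  have cf1 : Continuous fun x => force1 δ lam (y x) := (continuous_force1 δ lam).comp hc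
  have hb := h.abs_force_le hlam hA hS0 hS1 hM
  have hH0 : 0 ≤ perInt (fun x => ham δ lam (y x)) := perInt_nonneg fun x => ham_nonneg hlam (y x)
  have hpi := Real.pi_gt_three
  have key : ∀ (f : ℝ → ℝ) (c : ℝ), Continuous f → perInt f = -(2 * Real.pi * c) →
      (∀ x, |f x| ≤ M + A * S + (3 + |δ| * (1 + lam⁻¹)) * ham δ lam (y x)) →
      |c| ≤ M + A * S + (3 + |δ| * (1 + lam⁻¹)) * H := by
    intro f c hf he hle
    have h1 := abs_perInt_le hf (by fun_prop) hle
    rw [he, abs_neg, abs_mul, abs_of_pos Real.two_pi_pos, perInt_add (by fun_prop) (by fun_prop),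
      perInt_const, perInt_const_mul] at h1
    have h2 : (3 + |δ| * (1 + lam⁻¹)) * perInt (fun x => ham δ lam (y x)) ≤
        2 * Real.pi * ((3 + |δ| * (1 + lam⁻¹)) * H) :=
      (mul_le_mul_of_nonneg_left hH (by positivity)).trans
        (le_mul_of_one_le_left (by have := hH0.trans hH; positivity) (by linarith))
    refine le_of_mul_le_mul_left ?_ Real.two_pi_pos
    linarith
  exact ⟨key _ _ cf0 h.perInt_force0 fun x => (hb x).1,
    key _ _ cf1 h.perInt_force1 fun x => (hb x).2⟩

/-- The conservation law bounds the Hamiltonian density at each point by quantities of order zero;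
this is the passage from integral to pointwise control of w and ω. -/
lemma ham_le (h : IsStateSolution δ lam r ℓ a γ η y) {A S M C : ℝ}
    (hA : |a| ≤ A) (hS0 : ∀ x, |y x 0| ≤ S) (hS1 : ∀ x, |y x 1| ≤ S) (hM : |ℓ| ≤ M)
    (hC0 : |y 0 10| ≤ C) (hC1 : |y 0 11| ≤ C) (x : ℝ) :
    ham δ lam (y x) ≤ M + A * (2 * (S * 1)) + 2 * (C * 1) := by
  have hA0 := (abs_nonneg _).trans hA
  have h1 := abs_add_mul_le (p := -(y x 1)) (by rw [abs_neg]; exact hS1 x) (hS0 x)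
    (h.abs_tangent0_le x) (h.abs_tangent1_le x)
  have h2 := abs_add_mul_le hC0 hC1 (h.abs_tangent0_le x) (h.abs_tangent1_le x)
  have h3 := mul_le_mul hA h1 (abs_nonneg _) hA0
  rw [← abs_mul] at h3
  rw [h.ham_eq x, twist]
  linarith [le_abs_self ℓ, le_abs_self (a * (-(y x 1) * y x 2 + y x 0 * y x 3)),
    le_abs_self (y 0 10 * y x 2 + y 0 11 * y x 3)]

end IsStateSolution

/-- Solutions are bounded in terms of their energy, their size and the multiplier of the length. -/
lemma exists_state_bound (δ : ℝ) {lam : ℝ} (hlam : 0 < lam) (R H K G M : ℝ) :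
    ∃ B : ℝ, ∀ (r ℓ a : ℝ) (γ η : ℝ → Plane) (y : ℝ → SolState),
      IsStateSolution δ lam r ℓ a γ η y → r ≤ R → perInt (fun x => ham δ lam (y x)) ≤ H →
      perInt (fun x => kap δ lam (y x) ^ 2) ≤ K → perInt (fun x => y x 0 ^ 2) ≤ G →
      perInt (fun x => y x 1 ^ 2) ≤ G → |ℓ| ≤ M → ∀ x, ‖y x‖ ≤ B := by
  -- The constants bound, in this order, the area multiplier, the position, the integration
  -- constants and the Hamiltonian density; each uses the preceding ones.
  obtain ⟨A, hA⟩ : ∃ A, A = K * (2 * Real.pi +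
    (2 + (3 + |δ| * (1 + lam⁻¹)) * (4 * Real.pi * R)) * H + M * (8 * Real.pi ^ 2 * R)) := ⟨_, rfl⟩
  obtain ⟨S, hS⟩ : ∃ S, S = 1 + G + 2 * Real.pi * R := ⟨_, rfl⟩
  obtain ⟨C, hC⟩ : ∃ C, C = M + A * S + (3 + |δ| * (1 + lam⁻¹)) * H := ⟨_, rfl⟩
  obtain ⟨N, hN⟩ : ∃ N, N = M + A * (2 * (S * 1)) + 2 * (C * 1) := ⟨_, rfl⟩
  refine ⟨S + 1 + (1 + 2 * N) + (lam * (1 + lam⁻¹ * (2 * N)) + |δ| * (1 + 2 * N)) + A + C + R + M,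
    fun r ℓ a γ η y h hR hH hK hG0 hG1 hM x => ?_⟩
  have bA : |a| ≤ A := hA ▸ h.abs_area_le hlam hR hH hK hM
  have bS0 : ∀ x, |y x 0| ≤ S := fun x => hS ▸ h.abs_le_of_centred (h.abs_centred0_le x) hR hG0
  have bS1 : ∀ x, |y x 1| ≤ S := fun x => hS ▸ h.abs_le_of_centred (h.abs_centred1_le x) hR hG1
  obtain ⟨bC0, bC1⟩ := h.abs_const_le hlam bA bS0 bS1 hM hH
  rw [← hC] at bC0 bC1
  have bN := h.ham_le bA bS0 bS1 hM bC0 bC1 x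
  rw [← hN] at bN
  have nA := (abs_nonneg _).trans bA
  have nS := (abs_nonneg _).trans (bS0 0)
  have nC := (abs_nonneg _).trans bC0
  have nN := (ham_nonneg hlam _).trans bN
  have nM := (abs_nonneg _).trans hM
  have nR := h.pos.le.trans hR
  have bw : |w (y x)| ≤ 1 + 2 * N := by
    have := sq_w_le (δ := δ) hlam (y x)
    nlinarith [sq_nonneg (|w (y x)| - 1), sq_abs (w (y x)), abs_nonneg (w (y x))]
  have bom : |om δ lam (y x)| ≤ 1 + lam⁻¹ * (2 * N) := by
    have h1 := sq_om_le (δ := δ) hlam (y x)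
    have h2 : lam⁻¹ * (2 * ham δ lam (y x)) ≤ lam⁻¹ * (2 * N) := by gcongr
    nlinarith [sq_nonneg (|om δ lam (y x)| - 1), sq_abs (om δ lam (y x)), abs_nonneg (om δ lam (y x))]
  have bs : |s (y x)| ≤ 1 := abs_le_one_iff_mul_self_le_one.2 (by
    have := h.abs_s_le x
    rwa [sq] at this)
  have n1 : 0 ≤ lam * (1 + lam⁻¹ * (2 * N)) := by positivity
  have n2 : 0 ≤ |δ| * (1 + 2 * N) := by positivity
  have b4 : |y x 4| ≤ 1 + 2 * N := by
    rw [h.stress0 x, abs_neg, abs_mul]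
    exact (mul_le_of_le_one_right (abs_nonneg _) (h.abs_tangent1_le x)).trans bw
  have b5 : |y x 5| ≤ 1 + 2 * N := by
    rw [h.stress1 x, abs_mul]
    exact (mul_le_of_le_one_right (abs_nonneg _) (h.abs_tangent0_le x)).trans bw
  have b8 : |y x 8| ≤ lam * (1 + lam⁻¹ * (2 * N)) + |δ| * (1 + 2 * N) := by
    have e : y x 8 = lam * om δ lam (y x) + δ * w (y x) * s (y x) := by
      rw [om]; field_simp; ring
    rw [e]
    refine (abs_add_le _ _).trans (add_le_add ?_ ?_)
    · rw [abs_mul, abs_of_pos hlam]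
      gcongr
    · rw [abs_mul, abs_mul]
      exact (mul_le_of_le_one_right (by positivity) bs).trans (by gcongr)
  rw [pi_norm_le_iff_of_nonneg (by positivity)]
  have b0 := bS0 x
  have b1 := bS1 x
  have b2 := h.abs_tangent0_le x
  have b3 := h.abs_tangent1_le x
  have b6 := h.abs_director0_le x
  have b7 := h.abs_director1_le x
  have b9 : |y x 9| ≤ A := by rwa [h.area]
  have b10 : |y x 10| ≤ C := by rwa [h.const0]
  have b11 : |y x 11| ≤ C := by rwa [h.const1]
  have b12 : |y x 12| ≤ R := by rwa [h.speed, abs_of_pos h.pos]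
  have b13 : |y x 13| ≤ M := by rwa [h.length]
  intro i
  rw [Real.norm_eq_abs]
  fin_cases i
  · exact b0.trans (by linarith)
  · exact b1.trans (by linarith)
  · exact b2.trans (by linarith)
  · exact b3.trans (by linarith)
  · exact b4.trans (by linarith)
  · exact b5.trans (by linarith)
  · exact b6.trans (by linarith)
  · exact b7.trans (by linarith)
  · exact b8.trans (by linarith)
  · exact b9.trans (by linarith)
  · exact b10.trans (by linarith)
  · exact b11.trans (by linarith)
  · exact b12.trans (by linarith)
  · exact b13.trans (by linarith)

/-! ### Bounds on the states in terms of Sobolev norms -/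

lemma perInt_comp_add_left {f : ℝ → ℝ} (hp : Function.Periodic f (2 * Real.pi)) (x : ℝ) :
    perInt (fun t => f (x + t)) = perInt f := by
  rw [perInt, perInt, ← integral_period, ← integral_period,
    intervalIntegral.integral_comp_add_left, add_zero]
  have := hp.intervalIntegral_add_eq x 0
  rwa [zero_add] at this

lemma hasDerivAt_plane {f : ℝ → Plane} {a b x : ℝ} (h0 : HasDerivAt (fun x => f x 0) a x)
    (h1 : HasDerivAt (fun x => f x 1) b x) : HasDerivAt f !₂[a, b] x := by
  have := hasDerivAt_planeMk h0 h1
  rwa [planeMk_coord] at this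

namespace IsStateSolution

variable {δ lam r ℓ a : ℝ} {γ η : ℝ → Plane} {y : ℝ → SolState}

lemma point_eq (h : IsStateSolution δ lam r ℓ a γ η y) : γ = fun x => vec 0 1 (y x) :=
  funext fun x => plane_ext (h.point0 x) (h.point1 x)

lemma director_eq (h : IsStateSolution δ lam r ℓ a γ η y) : η = fun x => vec 6 7 (y x) :=
  funext fun x => plane_ext (h.director0 x) (h.director1 x)

lemma hasDerivAt_point (h : IsStateSolution δ lam r ℓ a γ η y) (x : ℝ) :
    HasDerivAt γ !₂[r * y x 2, r * y x 3] x := by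
  rw [h.point_eq]
  exact hasDerivAt_plane (h.d0 x) (h.d1 x)

lemma hasDerivAt_deriv_point (h : IsStateSolution δ lam r ℓ a γ η y) (x : ℝ) :
    HasDerivAt (deriv γ)
      !₂[r * -(r * kap δ lam (y x) * y x 3), r * (r * kap δ lam (y x) * y x 2)] x := by
  rw [funext fun x => (h.hasDerivAt_point x).deriv]
  exact hasDerivAt_plane ((h.d2 x).const_mul r) ((h.d3 x).const_mul r)

lemma hasDerivAt_director (h : IsStateSolution δ lam r ℓ a γ η y) (x : ℝ) :
    HasDerivAt η !₂[-(r * om δ lam (y x) * y x 7), r * om δ lam (y x) * y x 6] x := by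
  rw [h.director_eq]
  exact hasDerivAt_plane (h.d6 x) (h.d7 x)

lemma area_eq (h : IsStateSolution δ lam r ℓ a γ η y) :
    curveArea γ = r / 2 * perInt (fun x => twist (y x)) := by
  rw [curveArea_eq, ← perInt_const_mul, perInt, ← integral_const_mul]
  congr 1 with x
  rw [(h.hasDerivAt_point x).deriv, h.point0, h.point1, twist]
  simp
  ring

/-- At constant speed |∂ₓγ| = r and |∂ₓ²γ| = r²|κ|, so the three parts of the H² norm control
position, speed and curvature separately. -/
lemma perInt_sq_le_of_hNorm (h : IsStateSolution δ lam r ℓ a γ η y) {M : ℝ} (hM : hNorm 2 γ ≤ M) :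
    perInt (fun x => y x 0 ^ 2) ≤ M ^ 2 ∧ perInt (fun x => y x 1 ^ 2) ≤ M ^ 2 ∧ r ≤ M ∧
      r ^ 4 * perInt (fun x => kap δ lam (y x) ^ 2) ≤ M ^ 2 := by
  have hc := h.cont
  have hN := hNorm_nonneg 2 γ
  have hM0 := hN.trans hM
  have hsq : hNorm 2 γ ^ 2 ≤ M ^ 2 := by gcongr
  have i0 := (integral_sq_iteratedDeriv_le (k := 2) (j := 0) (by norm_num) γ).trans hsq
  have i1 := (integral_sq_iteratedDeriv_le (k := 2) (j := 1) (by norm_num) γ).trans hsq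
  have i2 := (integral_sq_iteratedDeriv_le (k := 2) (j := 2) le_rfl γ).trans hsq
  have e0 : ∫ x, ‖iteratedDeriv 0 γ x‖ ^ 2 ∂perVol = perInt fun x => y x 0 ^ 2 + y x 1 ^ 2 := by
    rw [perInt]
    congr 1 with x
    rw [iteratedDeriv_zero, plane_norm_sq, h.point0, h.point1]
  have e1 : ∫ x, ‖iteratedDeriv 1 γ x‖ ^ 2 ∂perVol = perInt fun _ => r ^ 2 := by
    rw [perInt]
    congr 1 with x
    rw [iteratedDeriv_one, plane_norm_sq, (h.hasDerivAt_point x).deriv]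
    simp
    linear_combination r ^ 2 * h.tangent x
  have e2 : ∫ x, ‖iteratedDeriv 2 γ x‖ ^ 2 ∂perVol =
      r ^ 4 * perInt fun x => kap δ lam (y x) ^ 2 := by
    rw [← perInt_const_mul, perInt]
    congr 1 with x
    rw [iteratedDeriv_succ, iteratedDeriv_one, plane_norm_sq, (h.hasDerivAt_deriv_point x).deriv]
    simp
    linear_combination r ^ 4 * kap δ lam (y x) ^ 2 * h.tangent x
  rw [e0] at i0
  rw [e1, perInt_const] at i1
  rw [e2] at i2
  have hpi := Real.pi_gt_three
  refine ⟨(perInt_mono (by fun_prop) (by fun_prop) fun x => ?_).trans i0,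
    (perInt_mono (by fun_prop) (by fun_prop) fun x => ?_).trans i0, ?_, i2⟩
  · nlinarith [sq_nonneg (y x 1)]
  · nlinarith [sq_nonneg (y x 0)]
  · exact abs_le_of_sq_le_sq' (by nlinarith [sq_nonneg r]) hM0 |>.2

lemma perInt_sq_om_le_of_hNorm (h : IsStateSolution δ lam r ℓ a γ η y) {M : ℝ}
    (hM : hNorm 1 η ≤ M) : r ^ 2 * perInt (fun x => om δ lam (y x) ^ 2) ≤ M ^ 2 := by
  have hN := hNorm_nonneg 1 η
  have hsq : hNorm 1 η ^ 2 ≤ M ^ 2 := by gcongr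
  have i1 := (integral_sq_iteratedDeriv_le (k := 1) (j := 1) le_rfl η).trans hsq
  have e1 : ∫ x, ‖iteratedDeriv 1 η x‖ ^ 2 ∂perVol =
      r ^ 2 * perInt fun x => om δ lam (y x) ^ 2 := by
    rw [← perInt_const_mul, perInt]
    congr 1 with x
    rw [iteratedDeriv_one, plane_norm_sq, (h.hasDerivAt_director x).deriv]
    simp
    linear_combination r ^ 2 * om δ lam (y x) ^ 2 * h.unit x
  rwa [e1] at i1

/-- Since w = κ + δω⟨Jη,τ⟩ and |⟨Jη,τ⟩| ≤ 1, w² is at most 2κ² + 2δ²ω². -/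
lemma perInt_ham_le (h : IsStateSolution δ lam r ℓ a γ η y) :
    perInt (fun x => ham δ lam (y x)) ≤ perInt (fun x => kap δ lam (y x) ^ 2) +
      (δ ^ 2 + lam / 2) * perInt (fun x => om δ lam (y x) ^ 2) := by
  have hc := h.cont
  have ch : Continuous fun x => ham δ lam (y x) := (continuous_ham δ lam).comp hc
  have ck : Continuous fun x => kap δ lam (y x) := (continuous_kap δ lam).comp hc
  have co : Continuous fun x => om δ lam (y x) := (continuous_om δ lam).comp hc
  rw [← perInt_const_mul, ← perInt_add (by fun_prop) (by fun_prop)]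
  refine perInt_mono (by fun_prop) (by fun_prop) fun x => ?_
  have hs := h.abs_s_le x
  have e : w (y x) = kap δ lam (y x) + δ * om δ lam (y x) * s (y x) := by rw [kap]; ring
  have h1 : (δ * om δ lam (y x) * s (y x)) ^ 2 ≤ δ ^ 2 * om δ lam (y x) ^ 2 := by
    rw [mul_pow, mul_pow]
    exact mul_le_of_le_one_right (by positivity) hs
  rw [ham, e]
  nlinarith [sq_nonneg (kap δ lam (y x) - δ * om δ lam (y x) * s (y x))]

lemma perInt_sq_kap_le (h : IsStateSolution δ lam r ℓ a γ η y) (hlam : 0 < lam) :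
    perInt (fun x => kap δ lam (y x) ^ 2) ≤
      (4 + 4 * δ ^ 2 * lam⁻¹) * perInt (fun x => ham δ lam (y x)) := by
  have hc := h.cont
  have ch : Continuous fun x => ham δ lam (y x) := (continuous_ham δ lam).comp hc
  have ck : Continuous fun x => kap δ lam (y x) := (continuous_kap δ lam).comp hc
  rw [← perInt_const_mul]
  refine perInt_mono (by fun_prop) (by fun_prop) fun x => ?_
  have hs := h.abs_s_le x
  have h1 : (δ * om δ lam (y x) * s (y x)) ^ 2 ≤ δ ^ 2 * om δ lam (y x) ^ 2 := by
    rw [mul_pow, mul_pow]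
    exact mul_le_of_le_one_right (by positivity) hs
  have h2 := mul_le_mul_of_nonneg_left (sq_om_le (δ := δ) hlam (y x)) (sq_nonneg δ)
  have h3 := sq_w_le (δ := δ) hlam (y x)
  rw [kap]
  nlinarith [sq_nonneg (w (y x) + δ * om δ lam (y x) * s (y x))]

end IsStateSolution

/-- Solutions are bounded in terms of their Sobolev norms, a lower bound for the length and the
multiplier of the length. -/
lemma exists_state_bound_of_hNorm (δ : ℝ) {lam r₀ : ℝ} (hlam : 0 < lam) (hr₀ : 0 < r₀)
    (M₁ M₂ M₄ : ℝ) :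
    ∃ B : ℝ, ∀ (r ℓ a : ℝ) (γ η : ℝ → Plane) (y : ℝ → SolState),
      IsStateSolution δ lam r ℓ a γ η y → r₀ ≤ r → hNorm 2 γ ≤ M₁ → hNorm 1 η ≤ M₂ → |ℓ| ≤ M₄ →
      ∀ x, ‖y x‖ ≤ B := by
  obtain ⟨B, hB⟩ := exists_state_bound δ hlam M₁ (M₁ ^ 2 / r₀ ^ 4 + (δ ^ 2 + lam / 2) *
    (M₂ ^ 2 / r₀ ^ 2)) (M₁ ^ 2 / r₀ ^ 4) (M₁ ^ 2) M₄
  refine ⟨B, fun r ℓ a γ η y h hr h1 h2 h4 => ?_⟩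
  obtain ⟨k0, k1, k2, k3⟩ := h.perInt_sq_le_of_hNorm h1
  have k4 := h.perInt_sq_om_le_of_hNorm h2
  have n1 : 0 ≤ perInt fun x => kap δ lam (y x) ^ 2 := perInt_nonneg fun x => sq_nonneg _
  have n2 : 0 ≤ perInt fun x => om δ lam (y x) ^ 2 := perInt_nonneg fun x => sq_nonneg _
  have b1 : perInt (fun x => kap δ lam (y x) ^ 2) ≤ M₁ ^ 2 / r₀ ^ 4 := by
    rw [le_div_iff₀' (by positivity)]
    exact le_trans (by gcongr) k3
  have b2 : perInt (fun x => om δ lam (y x) ^ 2) ≤ M₂ ^ 2 / r₀ ^ 2 := by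
    rw [le_div_iff₀' (by positivity)]
    exact le_trans (by gcongr) k4
  exact hB r ℓ a γ η y h k2 ((h.perInt_ham_le).trans (by gcongr)) b1 k0 k1 h4

/-! ### A lower bound for the length -/

/-- In `energyLM` the length enters with coefficient 1, so ℓ = 1. The Sobolev norms do not prevent
the curve from shrinking; the area constraint does so if A₀ ≠ 0, and the dilation identity if A₀ =
0. -/
lemma exists_speed_lower (δ A₀ : ℝ) {lam : ℝ} (hlam : 0 < lam) :
    ∃ r₀ > 0, ∀ (r a : ℝ) (γ η : ℝ → Plane) (y : ℝ → SolState),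
      IsStateSolution δ lam r 1 a γ η y → curveArea γ = A₀ → r₀ ≤ r := by
  have hpi := Real.pi_pos
  suffices ∃ c > 0, ∀ (r a : ℝ) (γ η : ℝ → Plane) (y : ℝ → SolState),
      IsStateSolution δ lam r 1 a γ η y → curveArea γ = A₀ → 1 ≤ c * r ^ 2 by
    obtain ⟨c, hc, h⟩ := this
    refine ⟨√c⁻¹, by positivity, fun r a γ η y hy hA => ?_⟩
    have h1 := h r a γ η y hy hA
    rw [Real.sqrt_le_left hy.pos.le, inv_le_iff_one_le_mul₀' hc]
    exact h1
  -- For zero area the dilation identity becomes ∫ham = 2π, so ∫κ² is bounded. By `spread_lower` the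
  -- variance is then bounded below, while `spread_le` bounds it by a multiple of r².
  by_cases hA0 : A₀ = 0
  · refine ⟨64 * Real.pi ^ 2 * (1 + δ ^ 2 * lam⁻¹), by positivity, fun r a γ η y h hA => ?_⟩
    have hr := h.pos
    have hT : perInt (fun x => twist (y x)) = 0 := by
      rw [hA0, h.area_eq] at hA
      exact (mul_eq_zero.1 hA).resolve_left (by positivity)
    have h1 := h.perInt_ham
    rw [hT, mul_zero, add_zero, mul_one] at h1
    have h2 := h.perInt_sq_kap_le hlam
    rw [h1] at h2
    have h3 := h.spread_lower
    have h4 := h.spread_le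
    have h5 := mul_le_mul h4 h2 (perInt_nonneg fun x => sq_nonneg _) (by positivity)
    have h6 : (4 * Real.pi ^ 2) * (64 * Real.pi ^ 2 * (1 + δ ^ 2 * lam⁻¹) * r ^ 2) =
      2 * (16 * Real.pi ^ 3 * r ^ 2 * ((4 + 4 * δ ^ 2 * lam⁻¹) * (2 * Real.pi))) := by ring
    refine le_of_mul_le_mul_left ?_ (show 0 < 4 * Real.pi ^ 2 by positivity)
    rw [h6]
    nlinarith
  · refine ⟨4 * Real.pi ^ 2 / |A₀|, by positivity, fun r a γ η y h hA => ?_⟩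
    have hr := h.pos
    rw [div_mul_eq_mul_div, le_div_iff₀ (by positivity), one_mul, ← hA, h.area_eq, abs_mul,
      abs_of_pos (by positivity)]
    have := mul_le_mul_of_nonneg_left h.abs_perInt_twist_le (show 0 ≤ r / 2 by positivity)
    linarith

/-! ### A bound for the multiplier of the length -/

namespace IsStateSolution

variable {δ lam r ℓ a : ℝ} {γ η : ℝ → Plane} {y : ℝ → SolState}

/-- A pointwise bound for the centred curve by its deviation from a circular motion. -/
lemma circle_deviation_pointwise (h : IsStateSolution δ lam r ℓ a γ η y) (c x : ℝ) :
    (2 - 2 * Real.cos (2 * Real.pi * c)) * (centred y 0 x ^ 2 + centred y 1 x ^ 2) ≤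
      2 * Real.pi * perInt (fun x => (r * y x 2 + c * centred y 1 x) ^ 2 +
        (r * y x 3 - c * centred y 0 x) ^ 2) := by
  have hc := h.cont
  have k0 := h.continuous_centred 0
  have k1 := h.continuous_centred 1
  have hcos : ∀ t, HasDerivAt (fun t => Real.cos (c * t)) (-Real.sin (c * t) * (c * 1)) t :=
    fun t => ((hasDerivAt_id t).const_mul c).cos
  have hsin : ∀ t, HasDerivAt (fun t => Real.sin (c * t)) (Real.cos (c * t) * (c * 1)) t :=
    fun t => ((hasDerivAt_id t).const_mul c).sin
  -- The vector (p, q) is γ' - cJ(γ - γ̄), which vanishes for circular motion with angular velocity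
  -- c. Rotated by the angle -ct it becomes (f0, f1), the derivative of γ - γ̄ seen in the rotating
  -- frame.
  set p : ℝ → ℝ := fun t => r * y t 2 + c * centred y 1 t with hp
  set q : ℝ → ℝ := fun t => r * y t 3 - c * centred y 0 t with hq
  have cp : Continuous p := by fun_prop
  have cq : Continuous q := by fun_prop
  have pp : Function.Periodic (fun x => p x ^ 2 + q x ^ 2) (2 * Real.pi) := fun x => by
    simp only [hp, hq, h.periodic x, h.periodic_centred 0 x, h.periodic_centred 1 x]
  set f0 : ℝ → ℝ := fun t => Real.cos (c * t) * p t + Real.sin (c * t) * q t with hf0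
  set f1 : ℝ → ℝ := fun t => Real.cos (c * t) * q t - Real.sin (c * t) * p t with hf1
  have c0 : Continuous f0 := by fun_prop
  have c1 : Continuous f1 := by fun_prop
  have D0 : ∀ t, HasDerivAt (fun t => Real.cos (c * t) * centred y 0 t +
      Real.sin (c * t) * centred y 1 t) (f0 t) t := fun t =>
    (((hcos t).mul (h.hasDerivAt_centred0 t)).add
      ((hsin t).mul (h.hasDerivAt_centred1 t))).congr_deriv (by simp only [hf0, hp, hq]; ring)
  have D1 : ∀ t, HasDerivAt (fun t => Real.cos (c * t) * centred y 1 t -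
      Real.sin (c * t) * centred y 0 t) (f1 t) t := fun t =>
    (((hcos t).mul (h.hasDerivAt_centred1 t)).sub
      ((hsin t).mul (h.hasDerivAt_centred0 t))).congr_deriv (by simp only [hf1, hp, hq]; ring)
  have I : ∀ F f : ℝ → ℝ, Continuous f → (∀ t, HasDerivAt F (f t) t) →
      (F (x + 2 * Real.pi) - F x) ^ 2 ≤ 2 * Real.pi * perInt (fun t => f (x + t) ^ 2) := by
    intro F f hf hF
    have e : perInt (fun t => f (x + t) * 1) = F (x + 2 * Real.pi) - F x := by
      simp only [mul_one]
      rw [perInt, ← integral_period, intervalIntegral.integral_comp_add_left, add_zero,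
        intervalIntegral.integral_eq_sub_of_hasDerivAt (fun x _ => hF x)
          (hf.intervalIntegrable _ _)]
    have := perInt_sq_mul_le (f := fun t => f (x + t)) (g := fun _ => 1) (by fun_prop)
      continuous_const
    rw [e, one_pow, perInt_const, mul_one] at this
    linarith
  have i0 := I _ _ c0 D0
  have i1 := I _ _ c1 D1
  have i2 : perInt (fun t => f0 (x + t) ^ 2) + perInt (fun t => f1 (x + t) ^ 2) =
      perInt (fun x => p x ^ 2 + q x ^ 2) := by
    rw [← perInt_comp_add_left pp x, ← perInt_add (by fun_prop) (by fun_prop)]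
    congr 1 with t
    simp only [hf0, hf1]
    linear_combination (p (x + t) ^ 2 + q (x + t) ^ 2) * Real.sin_sq_add_cos_sq (c * (x + t))
  simp only [h.periodic_centred 0 x, h.periodic_centred 1 x] at i0 i1
  have e3 : c * (x + 2 * Real.pi) = c * x + 2 * Real.pi * c := by ring
  rw [← i2, mul_add (2 * Real.pi)]
  -- Over one period the rotated curve moves from a vector to its rotation by a further -2πc; the
  -- squared length of this displacement is (2 - 2cos 2πc)|γ - γ̄|².
  refine le_trans (le_of_eq ?_) (add_le_add i0 i1)
  rw [e3, Real.cos_add, Real.sin_add]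
  have s1 := Real.sin_sq_add_cos_sq (c * x)
  have s2 := Real.sin_sq_add_cos_sq (2 * Real.pi * c)
  set C := Real.cos (c * x)
  set S := Real.sin (c * x)
  set C' := Real.cos (2 * Real.pi * c)
  set S' := Real.sin (2 * Real.pi * c)
  set g0 := centred y 0 x
  set g1 := centred y 1 x
  linear_combination (-(g0 ^ 2 + g1 ^ 2)) * ((2 - 2 * C') * s1 + (C ^ 2 + S ^ 2) * (s2))

/-- The area of a curve of given length and variance is bounded away from the extremal values unless
a multiply covered circle is close. -/
lemma circle_deviation (h : IsStateSolution δ lam r ℓ a γ η y) (hQ : 0 < spread y) :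
    spread y ^ 2 * (2 - 2 * Real.cos (2 * Real.pi *
      (r * perInt (fun x => twist (y x)) / spread y))) ≤
      4 * Real.pi ^ 2 * r ^ 2 * (2 * Real.pi * spread y - perInt (fun x => twist (y x)) ^ 2) := by
  have hc := h.cont
  have k0 := h.continuous_centred 0
  have k1 := h.continuous_centred 1
  set T := perInt (fun x => twist (y x)) with hT
  -- This c minimises ∫|γ' - cJ(γ - γ̄)|² = 2πr² - 2rcT + c²Q; the minimum is r²(2πQ - T²)/Q.
  set c := r * T / spread y with hcdef
  have h1 : (2 - 2 * Real.cos (2 * Real.pi * c)) * spread y ≤ 2 * Real.pi * (2 * Real.pi *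
      perInt (fun x => (r * y x 2 + c * centred y 1 x) ^ 2 +
        (r * y x 3 - c * centred y 0 x) ^ 2)) := by
    have := perInt_mono (by fun_prop) (by fun_prop) fun x => h.circle_deviation_pointwise c x
    rwa [perInt_const_mul (2 - 2 * Real.cos (2 * Real.pi * c)), perInt_const] at this
  have h2 : perInt (fun x => (r * y x 2 + c * centred y 1 x) ^ 2 +
        (r * y x 3 - c * centred y 0 x) ^ 2) =
      2 * Real.pi * r ^ 2 + c ^ 2 * spread y + (-(2 * r * c)) * T := by
    rw [hT, ← h.perInt_twist_centred, spread, ← perInt_const, ← perInt_const_mul,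
      ← perInt_const_mul, ← perInt_add (by fun_prop) (by fun_prop),
      ← perInt_add (by fun_prop) (by fun_prop)]
    congr 1 with x
    linear_combination r ^ 2 * h.tangent x
  rw [h2] at h1
  have h3 := mul_le_mul_of_nonneg_left h1 hQ.le
  have h4 : spread y * (2 * Real.pi * (2 * Real.pi * (2 * Real.pi * r ^ 2 + c ^ 2 * spread y +
      (-(2 * r * c)) * T))) = 4 * Real.pi ^ 2 * r ^ 2 * (2 * Real.pi * spread y - T ^ 2) := by
    rw [hcdef]
    field_simp
    ring
  rw [h4] at h3
  linarith

end IsStateSolution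

/-- The defect in the isoperimetric inequality for multiply covered circles is bounded below. -/
lemma exists_defect_lower {r T q₀ q₁ : ℝ} (hr : 0 < r) (hq₀ : 0 < q₀)
    (hT : ∀ n : ℕ, 1 ≤ n → |T| * n ≠ 2 * Real.pi * r) :
    ∃ ε > 0, ∀ q ∈ Icc q₀ q₁, q ^ 2 * (2 - 2 * Real.cos (2 * Real.pi * (r * T / q))) ≤
      4 * Real.pi ^ 2 * r ^ 2 * (2 * Real.pi * q - T ^ 2) → ε ≤ 2 * Real.pi * q - T ^ 2 := by
  have hpi := Real.pi_pos
  have hcont : ContinuousOn (fun q : ℝ => |2 * Real.pi * q - T ^ 2| +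
      q ^ 2 * (2 - 2 * Real.cos (2 * Real.pi * (r * T / q)))) (Icc q₀ q₁) := by
    have : ∀ q ∈ Icc q₀ q₁, q ≠ 0 := fun q hq => (hq₀.trans_le hq.1).ne'
    fun_prop (disch := assumption)
  -- If this continuous function vanished at q, then T² = 2πq and rT/q would be an integer n, so nT
  -- = 2πr, which is excluded. Compactness gives a positive lower bound.
  obtain ⟨ε, hε, hmin⟩ := isCompact_Icc.exists_forall_le' hcont (a := 0) fun q hq => by
    have hq0 : 0 < q := hq₀.trans_le hq.1
    have n1 := abs_nonneg (2 * Real.pi * q - T ^ 2)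
    have n2 : 0 ≤ 2 - 2 * Real.cos (2 * Real.pi * (r * T / q)) := by
      linarith [Real.cos_le_one (2 * Real.pi * (r * T / q))]
    by_contra hle
    have n3 : 0 ≤ q ^ 2 * (2 - 2 * Real.cos (2 * Real.pi * (r * T / q))) := by positivity
    have z1 : 2 * Real.pi * q - T ^ 2 = 0 := abs_eq_zero.1 (by linarith)
    have z2 : q ^ 2 * (2 - 2 * Real.cos (2 * Real.pi * (r * T / q))) = 0 := by linarith
    have z3 := (mul_eq_zero.1 z2).resolve_left (by positivity)
    obtain ⟨n, hn⟩ := (Real.cos_eq_one_iff (2 * Real.pi * (r * T / q))).1 (by linarith)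
    have hT2 : 0 < T ^ 2 := by nlinarith
    have hT0 : T ≠ 0 := fun h => by simp [h] at hT2
    have hn2 : (n : ℝ) * q = r * T := by
      field_simp at hn
      linarith
    have hn3 : (n : ℝ) * T = 2 * Real.pi * r := by
      refine mul_right_cancel₀ hT0 ?_
      linear_combination (2 * Real.pi) * hn2 - n * z1
    have hn4 : |T| * (n.natAbs : ℝ) = 2 * Real.pi * r := by
      rw [Nat.cast_natAbs, Int.cast_abs, ← abs_mul, mul_comm, hn3, abs_of_pos (by positivity)]
    refine hT n.natAbs (Nat.one_le_iff_ne_zero.2 fun h => ?_) hn4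
    rw [h] at hn4
    simp at hn4
    exact hr.ne' (by simpa [hpi.ne'] using hn4)
  -- The hypothesis on q bounds the second summand by 4π²r² times the defect, so ε is at most (1 +
  -- 4π²r²) times the defect.
  refine ⟨ε / (1 + 4 * Real.pi ^ 2 * r ^ 2), by positivity, fun q hq hle => ?_⟩
  have hD : 0 ≤ 2 * Real.pi * q - T ^ 2 := by
    have n2 : 0 ≤ 2 - 2 * Real.cos (2 * Real.pi * (r * T / q)) := by
      linarith [Real.cos_le_one (2 * Real.pi * (r * T / q))]
    have n3 : 0 ≤ q ^ 2 * (2 - 2 * Real.cos (2 * Real.pi * (r * T / q))) := by positivity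
    exact nonneg_of_mul_nonneg_right (n3.trans hle) (by positivity)
  have := hmin q hq
  rw [abs_of_nonneg hD] at this
  rw [div_le_iff₀ (by positivity)]
  linarith

/-- A bound for the multiplier of the length away from multiply covered circles. -/
lemma exists_length_multiplier_bound (δ A₀ : ℝ) {lam r : ℝ} (hlam : 0 < lam) (hr : 0 < r)
    (hA : ∀ n : ℕ, 1 ≤ n → |A₀| * n ≠ Real.pi * r ^ 2) (M₁ M₂ : ℝ) :
    ∃ M : ℝ, ∀ (ℓ a : ℝ) (γ η : ℝ → Plane) (y : ℝ → SolState),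
      IsStateSolution δ lam r ℓ a γ η y → curveArea γ = A₀ → hNorm 2 γ ≤ M₁ → hNorm 1 η ≤ M₂ →
      |ℓ| ≤ M := by
  have hpi := Real.pi_pos
  obtain ⟨T, hT⟩ : ∃ T, T = 2 * A₀ / r := ⟨_, rfl⟩
  obtain ⟨K, hK⟩ : ∃ K, K = 1 + M₁ ^ 2 / r ^ 4 := ⟨_, rfl⟩
  have hK0 : 0 < K := by rw [hK]; positivity
  obtain ⟨H, hH⟩ : ∃ H, H = M₁ ^ 2 / r ^ 4 + (δ ^ 2 + lam / 2) * (M₂ ^ 2 / r ^ 2) := ⟨_, rfl⟩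
  obtain ⟨ε, hε, hlow⟩ := exists_defect_lower (T := T) (q₁ := 16 * Real.pi ^ 3 * r ^ 2) hr
    (inv_pos.2 hK0) (fun n hn h => hA n hn (by
      rw [hT, abs_div, abs_mul, abs_two, abs_of_pos hr] at h
      field_simp at h
      linarith))
  refine ⟨(16 * Real.pi ^ 3 * r ^ 2 * H + |T| * (2 * Real.pi +
    (2 + (3 + |δ| * (1 + lam⁻¹)) * (4 * Real.pi * r)) * H)) / ε,
    fun ℓ a γ η y h hAr h1 h2 => ?_⟩
  have hTy : perInt (fun x => twist (y x)) = T := by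
    rw [hT, ← hAr, h.area_eq]
    field_simp
  obtain ⟨-, -, -, k3⟩ := h.perInt_sq_le_of_hNorm h1
  have k4 := h.perInt_sq_om_le_of_hNorm h2
  rw [← le_div_iff₀' (by positivity)] at k3 k4
  have bH : perInt (fun x => ham δ lam (y x)) ≤ H := by
    rw [hH]
    exact (h.perInt_ham_le).trans (by gcongr)
  have nH : 0 ≤ perInt (fun x => ham δ lam (y x)) := perInt_nonneg fun x => ham_nonneg hlam (y x)
  have nQ := IsStateSolution.spread_nonneg y
  have bQ : K⁻¹ ≤ spread y := by
    rw [inv_le_iff_one_le_mul₀ hK0]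
    have e1 := h.spread_lower
    have e2 := mul_le_mul_of_nonneg_left (k3.trans (show M₁ ^ 2 / r ^ 4 ≤ K by linarith)) nQ
    nlinarith [Real.pi_gt_three]
  have hQ0 : 0 < spread y := (inv_pos.2 hK0).trans_le bQ
  have hdev := h.circle_deviation hQ0
  rw [hTy] at hdev
  have hD := hlow _ ⟨bQ, h.spread_le⟩ hdev
  have e1 := h.perInt_ham
  have e2 := h.perInt_innerForce
  rw [hTy] at e1 e2
  -- The area multiplier is eliminated between the dilation identity and the identity for the
  -- centred curve.
  have e3 : ℓ * (2 * Real.pi * spread y - T ^ 2) =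
      spread y * perInt (fun x => ham δ lam (y x)) + T * perInt (innerForce δ lam y) := by
    linear_combination (-(spread y)) * e1 - T * e2
  have e4 : |ℓ| * (2 * Real.pi * spread y - T ^ 2) ≤ 16 * Real.pi ^ 3 * r ^ 2 * H +
      |T| * (2 * Real.pi + (2 + (3 + |δ| * (1 + lam⁻¹)) * (4 * Real.pi * r)) * H) := by
    rw [← abs_of_pos (hε.trans_le hD), ← abs_mul, e3]
    refine (abs_add_le _ _).trans (add_le_add ?_ ?_)
    · rw [abs_of_nonneg (by positivity)]
      exact mul_le_mul h.spread_le bH nH (by positivity)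
    · rw [abs_mul]
      refine mul_le_mul_of_nonneg_left ((h.abs_perInt_innerForce_le hlam).trans ?_) (abs_nonneg _)
      gcongr
  rw [le_div_iff₀ hε]
  exact (mul_le_mul_of_nonneg_left hD (abs_nonneg _)).trans e4

/-! ### Regularity and bounds for constrained critical points -/

lemma IsArcProportional.speed_pos {γ : ℝ → Plane} (hs : IsArcProportional γ) (h : IsH2imm γ) :
    0 < curveLength γ / (2 * Real.pi) := by
  rw [← hs 0]
  exact norm_pos_iff.2 (h.2 0)

section FirstVariation

variable {δ lam r : ℝ} {γ η : ℝ → Plane}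

lemma hasFirstVariation_energyE (hγ : IsH2per γ) (hη : IsH1per η) (hr : 0 < r)
    (hs : ∀ x, ‖deriv γ x‖ = r) :
    HasFirstVariation (energyE δ lam) ![curveLength, curveArea] γ η
      (fun x => coeffA δ r (deriv γ x) (deriv (deriv γ) x) (deriv η x))
      (fun x => coeffB δ lam r (deriv γ x) (deriv (deriv γ) x) (deriv η x))
      (fun x => coeffC δ lam r (deriv γ x) (deriv (deriv γ) x) (deriv η x))
      ![fun x => r⁻¹ • deriv γ x, fun x => rotJ (γ x)] where
  h1 := hη
  memA := memLp_coeffA δ hγ hη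
  memB := memLp_coeffB δ lam hγ hη
  memC := memLp_coeffC δ lam hγ hη
  contG := by
    intro i
    fin_cases i
    · exact hγ.2.continuous.const_smul r⁻¹
    · exact rotJL.continuous.comp hγ.1.continuous
  functional := fun φ ψ hφ hψ => hasDerivAt_energyE δ lam hγ hφ hη hψ hr hs
  constraint := by
    intro i φ hφ
    fin_cases i
    · exact hasDerivAt_curveLength hγ hφ hr hs
    · exact hasDerivAt_curveArea hγ hφ

lemma hasFirstVariation_energyLM (hγ : IsH2per γ) (hη : IsH1per η) (hr : 0 < r)
    (hs : ∀ x, ‖deriv γ x‖ = r) :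
    HasFirstVariation (energyLM δ lam) ![curveArea] γ η
      (fun x => coeffA δ r (deriv γ x) (deriv (deriv γ) x) (deriv η x))
      (fun x => coeffB δ lam r (deriv γ x) (deriv (deriv γ) x) (deriv η x) + r⁻¹ • deriv γ x)
      (fun x => coeffC δ lam r (deriv γ x) (deriv (deriv γ) x) (deriv η x))
      ![fun x => rotJ (γ x)] where
  h1 := hη
  memA := memLp_coeffA δ hγ hη
  memB := (memLp_coeffB δ lam hγ hη).add
    (memLp_perVol_of_continuous (hγ.2.continuous.const_smul r⁻¹) 1)
  memC := memLp_coeffC δ lam hγ hη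
  contG := by
    intro i
    fin_cases i
    exact rotJL.continuous.comp hγ.1.continuous
  functional := by
    intro φ ψ hφ hψ
    have hE := hasFirstVariation_energyE (δ := δ) (lam := lam) hγ hη hr hs
    have hg := hγ.2.continuous.const_smul r⁻¹
    refine ((hE.functional φ ψ hφ hψ).add
      (hasDerivAt_curveLength hγ hφ hr hs)).congr_deriv ?_
    rw [hE.integral_split hφ hψ, add_right_comm, ← integral_add]
    · rw [← integral_add]
      · congr 1 with x
        rw [inner_add_left]
        ring
      · exact ((integrable_inner_of_memLp hE.memA hφ.2.2.1).add
          (integrable_inner_of_continuous hE.memB hφ.2.continuous)).add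
          (integrable_inner_of_continuous (memLp_perVol_of_continuous hg 1) hφ.2.continuous)
      · exact integrable_inner_of_memLp hE.memC hψ.2.1
    · exact (integrable_inner_of_memLp hE.memA hφ.2.2.1).add
        (integrable_inner_of_continuous hE.memB hφ.2.continuous)
    · exact integrable_inner_of_continuous (memLp_perVol_of_continuous hg 1) hφ.2.continuous
  constraint := by
    intro i φ hφ
    fin_cases i
    exact hasDerivAt_curveArea hγ hφ

end FirstVariation

/-- Lagrange multipliers give rise to a solution of the Euler-Lagrange system. -/
lemma HasFirstVariation.exists_state {m : ℕ} {Φ : (ℝ → Plane) → (ℝ → Plane) → ℝ}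
    {F : Fin m → (ℝ → Plane) → ℝ} {γ η B : ℝ → Plane} {G : Fin m → ℝ → Plane} {μ : Fin m → ℝ}
    {Ψ : (ℝ → ℝ) → ℝ} {δ lam r ℓ a : ℝ} (hlam : 0 < lam)
    (h : HasFirstVariation Φ F γ η
      (fun x => coeffA δ r (deriv γ x) (deriv (deriv γ) x) (deriv η x)) B
      (fun x => coeffC δ lam r (deriv γ x) (deriv (deriv γ) x) (deriv η x)) G)
    (hm : IsLagrangeMultiplier Φ F γ η μ Ψ)
    (hB : ∀ x, B x + ∑ i, μ i • G i x =
      coeffB δ lam r (deriv γ x) (deriv (deriv γ) x) (deriv η x) + (ℓ • r⁻¹ • deriv γ x +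
        a • rotJ (γ x)))
    (hγ : IsH2per γ) (hr : 0 < r) (hs : ∀ x, ‖deriv γ x‖ = r) (hu : ∀ x, constraintS η x = 0) :
    ∃ y, IsStateSolution δ lam r ℓ a γ η y := by
  refine IsWeakSolution.exists_state hlam ⟨hγ, h.h1, hr, hs, fun x => sub_eq_zero.1 (hu x),
    fun φ hφ => ?_, fun g hg => h.director_equation hm hg⟩
  have := h.curve_equation hm hφ
  simpa only [hB] using this

/-! ### Smoothness of the pair and of the multiplier of the unit length constraint -/

namespace IsStateSolution

variable {δ lam r ℓ a : ℝ} {γ η : ℝ → Plane} {y : ℝ → SolState}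

lemma isSmoothPer_comp {E : Type*} [NormedAddCommGroup E] [NormedSpace ℝ E] {f : SolState → E}
    (h : IsStateSolution δ lam r ℓ a γ η y) (hf : ContDiff ℝ ∞ f) :
    IsSmoothPer fun x => f (y x) :=
  ⟨fun x => by simp only [h.periodic x], contDiff_comp_ode (contDiff_field δ lam) h.ode hf⟩

lemma isSmoothPer_point (h : IsStateSolution δ lam r ℓ a γ η y) : IsSmoothPer γ := by
  rw [h.point_eq]
  exact h.isSmoothPer_comp (contDiff_vec 0 1)

lemma isSmoothPer_director (h : IsStateSolution δ lam r ℓ a γ η y) : IsSmoothPer η := by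
  rw [h.director_eq]
  exact h.isSmoothPer_comp (contDiff_vec 6 7)

lemma bendDensity_eq (h : IsStateSolution δ lam r ℓ a γ η y) (x : ℝ) :
    bendDensity δ r (deriv γ x) (deriv (deriv γ) x) (deriv η x) = w (y x) := by
  have hr := h.pos.ne'
  have ht := h.tangent x
  have e : w (y x) = kap δ lam (y x) * (y x 2 ^ 2 + y x 3 ^ 2) +
      δ * om δ lam (y x) * s (y x) := by
    rw [ht, kap]; ring
  rw [e, bendDensity, (h.hasDerivAt_point x).deriv, (h.hasDerivAt_deriv_point x).deriv,
    (h.hasDerivAt_director x).deriv, s]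
  simp
  field_simp

/-- The multiplier of the unit length constraint is represented by smooth functions. -/
lemma isRepresentedBy (h : IsStateSolution δ lam r ℓ a γ η y)
    (hs : ∀ x, ‖deriv γ x‖ = r) {Ψ : (ℝ → ℝ) → ℝ}
    (hΨ : ∀ g : ℝ → ℝ, IsH1per g → Ψ g = -(1 / 2) * ∫ x, (deriv g x *
      ⟪coeffC δ lam r (deriv γ x) (deriv (deriv γ) x) (deriv η x), η x⟫ +
      g x * ⟪coeffC δ lam r (deriv γ x) (deriv (deriv γ) x) (deriv η x), deriv η x⟫) ∂perVol) :
    IsRepresentedBy γ Ψ (fun x => psi0 δ lam (y x)) (fun x => psi1 δ (y x)) := by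
  intro g hg
  have hr := h.pos.ne'
  rw [hΨ g hg, arcIntegral, integral_period, ← integral_const_mul]
  congr 1 with x
  have hu := h.unit x
  simp only [coeffC, h.bendDensity_eq, arcDeriv, hs x]
  simp only [plane_inner, (h.hasDerivAt_point x).deriv,
    (h.hasDerivAt_director x).deriv, h.director0, h.director1, psi0, psi1, s, d, PiLp.add_apply,
    PiLp.smul_apply, smul_eq_mul]
  simp
  field_simp
  linear_combination (-(g x) * r * lam * om δ lam (y x) ^ 2) * hu

end IsStateSolution

end

theorem theorem4p9 (δ lam A₀ : ℝ) (hlam : 0 < lam) :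
    -- (i) critical points of the energy E_LM under the area and unit length constraints
    (∃ C : ℕ → ℝ → ℝ → ℝ → ℝ, ∀ γ η : ℝ → Plane,
      IsH2imm γ → IsArcProportional γ → IsH1per η →
      IsConstrainedCritical (energyLM δ lam) ![curveArea] ![A₀] γ η →
      IsSmoothPer γ ∧ IsSmoothPer η ∧
      (∃ (μ : Fin 1 → ℝ) (Ψ : (ℝ → ℝ) → ℝ),
        IsLagrangeMultiplier (energyLM δ lam) ![curveArea] γ η μ Ψ) ∧
      ∀ (μ : Fin 1 → ℝ) (Ψ : (ℝ → ℝ) → ℝ),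
        IsLagrangeMultiplier (energyLM δ lam) ![curveArea] γ η μ Ψ →
        ∃ ψ₀ ψ₁ : ℝ → ℝ, IsSmoothPer ψ₀ ∧ IsSmoothPer ψ₁ ∧ IsRepresentedBy γ Ψ ψ₀ ψ₁ ∧
          ∀ M₁ M₂ M₃ : ℝ, hNorm 2 γ ≤ M₁ → hNorm 1 η ≤ M₂ → hMinusOneNorm Ψ ≤ M₃ →
            ∀ k : ℕ, totalNorm k γ η ψ₀ ψ₁ ≤ ENNReal.ofReal (C k M₁ M₂ M₃)) ∧
    -- (ii) critical points of the energy E under the length, area and unit length constraints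
    (∀ L₀ : ℝ, 0 < L₀ → A₀ ∈ Icc (-(L₀ ^ 2 / (4 * Real.pi))) (L₀ ^ 2 / (4 * Real.pi)) →
      ∃ (C : ℕ → ℝ → ℝ → ℝ → ℝ) (D : ℕ → ℝ → ℝ → ℝ → ℝ → ℝ), ∀ γ η : ℝ → Plane,
      IsH2imm γ → IsArcProportional γ → IsH1per η → ¬ HasConstCurvature γ →
      IsConstrainedCritical (energyE δ lam) ![curveLength, curveArea] ![L₀, A₀] γ η →
      IsSmoothPer γ ∧ IsSmoothPer η ∧
      (∃ (μ : Fin 2 → ℝ) (Ψ : (ℝ → ℝ) → ℝ),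
        IsLagrangeMultiplier (energyE δ lam) ![curveLength, curveArea] γ η μ Ψ) ∧
      ∀ (μ : Fin 2 → ℝ) (Ψ : (ℝ → ℝ) → ℝ),
        IsLagrangeMultiplier (energyE δ lam) ![curveLength, curveArea] γ η μ Ψ →
        ∃ ψ₀ ψ₁ : ℝ → ℝ, IsSmoothPer ψ₀ ∧ IsSmoothPer ψ₁ ∧ IsRepresentedBy γ Ψ ψ₀ ψ₁ ∧
          ∀ M₁ M₂ M₃ : ℝ, hNorm 2 γ ≤ M₁ → hNorm 1 η ≤ M₂ → hMinusOneNorm Ψ ≤ M₃ →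
            -- the bound, if no circle, however often covered, has length L₀ and area A₀
            ((∀ n : ℕ, 1 ≤ n → |A₀| ≠ L₀ ^ 2 / (4 * Real.pi * n)) →
              ∀ k : ℕ, totalNorm k γ η ψ₀ ψ₁ ≤ ENNReal.ofReal (C k M₁ M₂ M₃)) ∧
            -- in general the bound also involves the multiplier of the length constraint
            (∀ M₄ : ℝ, |μ 0| ≤ M₄ →
              ∀ k : ℕ, totalNorm k γ η ψ₀ ψ₁ ≤ ENNReal.ofReal (D k M₁ M₂ M₃ M₄))) := by
  obtain ⟨K, hK⟩ := exists_totalNorm_bound δ lam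
  refine ⟨?_, fun L₀ hL₀ _ => ?_⟩
  · obtain ⟨r₀, hr₀, hlow⟩ := exists_speed_lower δ A₀ hlam
    -- The last argument 1 bounds the length multiplier, which is 1 for `energyLM`.
    choose B hB using fun M₁ M₂ => exists_state_bound_of_hNorm δ hlam hr₀ M₁ M₂ 1
    refine ⟨fun k M₁ M₂ _ => K k (B M₁ M₂), fun γ η hγ hs hη hc => ?_⟩
    have hr := hs.speed_pos hγ
    have hF := hasFirstVariation_energyLM (δ := δ) (lam := lam) hγ.1 hη hr hs
    have hy : ∀ (μ : Fin 1 → ℝ) (Ψ : (ℝ → ℝ) → ℝ),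
        IsLagrangeMultiplier (energyLM δ lam) ![curveArea] γ η μ Ψ →
        ∃ y, IsStateSolution δ lam (curveLength γ / (2 * Real.pi)) 1 (μ 0) γ η y := by
      intro μ Ψ hm
      refine hF.exists_state hlam hm (fun x => ?_) hγ.1 hr hs hc.unit
      simp [add_assoc]
    have hm := hF.exists_multipliers hc
    obtain ⟨y, h⟩ : ∃ y a, IsStateSolution δ lam _ 1 a γ η y := by
      obtain ⟨μ, Ψ, hm⟩ := hm
      exact (hy μ Ψ hm).imp fun y h => ⟨_, h⟩
    obtain ⟨a, h⟩ := h
    refine ⟨h.isSmoothPer_point, h.isSmoothPer_director, hm, fun μ Ψ hm => ?_⟩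
    -- Any multipliers serve to prove that γ and η are smooth. For the bounds, the state is built
    -- anew from the multipliers under consideration.
    obtain ⟨y, h⟩ := hy μ Ψ hm
    refine ⟨_, _, h.isSmoothPer_comp (SolState.contDiff_psi0 δ lam), h.isSmoothPer_comp (SolState.contDiff_psi1 δ),
      h.isRepresentedBy hs fun g hg => hF.multiplier_eq hm
        (fun x => sub_eq_zero.1 (hc.unit x)) hg, fun M₁ M₂ M₃ h₁ h₂ _ k => ?_⟩
    have hb := hB M₁ M₂ _ _ _ _ _ y h (hlow _ _ _ _ _ h (hc.constraint 0)) h₁ h₂ (by simp)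
    have := hK y _ h.ode hb k
    rwa [← h.point_eq, ← h.director_eq] at this
  · obtain ⟨r, hrdef⟩ : ∃ r, r = L₀ / (2 * Real.pi) := ⟨_, rfl⟩
    have hr : 0 < r := by rw [hrdef]; positivity
    choose B hB using exists_state_bound_of_hNorm δ hlam hr
    -- The bound N for ℓ matters only away from multiply covered circles; the value 0 in the
    -- exceptional case is never used. In terms of r = L₀/(2π) the excluded areas satisfy |A₀| n =
    -- πr².
    obtain ⟨N, hN⟩ : ∃ N : ℝ → ℝ → ℝ, (∀ n : ℕ, 1 ≤ n → |A₀| ≠ L₀ ^ 2 / (4 * Real.pi * n)) →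
        ∀ (M₁ M₂ ℓ a : ℝ) (γ η : ℝ → Plane) (y : ℝ → SolState),
          IsStateSolution δ lam r ℓ a γ η y → curveArea γ = A₀ → hNorm 2 γ ≤ M₁ →
          hNorm 1 η ≤ M₂ → |ℓ| ≤ N M₁ M₂ := by
      by_cases hA : ∀ n : ℕ, 1 ≤ n → |A₀| ≠ L₀ ^ 2 / (4 * Real.pi * n)
      · choose N hN using exists_length_multiplier_bound δ A₀ hlam hr (fun n hn h => hA n hn (by
          have hn0 : (0 : ℝ) < n := by exact_mod_cast hn
          have hpi := Real.pi_pos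
          rw [eq_div_iff (by positivity), show |A₀| * (4 * Real.pi * n) = 4 * Real.pi * (|A₀| * n) by
            ring, h, hrdef]
          field_simp
          norm_num))
        exact ⟨N, fun _ => hN⟩
      · exact ⟨fun _ _ => 0, fun h => absurd h hA⟩
    refine ⟨fun k M₁ M₂ _ => K k (B M₁ M₂ (N M₁ M₂)), fun k M₁ M₂ _ M₄ => K k (B M₁ M₂ M₄),
      fun γ η hγ hs hη _ hc => ?_⟩
    -- The length constraint fixes the speed, so r serves as its own lower bound.
    have hs : ∀ x, ‖deriv γ x‖ = r := fun x => by
      rw [hs x, hrdef, show curveLength γ = L₀ from hc.constraint 0]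
    have hF := hasFirstVariation_energyE (δ := δ) (lam := lam) hγ.1 hη hr hs
    have hy : ∀ (μ : Fin 2 → ℝ) (Ψ : (ℝ → ℝ) → ℝ),
        IsLagrangeMultiplier (energyE δ lam) ![curveLength, curveArea] γ η μ Ψ →
        ∃ y, IsStateSolution δ lam r (μ 0) (μ 1) γ η y := by
      intro μ Ψ hm
      refine hF.exists_state hlam hm (fun x => ?_) hγ.1 hr hs hc.unit
      simp
    have hm := hF.exists_multipliers hc
    obtain ⟨y, ℓ, a, h⟩ : ∃ y ℓ a, IsStateSolution δ lam r ℓ a γ η y := by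
      obtain ⟨μ, Ψ, hm⟩ := hm
      exact (hy μ Ψ hm).imp fun y h => ⟨_, _, h⟩
    refine ⟨h.isSmoothPer_point, h.isSmoothPer_director, hm, fun μ Ψ hm => ?_⟩
    obtain ⟨y, h⟩ := hy μ Ψ hm
    refine ⟨_, _, h.isSmoothPer_comp (SolState.contDiff_psi0 δ lam), h.isSmoothPer_comp (SolState.contDiff_psi1 δ),
      h.isRepresentedBy hs fun g hg => hF.multiplier_eq hm
        (fun x => sub_eq_zero.1 (hc.unit x)) hg, fun M₁ M₂ M₃ h₁ h₂ _ => ?_⟩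
    have key : ∀ M₄, |μ 0| ≤ M₄ → ∀ k : ℕ, totalNorm k γ η (fun x => SolState.psi0 δ lam (y x))
        (fun x => SolState.psi1 δ (y x)) ≤ ENNReal.ofReal (K k (B M₁ M₂ M₄)) := by
      intro M₄ h₄ k
      have := hK y _ h.ode (hB M₁ M₂ M₄ _ _ _ _ _ y h le_rfl h₁ h₂ h₄) k
      rwa [← h.point_eq, ← h.director_eq] at this
    exact ⟨fun hA => key _ (hN hA M₁ M₂ _ _ _ _ y h (hc.constraint 1) h₁ h₂), key⟩
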